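/- **Setting.** Let $(\mathbf X_t)_{t\in\mathbb Z}$ be a strictly stationary sequence of $\mathbb R^d$-valued random vectors, $\mathbf X=\mathbf X_0$, $|\cdot|$ the Euclidean norm, $\overline{\mathbb R}=\mathbb R\cup\{\pm\infty\}$ and $\overline{\mathbb R}{}^{k}_0=\overline{\mathbb R}{}^{k}\setminus\{\mathbf 0\}$. Assume that $(\mathbf X_t)$ is regularly varying with index $\alpha>0$: for every $h\ge 1$ and $\mathbf Y_h=\mathrm{vec}(\mathbf X_1,\dots,\mathbf X_h)$ there is a non-null Radon measure $\mu_h$ on $\overline{\mathbb R}{}^{hd}_0$ with $\mu_h(tB)=t^{-\alpha}\mu_h(B)$ for all $t>0$ and Borel sets $B$, such that $$\frac{P(x^{-1}\mathbf Y_h\in\cdot)}{P(|\mathbf Y_h|>x)}\xrightarrow{v}\mu_h(\cdot)\qquad(x\to\infty).$$ Write $\mu=\mu_1$. Let $a_n\to\infty$ with $nP(|\mathbf X|>a_n)\to 1$, and put $\nu_h=c_h\mu_h$ with $c_h=\lim_n nP(|\mathbf Y_h|>a_n)$, so that $\nu_h$ is the vague limit of $nP(a_n^{-1}\mathbf Y_h\in\cdot)$.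 Let $\alpha_h=\sup\{|P(A\cap B)-P(A)P(B)| : A\in\sigma(\mathbf X_t,t\le 0),\ B\in\sigma(\mathbf X_t,t\ge h)\}$ and assume $\alpha_h\to0$. Let $m_n,r_n$ be integer sequences with $m_n,r_n\to\infty$, $m_n/n\to0$, $r_n/m_n\to0$; write $m=m_n$ in subscripts and $a_m=a_{m_n}$. Assume $$\lim_{n\to\infty}m_n\sum_{h=r_n}^\infty\alpha_h=0,\qquad \lim_{k\to\infty}\limsup_{n\to\infty}m_n\sum_{h=k}^{r_n}P(|\mathbf X_h|>\epsilon a_m,\ |\mathbf X_0|>\epsilon a_m)=0\quad\text{for all }\epsilon>0,$$ $$\frac{n}{m_n}\alpha_{r_n}\to0,$$ and at least one of the following two conditions: (i) $m_n=o(n^{1/3})$; (ii) $\frac{m_n^4}{n}\sum_{j=r_n}^{m_n}\alpha_j\to0$ and $\frac{m_nr_n^3}{n}\to0$. Let $D_1,\dots,D_h$ and $C=D_{h+1}$ be Borel subsets of $\overline{\mathbb R}{}^d_0$ that are bounded away from zero and satisfy $\mu(\partial D_i)=0$ for $i=1,\dots,h+1$, and let $\mu(C)>0$. Put $$\widehat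 P_m(B)=\frac{m_n}{n}\sum_{t=1}^n I_{\{\mathbf X_t/a_m\in B\}},\quad \widehat R_m(C,D_i)=\frac{\widehat P_m(D_i)}{\widehat P_m(C)},\quad R_m(C,D_i)=\frac{P(a_m^{-1}\mathbf X\in D_i)}{P(a_m^{-1}\mathbf X\in C)},\quad R(C,D_i)=\frac{\mu(D_i)}{\mu(C)}.$$ For $\ell\ge1$ let $\tau_\ell(A,B)=\nu_{\ell+1}(A\times\overline{\mathbb R}{}^{d(\ell-1)}\times B)$, and let $\Sigma=(r_{D_i,D_j})_{i,j=1}^{h+1}$ with $$r_{A,B}=\mu(A\cap B)+\sum_{\ell=1}^\infty\big[\tau_\ell(A,B)+\tau_\ell(B,A)\big];$$ in particular, the diagonal entries are $\sigma^2(D_i)=\mu(D_i)+2\sum_{\ell\ge1}\tau_\ell(D_i,D_i)$. Let $F$ be the $h\times(h+1)$ matrix with $F_{ii}=\mu(C)$, $F_{i,h+1}=-\mu(D_i)$ for $i=1,\dots,h$, and all other entries zero. **Corollary 3.3.** The series $\sum_{\ell}\tau_\ell(D_i,D_j)$, $1\le i,j\le h+1$, converge, the matrix $\mu(C)^{-4}F\Sigma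 F'$ is symmetric and positive semidefinite, and $$\Big(\frac n{m_n}\Big)^{1/2}\big[\widehat R_m(C,D_i)-R_m(C,D_i)\big]_{i=1,\dots,h}\xrightarrow{d}N\big(\mathbf 0,\mu(C)^{-4}F\Sigma F'\big).$$ If, in addition, $$\lim_{n\to\infty}\sqrt{nm_n}\,\big[\mu(D_i)P(a_m^{-1}\mathbf X\in C)-\mu(C)P(a_m^{-1}\mathbf X\in D_i)\big]=0,\qquad i=1,\dots,h,$$ then $$\Big(\frac n{m_n}\Big)^{1/2}\big[\widehat R_m(C,D_i)-R(C,D_i)\big]_{i=1,\dots,h}\xrightarrow{d}N\big(\mathbf 0,\mu(C)^{-4}F\Sigma F'\big).$$ -/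

import Mathlib

open MeasureTheory ProbabilityTheory Filter Topology
open scoped ENNReal

namespace Extremogram

noncomputable section

variable {Ω : Type*} [MeasurableSpace Ω] {d : ℕ}

/-- Points of `[-∞, ∞]^{hd}`, grouped as `h` blocks of length `d`.  Measures on the punctured space
`[-∞, ∞]^{hd} \ {0}` are encoded as measures on this space that do not charge `{0}`. -/
abbrev ExtSpace (h d : ℕ) : Type := Fin h → Fin d → EReal

/-- `x⁻¹ v`, as a point of `[-∞, ∞]^d`. -/
def scaled (x : ℝ) (v : EuclideanSpace ℝ (Fin d)) : Fin d → EReal :=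
  fun j => ((x⁻¹ * v j : ℝ) : EReal)

/-- `x⁻¹ Y_h`, where `Y_h = vec(X_1, …, X_h)`, as a point of `[-∞, ∞]^{hd}`. -/
def scaledStack (X : ℤ → Ω → EuclideanSpace ℝ (Fin d)) (h : ℕ) (x : ℝ) (ω : Ω) : ExtSpace h d :=
  fun i => scaled x (X ((i : ℤ) + 1) ω)

/-- The Euclidean norm `|Y_h|` of `Y_h = vec(X_1, …, X_h)`. -/
def stackNorm (X : ℤ → Ω → EuclideanSpace ℝ (Fin d)) (h : ℕ) (ω : Ω) : ℝ :=
  Real.sqrt (∑ i : Fin h, ‖X ((i : ℤ) + 1) ω‖ ^ 2)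

/-- Strict stationarity: the law of the whole sequence is invariant under time shifts. -/
def IsStrictlyStationary (P : Measure Ω) (X : ℤ → Ω → EuclideanSpace ℝ (Fin d)) : Prop :=
  ∀ s : ℤ, IdentDistrib (fun ω t => X (t + s) ω) (fun ω t => X t ω) P P

/-- A non-null Radon measure `μ` on `[-∞, ∞]^{hd} \ {0}` (finite on the compact subsets of the
punctured space) such that `μ(tC) = t^{-α} μ(C)` for all `t > 0` and all Borel sets `C`. -/
structure IsLimitMeasure {h : ℕ} (α : ℝ) (μ : Measure (ExtSpace h d)) : Prop where
  singleton_zero : μ {0} = 0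
  ne_zero : μ ≠ 0
  lt_top_of_isCompact : ∀ K : Set (ExtSpace h d), IsCompact K → 0 ∉ K → μ K < ∞
  homogeneous : ∀ t : ℝ, 0 < t → ∀ C : Set (ExtSpace h d), MeasurableSet C →
    μ ((fun y i j => (t : EReal) * y i j) '' C) = ENNReal.ofReal (t ^ (-α)) * μ C

/-- The sequence `(X_t)` is regularly varying with index `α`, with limit measures `μ h`, `h ≥ 1`:
`P(x⁻¹ Y_h ∈ ·) / P(|Y_h| > x)` converges vaguely to `μ h` on `[-∞, ∞]^{hd} \ {0}` as `x → ∞`.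
The test functions are the continuous functions with compact support in the punctured space, that
is, the continuous functions on the compact space `[-∞, ∞]^{hd}` whose closed support misses `0`. -/
def IsRegularlyVarying (P : Measure Ω) (X : ℤ → Ω → EuclideanSpace ℝ (Fin d)) (α : ℝ)
    (μ : (h : ℕ) → Measure (ExtSpace h d)) : Prop :=
  ∀ h : ℕ, 1 ≤ h → IsLimitMeasure α (μ h) ∧
    ∀ f : ExtSpace h d → ℝ, Continuous f → 0 ∉ tsupport f →
      Tendsto (fun x : ℝ => (∫ ω, f (scaledStack X h x ω) ∂P) / P.real {ω | x < stackNorm X h ω})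
        atTop (𝓝 (∫ y, f y ∂(μ h)))

/-- The constant `c_h = lim_n n P(|Y_h| > a_n)`. -/
def scaleConst (P : Measure Ω) (X : ℤ → Ω → EuclideanSpace ℝ (Fin d)) (a : ℕ → ℝ) (h : ℕ) : ℝ :=
  limUnder atTop (fun n : ℕ => (n : ℝ) * P.real {ω | a n < stackNorm X h ω})

/-- The measure `ν_h = c_h μ_h`, the vague limit of `n P(a_n⁻¹ Y_h ∈ ·)`. -/
def nu (P : Measure Ω) (X : ℤ → Ω → EuclideanSpace ℝ (Fin d)) (a : ℕ → ℝ)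
    (μ : (h : ℕ) → Measure (ExtSpace h d)) (h : ℕ) : Measure (ExtSpace h d) :=
  ENNReal.ofReal (scaleConst P X a h) • μ h

/-- The limit measure `μ = μ_1` of a single observation, as a measure on `[-∞, ∞]^d`. -/
def marginal (μ : (h : ℕ) → Measure (ExtSpace h d)) : Measure (Fin d → EReal) :=
  (μ 1).map (fun y => y 0)

/-- The `α`-mixing coefficient
`α_h = sup |P(A ∩ B) - P(A) P(B)|`, over `A ∈ σ(X_t, t ≤ 0)` and `B ∈ σ(X_t, t ≥ h)`. -/
def alphaMixingCoeff (P : Measure Ω) (X : ℤ → Ω → EuclideanSpace ℝ (Fin d)) (h : ℕ) : ℝ :=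
  sSup {q : ℝ | ∃ A B : Set Ω,
    MeasurableSet[⨆ t : {t : ℤ // t ≤ 0}, MeasurableSpace.comap (X t) inferInstance] A ∧
    MeasurableSet[⨆ t : {t : ℤ // (h : ℤ) ≤ t}, MeasurableSpace.comap (X t) inferInstance] B ∧
    q = |P.real (A ∩ B) - P.real A * P.real B|}

/-- Mixing and anti-clustering condition on `(X_t)` along the integer sequences `m`, `r`, for the
thresholds `a`.  The series and the upper limits are taken in `[0, ∞]`. -/
structure MixingCondition (P : Measure Ω) (X : ℤ → Ω → EuclideanSpace ℝ (Fin d)) (a : ℕ → ℝ)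
    (m r : ℕ → ℕ) : Prop where
  alpha_mixing : Tendsto (alphaMixingCoeff P X) atTop (𝓝 0)
  tendsto_m : Tendsto m atTop atTop
  tendsto_r : Tendsto r atTop atTop
  m_div_n : Tendsto (fun n : ℕ => (m n : ℝ) / n) atTop (𝓝 0)
  r_div_m : Tendsto (fun n : ℕ => (r n : ℝ) / m n) atTop (𝓝 0)
  mixing_rate : Tendsto
    (fun n : ℕ => (m n : ℝ≥0∞) * ∑' j : ℕ, ENNReal.ofReal (alphaMixingCoeff P X (r n + j)))
    atTop (𝓝 0)
  anti_clustering : ∀ ε : ℝ, 0 < ε → Tendsto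
    (fun k : ℕ => limsup (fun n : ℕ => (m n : ℝ≥0∞) * ∑ h ∈ Finset.Icc k (r n),
      P {ω | ε * a (m n) < ‖X (h : ℤ) ω‖ ∧ ε * a (m n) < ‖X 0 ω‖}) atTop)
    atTop (𝓝 0)

/-- Growth conditions for the central limit theorem: `(n / m_n) α_{r_n} → 0`, and either
`m_n = o(n^{1/3})`, or both `(m_n⁴ / n) ∑_{j=r_n}^{m_n} α_j → 0` and `m_n r_n³ / n → 0`. -/
def GrowthCondition (P : Measure Ω) (X : ℤ → Ω → EuclideanSpace ℝ (Fin d))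
    (m r : ℕ → ℕ) : Prop :=
  Tendsto (fun n : ℕ => (n : ℝ) / m n * alphaMixingCoeff P X (r n)) atTop (𝓝 0) ∧
  ((fun n : ℕ => (m n : ℝ)) =o[atTop] (fun n : ℕ => (n : ℝ) ^ (1 / 3 : ℝ)) ∨
    (Tendsto (fun n : ℕ => (m n : ℝ) ^ 4 / n *
        ∑ j ∈ Finset.Icc (r n) (m n), alphaMixingCoeff P X j) atTop (𝓝 0) ∧
      Tendsto (fun n : ℕ => (m n : ℝ) * (r n : ℝ) ^ 3 / n) atTop (𝓝 0)))

/-- A Borel subset of `[-∞, ∞]^d` that is bounded away from zero and a `μ`-continuity set. -/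
structure IsAdmissible (μ : Measure (Fin d → EReal)) (C : Set (Fin d → EReal)) : Prop where
  measurableSet : MeasurableSet C
  bounded_away : 0 ∉ closure C
  continuity : μ (frontier C) = 0

/-- The probability `P(a_m⁻¹ X ∈ C)`, with `X = X_0` and `m = m_n`. -/
def tailProb (P : Measure Ω) (X : ℤ → Ω → EuclideanSpace ℝ (Fin d)) (a : ℕ → ℝ) (m : ℕ → ℕ)
    (C : Set (Fin d → EReal)) (n : ℕ) : ℝ :=
  P.real {ω | scaled (a (m n)) (X 0 ω) ∈ C}

open scoped Classical in
/-- The estimator `(m_n / n) ∑_{t=1}^n 1{X_t / a_m ∈ C}` of `μ(C)`. -/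
def Phat (X : ℤ → Ω → EuclideanSpace ℝ (Fin d)) (a : ℕ → ℝ) (m : ℕ → ℕ)
    (C : Set (Fin d → EReal)) (n : ℕ) (ω : Ω) : ℝ :=
  (m n : ℝ) / n * ∑ t ∈ Finset.Icc 1 n, if scaled (a (m n)) (X (t : ℤ) ω) ∈ C then 1 else 0

/-- The ratio estimator `P̂_m(D) / P̂_m(C)`. -/
def Rhat (X : ℤ → Ω → EuclideanSpace ℝ (Fin d)) (a : ℕ → ℝ) (m : ℕ → ℕ)
    (C D : Set (Fin d → EReal)) (n : ℕ) (ω : Ω) : ℝ :=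
  Phat X a m D n ω / Phat X a m C n ω

/-- The pre-asymptotic ratio `P(a_m⁻¹ X ∈ D) / P(a_m⁻¹ X ∈ C)`. -/
def Rpre (P : Measure Ω) (X : ℤ → Ω → EuclideanSpace ℝ (Fin d)) (a : ℕ → ℝ) (m : ℕ → ℕ)
    (C D : Set (Fin d → EReal)) (n : ℕ) : ℝ :=
  tailProb P X a m D n / tailProb P X a m C n

/-- The ratio `R(C, D) = μ(D) / μ(C)`. -/
def ratio (μ : Measure (Fin d → EReal)) (C D : Set (Fin d → EReal)) : ℝ :=
  μ.real D / μ.real C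

/-- `τ_ℓ(A, B) = ν_{ℓ+1}(A × [-∞, ∞]^{d(ℓ-1)} × B)`, for `ℓ ≥ 1`. -/
def tau (ν : (h : ℕ) → Measure (ExtSpace h d)) (A B : Set (Fin d → EReal)) (ℓ : ℕ) : ℝ :=
  (ν (ℓ + 1)).real {y | y 0 ∈ A ∧ y (Fin.last ℓ) ∈ B}

/-- The asymptotic covariance
`r_{A,B} = μ(A ∩ B) + ∑_{ℓ ≥ 1} (τ_ℓ(A, B) + τ_ℓ(B, A))`; for `A = B` it is
`σ²(A) = μ(A) + 2 ∑_{ℓ ≥ 1} τ_ℓ(A, A)`. -/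
def asympCov (μ : Measure (Fin d → EReal)) (ν : (h : ℕ) → Measure (ExtSpace h d))
    (A B : Set (Fin d → EReal)) : ℝ :=
  μ.real (A ∩ B) + ∑' ℓ : ℕ, (tau ν A B (ℓ + 1) + tau ν B A (ℓ + 1))

/-- The `(h+1) × (h+1)` matrix `Σ = (r_{D_i, D_j})`, for sets `D_1, …, D_h, D_{h+1}`. -/
def SigmaMat {h : ℕ} (μ : Measure (Fin d → EReal)) (ν : (h : ℕ) → Measure (ExtSpace h d))
    (D : Fin (h + 1) → Set (Fin d → EReal)) : Matrix (Fin (h + 1)) (Fin (h + 1)) ℝ :=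
  fun i j => asympCov μ ν (D i) (D j)

/-- The `h × (h+1)` matrix `F` with `μ(D_{h+1})` on the diagonal, last column
`(-μ(D_1), …, -μ(D_h))`, and zeros elsewhere. -/
def FMat {h : ℕ} (μ : Measure (Fin d → EReal)) (D : Fin (h + 1) → Set (Fin d → EReal)) :
    Matrix (Fin h) (Fin (h + 1)) ℝ :=
  fun i j => if j = Fin.last h then -μ.real (D i.castSucc)
    else if j = i.castSucc then μ.real (D (Fin.last h)) else 0

/-- The covariance matrix `μ(D_{h+1})⁻⁴ F Σ Fᵀ` of the limit law. -/
def limitCov {h : ℕ} (μ : Measure (Fin d → EReal)) (ν : (h : ℕ) → Measure (ExtSpace h d))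
    (D : Fin (h + 1) → Set (Fin d → EReal)) : Matrix (Fin h) (Fin h) ℝ :=
  ((μ.real (D (Fin.last h))) ^ 4)⁻¹ • (FMat μ D * SigmaMat μ ν D * (FMat μ D).transpose)

end

end Extremogram

/-!
Let `φ` be a linear combination of the indicators of the events `a_m⁻¹ x ∈ D_j`. The suitably
normalized sums `∑_{t ≤ n} φ(X_t)` are handled by Bernstein's method: `1, …, n` is cut into about
`n / m_n` big blocks separated by small blocks of length `r_n`. The small blocks are negligible in
`L²`, and since `(n / m_n) α_{r_n} → 0` the characteristic function of the sum over the big blocks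
is asymptotically the `⌊n / m_n⌋`-th power of that of a single block. Regular variation identifies
the limit of `m_n E[φ(X_0) φ(X_ℓ)]` for each fixed lag `ℓ`, while the anti-clustering and mixing
conditions make the sums over large lags uniformly small; together they give the limit of the
variance of a block. Its third absolute moment is negligible under either growth condition, so a
Taylor expansion of the characteristic function of a block yields a Gaussian limit.

By the Cramér–Wold device the vector of the normalized estimators `P̂_m(D_j)` is asymptotically
`N(0, Σ)`, where `Σ` is positive semidefinite as a limit of covariance matrices. As
`P̂_m(C) → μ(C)` in probability, the ratios follow from Slutsky's theorem; the bias condition allows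
one to replace `R_m` by `R`.
-/

namespace Extremogram

section VagueConvergence

open scoped BoundedContinuousFunction

lemma tendsto_finiteMeasure_of_null_frontier {S ι : Type*} [MeasurableSpace S]
    [TopologicalSpace S] [OpensMeasurableSpace S] [HasOuterApproxClosed S] {L : Filter ι}
    {M : ι → FiniteMeasure S} {M₀ : FiniteMeasure S} (hM : Tendsto M L (𝓝 M₀)) {E : Set S}
    (hE : M₀ (frontier E) = 0) : Tendsto (fun i => M i E) L (𝓝 (M₀ E)) := by
  have hmass : Tendsto (fun i => (M i).mass) L (𝓝 M₀.mass) := hM.mass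
  rcases eq_or_ne M₀ 0 with rfl | hM₀
  · simp only [FiniteMeasure.zero_mass] at hmass
    exact tendsto_of_tendsto_of_tendsto_of_le_of_le tendsto_const_nhds hmass
      (fun _ => zero_le) fun i => (M i).apply_le_mass E
  · have : Nonempty S := not_isEmpty_iff.1 fun _ =>
      hM₀ (Subtype.ext (Measure.eq_zero_of_isEmpty _))
    have hfr : M₀.normalize (frontier E) = 0 := by
      rw [M₀.normalize_eq_of_nonzero hM₀, hE, mul_zero]
    simp only [FiniteMeasure.self_eq_mass_mul_normalize _ E]
    exact hmass.mul (ProbabilityMeasure.tendsto_measure_of_null_frontier_of_tendsto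
      (FiniteMeasure.tendsto_normalize_of_tendsto hM hM₀) hfr)

variable {S : Type*} [TopologicalSpace S] {z : S}

lemma exists_continuous_eq_one_of_notMem [T4Space S] {K : Set S} (hK : IsClosed K) (hz : z ∉ K) :
    ∃ χ : S → ℝ, Continuous χ ∧ z ∉ tsupport χ ∧ (∀ x ∈ K, χ x = 1) ∧
      ∀ x, χ x ∈ Set.Icc 0 1 := by
  obtain ⟨V, hVo, hzV, hVK⟩ := normal_exists_closure_subset (isClosed_singleton (x := z))
    hK.isOpen_compl (by simpa using hz)
  obtain ⟨χ, hχV, hχK, hχ⟩ := exists_continuous_zero_one_of_isClosed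
    (isClosed_closure (s := V)) hK (Set.disjoint_left.2 fun x hx hxK => hVK hx hxK)
  have hsupp : tsupport χ ⊆ Vᶜ :=
    closure_minimal (fun x hx hxV => hx (hχV (subset_closure hxV))) hVo.isClosed_compl
  exact ⟨χ, χ.continuous, fun h => hsupp h (hzV rfl), fun x hx => hχK hx, hχ⟩

lemma notMem_tsupport_mul {χ g : S → ℝ} (hz : z ∉ tsupport χ) :
    z ∉ tsupport fun x => χ x * g x := fun h =>
  hz (closure_mono (Function.support_mul_subset_left χ g) h)

variable [MeasurableSpace S]

/-- The Radon condition on the punctured space `S \ {z}`, for a measure encoded on all of `S`. -/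
def IsFiniteAwayFrom (z : S) (ν : Measure S) : Prop :=
  ∀ K : Set S, IsCompact K → z ∉ K → ν K < ∞

lemma IsFiniteAwayFrom.of_isFiniteMeasure (ν : Measure S) [IsFiniteMeasure ν] :
    IsFiniteAwayFrom z ν := fun _ _ _ => measure_lt_top _ _

lemma IsFiniteAwayFrom.lt_top_of_notMem_closure [CompactSpace S] {ν : Measure S}
    (hν : IsFiniteAwayFrom z ν) {E : Set S} (hz : z ∉ closure E) : ν E < ∞ :=
  (measure_mono subset_closure).trans_lt (hν _ isClosed_closure.isCompact hz)

variable [BorelSpace S]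

lemma IsFiniteAwayFrom.integrable [CompactSpace S] {ν : Measure S} (hν : IsFiniteAwayFrom z ν)
    {f : S → ℝ} (hf : Continuous f) (hz : z ∉ tsupport f) : Integrable f ν := by
  rw [← integrableOn_iff_integrable_of_support_subset (subset_tsupport f)]
  obtain ⟨c, hc⟩ := isCompact_univ.exists_bound_of_continuousOn hf.continuousOn
  exact Measure.integrableOn_of_bounded (M := c)
    (hν _ (isClosed_tsupport f).isCompact hz).ne hf.aestronglyMeasurable
    (ae_of_all _ fun x => hc x trivial)

/-- The measure `χ ν`; a cutoff `χ` vanishing near `z` turns vague convergence on `S \ {z}` into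
weak convergence of finite measures. -/
noncomputable def cutoff (χ : S → ℝ) (ν : Measure S) : Measure S :=
  ν.withDensity fun x => ENNReal.ofReal (χ x)

section Cutoff

variable {χ : S → ℝ} {ν : Measure S}

omit [BorelSpace S] [TopologicalSpace S] in
lemma cutoff_apply_of_eq_one {E : Set S} (hE : MeasurableSet E) (hχ : ∀ x ∈ E, χ x = 1) :
    cutoff χ ν E = ν E := by
  rw [cutoff, withDensity_apply _ hE, setLIntegral_congr_fun (g := fun _ => 1) hE
    (fun x hx => by simp [hχ x hx]), setLIntegral_one]

lemma integral_cutoff (hχ : Continuous χ) (hχ0 : ∀ x, 0 ≤ χ x) (f : S → ℝ) :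
    ∫ x, f x ∂(cutoff χ ν) = ∫ x, χ x * f x ∂ν := by
  rw [cutoff, integral_withDensity_eq_integral_toReal_smul hχ.measurable.ennreal_ofReal
    (ae_of_all _ fun _ => ENNReal.ofReal_lt_top)]
  simp only [ENNReal.toReal_ofReal (hχ0 _), smul_eq_mul]

lemma IsFiniteAwayFrom.isFiniteMeasure_cutoff [CompactSpace S] (hν : IsFiniteAwayFrom z ν)
    (hχ : Continuous χ) (hz : z ∉ tsupport χ) : IsFiniteMeasure (cutoff χ ν) :=
  isFiniteMeasure_withDensity_ofReal (hν.integrable hχ hz).2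

end Cutoff

variable [CompactSpace S] [T4Space S] [HasOuterApproxClosed S]

/-- The cutoffs of `Q i` converge weakly, so the portmanteau theorem for finite measures applies. -/
theorem tendsto_real_of_tendsto_integral {ι : Type*} {L : Filter ι} {Q : ι → Measure S}
    {ν : Measure S} (hQ : ∀ i, IsFiniteAwayFrom z (Q i)) (hν : IsFiniteAwayFrom z ν)
    (hlim : ∀ f : S → ℝ, Continuous f → z ∉ tsupport f →
      Tendsto (fun i => ∫ x, f x ∂(Q i)) L (𝓝 (∫ x, f x ∂ν)))
    {E : Set S} (hE : MeasurableSet E) (hz : z ∉ closure E) (hfr : ν (frontier E) = 0) :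
    Tendsto (fun i => (Q i).real E) L (𝓝 (ν.real E)) := by
  obtain ⟨χ, hχ, hχz, hχ1, hχ01⟩ := exists_continuous_eq_one_of_notMem isClosed_closure hz
  have hχE : ∀ x ∈ E, χ x = 1 := fun x hx => hχ1 x (subset_closure hx)
  let M : ι → FiniteMeasure S := fun i => ⟨cutoff χ (Q i), (hQ i).isFiniteMeasure_cutoff hχ hχz⟩
  let M₀ : FiniteMeasure S := ⟨cutoff χ ν, hν.isFiniteMeasure_cutoff hχ hχz⟩
  have hM : Tendsto M L (𝓝 M₀) := by
    refine FiniteMeasure.tendsto_iff_forall_integral_tendsto.2 fun f => ?_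
    simp only [M, M₀, FiniteMeasure.toMeasure_mk, integral_cutoff hχ (fun x => (hχ01 x).1)]
    exact hlim _ (hχ.mul f.continuous) (notMem_tsupport_mul hχz)
  have hM₀ : M₀ (frontier E) = 0 := by
    rw [FiniteMeasure.null_iff_toMeasure_null]
    exact withDensity_absolutelyContinuous _ _ hfr
  have hreal : Tendsto (fun i => (M i E : ℝ)) L (𝓝 (M₀ E)) :=
    NNReal.tendsto_coe.2 (tendsto_finiteMeasure_of_null_frontier hM hM₀)
  have hQE : ∀ i, (Q i).real E = M i E := fun i =>
    congrArg ENNReal.toReal (cutoff_apply_of_eq_one hE hχE).symm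
  have hνE : ν.real E = M₀ E := congrArg ENNReal.toReal (cutoff_apply_of_eq_one hE hχE).symm
  simpa only [hQE, hνE] using hreal

lemma measure_eq_of_forall_integral_eq {ν ν' : Measure S} (hν : IsFiniteAwayFrom z ν)
    (hν' : IsFiniteAwayFrom z ν')
    (heq : ∀ f : S → ℝ, Continuous f → z ∉ tsupport f → ∫ x, f x ∂ν = ∫ x, f x ∂ν')
    {E : Set S} (hE : MeasurableSet E) (hz : z ∉ closure E) : ν E = ν' E := by
  obtain ⟨χ, hχ, hχz, hχ1, hχ01⟩ := exists_continuous_eq_one_of_notMem isClosed_closure hz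
  have hχE : ∀ x ∈ E, χ x = 1 := fun x hx => hχ1 x (subset_closure hx)
  have := hν.isFiniteMeasure_cutoff hχ hχz
  have := hν'.isFiniteMeasure_cutoff hχ hχz
  have hcut : cutoff χ ν = cutoff χ ν' :=
    ext_of_forall_integral_eq_of_IsFiniteMeasure fun f => by
      simp only [integral_cutoff hχ (fun x => (hχ01 x).1)]
      exact heq _ (hχ.mul f.continuous) (notMem_tsupport_mul hχz)
  rw [← cutoff_apply_of_eq_one hE hχE, hcut, cutoff_apply_of_eq_one hE hχE]

end VagueConvergence

section RegularVariation

variable {Ω : Type*} [MeasurableSpace Ω] {d : ℕ}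

lemma continuous_scaled (x : ℝ) :
    Continuous (scaled x : EuclideanSpace ℝ (Fin d) → Fin d → EReal) := by
  unfold scaled
  exact continuous_pi fun j => continuous_coe_real_ereal.comp (by fun_prop)

lemma measurable_scaled (x : ℝ) :
    Measurable (scaled x : EuclideanSpace ℝ (Fin d) → Fin d → EReal) :=
  (continuous_scaled x).measurable

lemma exists_norm_gt_of_scaled_mem {A : Set (Fin d → EReal)} (hA : 0 ∉ closure A) :
    ∃ ε : ℝ, 0 < ε ∧ ∀ (x : ℝ) (v : EuclideanSpace ℝ (Fin d)), 0 < x →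
      scaled x v ∈ A → ε * x < ‖v‖ := by
  have hzero : scaled 1 (0 : EuclideanSpace ℝ (Fin d)) = 0 := by ext j; simp [scaled]
  have hnhds : (scaled 1 : EuclideanSpace ℝ (Fin d) → _) ⁻¹' (closure A)ᶜ ∈ 𝓝 0 := by
    refine (continuous_scaled 1).continuousAt.preimage_mem_nhds ?_
    rw [hzero]
    exact isClosed_closure.isOpen_compl.mem_nhds hA
  obtain ⟨ε, hε, hball⟩ := Metric.nhds_basis_closedBall.mem_iff.1 hnhds
  refine ⟨ε, hε, fun x v hx hv => lt_of_not_ge fun hle => ?_⟩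
  have hscale : scaled 1 (x⁻¹ • v) = scaled x v := by ext j; simp [scaled]
  have hmem : x⁻¹ • v ∈ Metric.closedBall 0 ε := by
    rw [mem_closedBall_zero_iff, norm_smul, norm_inv, Real.norm_of_nonneg hx.le,
      inv_mul_le_iff₀ hx, mul_comm]
    exact hle
  exact hball hmem (hscale ▸ subset_closure hv)

lemma IsAdmissible.iUnion {ν : Measure (Fin d → EReal)} {ι : Type*} [Finite ι]
    {A : ι → Set (Fin d → EReal)} (hA : ∀ i, IsAdmissible ν (A i)) :
    IsAdmissible ν (⋃ i, A i) where
  measurableSet := MeasurableSet.iUnion fun i => (hA i).measurableSet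
  bounded_away := by
    rw [closure_iUnion_of_finite, Set.mem_iUnion]
    exact fun ⟨i, hi⟩ => (hA i).bounded_away hi
  continuity := by
    have hsub : frontier (⋃ i, A i) ⊆ ⋃ i, frontier (A i) := fun y hy => by
      have hcl : y ∈ ⋃ i, closure (A i) := closure_iUnion_of_finite (f := A) ▸ hy.1
      obtain ⟨i, hi⟩ := Set.mem_iUnion.1 hcl
      exact Set.mem_iUnion.2
        ⟨i, hi, fun hint => hy.2 (interior_mono (Set.subset_iUnion A i) hint)⟩
    exact measure_mono_null hsub (measure_iUnion_null fun i => (hA i).continuity)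

variable {P : Measure Ω} {X : ℤ → Ω → EuclideanSpace ℝ (Fin d)} {α : ℝ}
  {μ : (h : ℕ) → Measure (ExtSpace h d)} {a : ℕ → ℝ}

lemma IsStrictlyStationary.integral_shift {E : Type*} [NormedAddCommGroup E] [NormedSpace ℝ E]
    [MeasurableSpace E] [BorelSpace E] (hstat : IsStrictlyStationary P X) (s : ℤ)
    {F : (ℤ → EuclideanSpace ℝ (Fin d)) → E} (hF : Measurable F) :
    ∫ ω, F (fun t => X (t + s) ω) ∂P = ∫ ω, F (fun t => X t ω) ∂P :=
  ((hstat s).comp hF).integral_eq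

lemma IsStrictlyStationary.real_shift (hstat : IsStrictlyStationary P X) (s : ℤ)
    {A : Set (ℤ → EuclideanSpace ℝ (Fin d))} (hA : MeasurableSet A) :
    P.real {ω | (fun t => X (t + s) ω) ∈ A} = P.real {ω | (fun t => X t ω) ∈ A} :=
  congrArg ENNReal.toReal ((hstat s).measure_mem_eq hA)

lemma IsStrictlyStationary.integral_scaledStack_apply (hstat : IsStrictlyStationary P X)
    {h : ℕ} (i : Fin h) (x : ℝ) {χ : (Fin d → EReal) → ℝ} (hχ : Measurable χ) :
    ∫ ω, χ (scaledStack X h x ω i) ∂P = ∫ ω, χ (scaled x (X 0 ω)) ∂P := by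
  simpa only [scaledStack, zero_add, Function.comp_def] using hstat.integral_shift ((i : ℤ) + 1)
    (hχ.comp ((measurable_scaled x).comp (measurable_pi_apply 0)))

lemma measurable_scaledStack (hX : ∀ t, Measurable (X t)) (h : ℕ) (x : ℝ) :
    Measurable (scaledStack X h x) :=
  measurable_pi_lambda _ fun _ => (measurable_scaled x).comp (hX _)

lemma notMem_tsupport_comp_eval {h : ℕ} (i : Fin h) {χ : (Fin d → EReal) → ℝ}
    (hz : (0 : Fin d → EReal) ∉ tsupport χ) :
    (0 : ExtSpace h d) ∉ tsupport fun y : ExtSpace h d => χ (y i) := fun hmem =>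
  hz (tsupport_comp_subset_preimage χ (f := fun y : ExtSpace h d => y i) (continuous_apply i) hmem)

lemma IsFiniteAwayFrom.map_eval {h : ℕ} {ν : Measure (ExtSpace h d)}
    (hν : IsFiniteAwayFrom 0 ν) (i : Fin h) :
    IsFiniteAwayFrom 0 (ν.map fun y : ExtSpace h d => y i) := fun K hK hK0 => by
  rw [Measure.map_apply (measurable_pi_apply i) hK.measurableSet]
  exact hν _ (hK.isClosed.preimage (continuous_apply i)).isCompact hK0

lemma IsRegularlyVarying.isFiniteAwayFrom_marginal (hreg : IsRegularlyVarying P X α μ) :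
    IsFiniteAwayFrom 0 (marginal μ) :=
  IsFiniteAwayFrom.map_eval (hreg 1 le_rfl).1.lt_top_of_isCompact 0

lemma IsRegularlyVarying.isFiniteAwayFrom_nu (hreg : IsRegularlyVarying P X α μ) {h : ℕ}
    (hh : 1 ≤ h) : IsFiniteAwayFrom 0 (nu P X a μ h) := fun K hK h0 => by
  simpa only [nu, Measure.smul_apply, smul_eq_mul] using
    ENNReal.mul_lt_top ENNReal.ofReal_lt_top ((hreg h hh).1.lt_top_of_isCompact K hK h0)

lemma IsLimitMeasure.exists_preimage_eval_ne_zero {h : ℕ} {ν : Measure (ExtSpace h d)}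
    (hν : IsLimitMeasure α ν) : ∃ (i : Fin h) (K : Set (Fin d → EReal)), IsClosed K ∧ 0 ∉ K ∧
      ν ((fun y : ExtSpace h d => y i) ⁻¹' K) ≠ 0 := by
  let _ : PseudoEMetricSpace (Fin d → EReal) :=
    (TopologicalSpace.pseudoMetrizableSpacePseudoMetric (Fin d → EReal)).toPseudoEMetricSpace
  obtain ⟨K, hK, hK0, hKU, -⟩ :=
    (isOpen_compl_singleton (x := (0 : Fin d → EReal))).exists_iUnion_isClosed
  by_contra! hnull
  have hcover : (Set.univ : Set (ExtSpace h d)) ⊆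
      {0} ∪ ⋃ (i : Fin h) (k : ℕ), (fun y : ExtSpace h d => y i) ⁻¹' K k := fun y _ => by
    refine or_iff_not_imp_left.2 fun hy => ?_
    obtain ⟨i, hi⟩ := Function.ne_iff.1 hy
    obtain ⟨k, hk⟩ := Set.mem_iUnion.1 (hKU.symm ▸ hi : y i ∈ ⋃ k, K k)
    exact Set.mem_iUnion₂.2 ⟨i, k, hk⟩
  refine hν.ne_zero (Measure.measure_univ_eq_zero.1
    (measure_mono_null hcover (measure_union_null hν.singleton_zero ?_)))
  exact measure_iUnion_null fun i => measure_iUnion_null fun k =>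
    hnull i (K k) (hK k) fun h0 => hK0 k h0 rfl

lemma IsLimitMeasure.exists_integral_eval_pos {h : ℕ} {ν : Measure (ExtSpace h d)}
    (hν : IsLimitMeasure α ν) : ∃ (i : Fin h) (χ : (Fin d → EReal) → ℝ), Continuous χ ∧
      (0 : Fin d → EReal) ∉ tsupport χ ∧ 0 < ∫ y, χ (y i) ∂ν := by
  obtain ⟨i, K, hK, hK0, hpos⟩ := hν.exists_preimage_eval_ne_zero
  obtain ⟨χ, hχ, hχz, hχ1, hχ01⟩ := exists_continuous_eq_one_of_notMem hK hK0
  refine ⟨i, χ, hχ, hχz, ?_⟩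
  have hint : Integrable (fun y : ExtSpace h d => χ (y i)) ν :=
    IsFiniteAwayFrom.integrable hν.lt_top_of_isCompact (hχ.comp (continuous_apply i))
      (notMem_tsupport_comp_eval i hχz)
  rw [integral_pos_iff_support_of_nonneg (fun y => (hχ01 _).1) hint]
  refine (pos_iff_ne_zero.2 hpos).trans_le (measure_mono fun y hy => ?_)
  simp only [Function.mem_support, hχ1 (y i) hy, ne_eq, one_ne_zero, not_false_eq_true]

lemma IsStrictlyStationary.tendsto_nat_mul_stackNorm_one (hstat : IsStrictlyStationary P X)
    (ha_tail : Tendsto (fun n : ℕ => (n : ℝ) * P.real {ω | a n < ‖X 0 ω‖}) atTop (𝓝 1)) :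
    Tendsto (fun n : ℕ => (n : ℝ) * P.real {ω | a n < stackNorm X 1 ω}) atTop (𝓝 1) := by
  refine ha_tail.congr fun n => ?_
  have hshift : P.real {ω | a n < ‖X (0 + 1) ω‖} = P.real {ω | a n < ‖X 0 ω‖} :=
    hstat.real_shift 1 (A := {x | a n < ‖x 0‖})
      (measurableSet_lt measurable_const (measurable_pi_apply 0).norm)
  rw [← hshift]
  simp [stackNorm, Real.sqrt_sq]

section VagueLimit

variable (hstat : IsStrictlyStationary P X) (hreg : IsRegularlyVarying P X α μ)
  (ha : Tendsto a atTop atTop)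
  (ha_tail : Tendsto (fun n : ℕ => (n : ℝ) * P.real {ω | a n < ‖X 0 ω‖}) atTop (𝓝 1))

include hstat hreg ha ha_tail

/-- The limit exists because one test function of a single block determines the ratio of the
normalizations `P(|Y_h| > x)` and `P(|Y_1| > x)`. -/
lemma tendsto_scaleConst {h : ℕ} (hh : 1 ≤ h) :
    Tendsto (fun n : ℕ => (n : ℝ) * P.real {ω | a n < stackNorm X h ω}) atTop
      (𝓝 (scaleConst P X a h)) := by
  obtain ⟨i, χ, hχ, hχz, hpos⟩ := (hreg h hh).1.exists_integral_eval_pos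
  have hlim : ∀ {k : ℕ}, 1 ≤ k → ∀ j : Fin k, Tendsto
      (fun n => (∫ ω, χ (scaled (a n) (X 0 ω)) ∂P) / P.real {ω | a n < stackNorm X k ω}) atTop
      (𝓝 (∫ y, χ (y j) ∂(μ k))) := fun {k} hk j => by
    simpa only [Function.comp_def, hstat.integral_scaledStack_apply _ _ hχ.measurable] using
      ((hreg k hk).2 (fun y => χ (y j)) (hχ.comp (continuous_apply j))
        (notMem_tsupport_comp_eval j hχz)).comp ha
  have hone := hstat.tendsto_nat_mul_stackNorm_one ha_tail
  refine tendsto_nhds_limUnder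
    ⟨_, (((hlim le_rfl 0).mul hone).div (hlim hh i) hpos.ne').congr' ?_⟩
  filter_upwards [(hlim hh i).eventually_ne hpos.ne', hone.eventually_ne one_ne_zero]
    with n hn hn1
  obtain ⟨hnum, hden⟩ := div_ne_zero_iff.1 hn
  have hden1 := right_ne_zero_of_mul hn1
  simp only [Pi.div_apply]
  field_simp

lemma tendsto_nat_mul_integral_scaledStack {h : ℕ} (hh : 1 ≤ h) {f : ExtSpace h d → ℝ}
    (hf : Continuous f) (hz : 0 ∉ tsupport f) :
    Tendsto (fun n : ℕ => (n : ℝ) * ∫ ω, f (scaledStack X h (a n) ω) ∂P) atTop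
      (𝓝 (∫ y, f y ∂(nu P X a μ h))) := by
  have hscale := tendsto_scaleConst hstat hreg ha ha_tail hh
  have hnonneg : 0 ≤ scaleConst P X a h := ge_of_tendsto' hscale fun n => by positivity
  obtain ⟨i, χ, hχ, hχz, hpos⟩ := (hreg h hh).1.exists_integral_eval_pos
  have hχlim := ((hreg h hh).2 (fun y => χ (y i)) (hχ.comp (continuous_apply i))
    (notMem_tsupport_comp_eval i hχz)).comp ha
  rw [nu, integral_smul_measure, ENNReal.toReal_ofReal hnonneg, smul_eq_mul]
  refine (hscale.mul (((hreg h hh).2 f hf hz).comp ha)).congr' ?_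
  filter_upwards [hχlim.eventually_ne hpos.ne'] with n hn
  have hden := (div_ne_zero_iff.1 hn).2
  simp only [Function.comp_apply]
  field_simp

lemma nu_one : nu P X a μ 1 = μ 1 := by
  have hone : scaleConst P X a 1 = 1 :=
    tendsto_nhds_unique (tendsto_scaleConst hstat hreg ha ha_tail le_rfl)
      (hstat.tendsto_nat_mul_stackNorm_one ha_tail)
  simp only [nu, hone, ENNReal.ofReal_one, one_smul]

lemma nu_preimage_eval {h : ℕ} (i : Fin h) {E : Set (Fin d → EReal)} (hE : MeasurableSet E)
    (hz : 0 ∉ closure E) :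
    nu P X a μ h ((fun y : ExtSpace h d => y i) ⁻¹' E) = marginal μ E := by
  have hh : 1 ≤ h := Nat.one_le_iff_ne_zero.2 fun h0 => (h0 ▸ i).elim0
  rw [← Measure.map_apply (measurable_pi_apply i) hE]
  refine measure_eq_of_forall_integral_eq ((hreg.isFiniteAwayFrom_nu hh).map_eval i)
    hreg.isFiniteAwayFrom_marginal (fun f hf hfz => ?_) hE hz
  have hlim : ∀ {k : ℕ}, 1 ≤ k → ∀ j : Fin k, Tendsto
      (fun n : ℕ => (n : ℝ) * ∫ ω, f (scaled (a n) (X 0 ω)) ∂P) atTop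
      (𝓝 (∫ y, f (y j) ∂(nu P X a μ k))) := fun {k} hk j => by
    simpa only [Function.comp_def, hstat.integral_scaledStack_apply _ _ hf.measurable] using
      tendsto_nat_mul_integral_scaledStack hstat hreg ha ha_tail hk
        (hf.comp (continuous_apply j)) (notMem_tsupport_comp_eval j hfz)
  rw [marginal, ← nu_one hstat hreg ha ha_tail,
    integral_map (measurable_pi_apply i).aemeasurable hf.aestronglyMeasurable,
    integral_map (measurable_pi_apply 0).aemeasurable hf.aestronglyMeasurable]
  exact tendsto_nhds_unique (hlim hh i) (hlim le_rfl 0)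

lemma nu_preimage_eval_frontier {D : Set (Fin d → EReal)} (hD : IsAdmissible (marginal μ) D)
    {h : ℕ} (i : Fin h) : nu P X a μ h ((fun y : ExtSpace h d => y i) ⁻¹' frontier D) = 0 := by
  rw [nu_preimage_eval hstat hreg ha ha_tail i isClosed_frontier.measurableSet, hD.continuity]
  rw [isClosed_frontier.closure_eq]
  exact fun h0 => hD.bounded_away (frontier_subset_closure h0)

lemma tau_zero {A B : Set (Fin d → EReal)} (hA : MeasurableSet A) (hB : MeasurableSet B) :
    tau (nu P X a μ) A B 0 = (marginal μ).real (A ∩ B) := by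
  rw [marginal, map_measureReal_apply (measurable_pi_apply 0) (hA.inter hB),
    ← nu_one hstat hreg ha ha_tail]
  rfl

lemma tendsto_nat_mul_scaledStack_mem [IsFiniteMeasure P] (hX : ∀ t, Measurable (X t)) {h : ℕ}
    (hh : 1 ≤ h) {E : Set (ExtSpace h d)} (hE : MeasurableSet E) (hz : 0 ∉ closure E)
    (hfr : nu P X a μ h (frontier E) = 0) :
    Tendsto (fun n : ℕ => (n : ℝ) * P.real {ω | scaledStack X h (a n) ω ∈ E}) atTop
      (𝓝 ((nu P X a μ h).real E)) := by
  have hmeas := fun n => measurable_scaledStack hX h (a n)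
  have hlim := tendsto_real_of_tendsto_integral
    (Q := fun n : ℕ => (n : ℝ≥0∞) • P.map (scaledStack X h (a n)))
    (fun n =>
      have := Measure.smul_finite (P.map (scaledStack X h (a n))) (ENNReal.natCast_ne_top n)
      IsFiniteAwayFrom.of_isFiniteMeasure _)
    (hreg.isFiniteAwayFrom_nu (a := a) hh) (fun f hf hfz => by
      simpa only [integral_smul_measure, integral_map (hmeas _).aemeasurable
        hf.aestronglyMeasurable, ENNReal.toReal_natCast, smul_eq_mul] using
        tendsto_nat_mul_integral_scaledStack hstat hreg ha ha_tail hh hf hfz) hE hz hfr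
  refine hlim.congr fun n => ?_
  rw [measureReal_ennreal_smul_apply, map_measureReal_apply (hmeas n) hE,
    ENNReal.toReal_natCast]
  rfl

theorem tendsto_nat_mul_joint [IsFiniteMeasure P] (hX : ∀ t, Measurable (X t))
    {A B : Set (Fin d → EReal)} (hA : IsAdmissible (marginal μ) A)
    (hB : IsAdmissible (marginal μ) B) (ℓ : ℕ) :
    Tendsto (fun n : ℕ => (n : ℝ) *
      P.real {ω | scaled (a n) (X 0 ω) ∈ A ∧ scaled (a n) (X ℓ ω) ∈ B}) atTop
      (𝓝 (tau (nu P X a μ) A B ℓ)) := by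
  let fst : ExtSpace (ℓ + 1) d → Fin d → EReal := fun y => y 0
  let lst : ExtSpace (ℓ + 1) d → Fin d → EReal := fun y => y (Fin.last ℓ)
  have hfst : Continuous fst := continuous_apply 0
  have hlst : Continuous lst := continuous_apply (Fin.last ℓ)
  have hfr : frontier (fst ⁻¹' A ∩ lst ⁻¹' B) ⊆ fst ⁻¹' frontier A ∪ lst ⁻¹' frontier B := by
    refine (frontier_inter_subset _ _).trans ?_
    rintro y (⟨hy, -⟩ | ⟨-, hy⟩)
    · exact Or.inl (hfst.frontier_preimage_subset A hy)
    · exact Or.inr (hlst.frontier_preimage_subset B hy)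
  refine (tendsto_nat_mul_scaledStack_mem hstat hreg ha ha_tail hX (Nat.le_add_left 1 ℓ)
    (E := fst ⁻¹' A ∩ lst ⁻¹' B)
    ((hfst.measurable hA.measurableSet).inter (hlst.measurable hB.measurableSet))
    (fun h0 => hA.bounded_away
      (hfst.closure_preimage_subset A (closure_mono Set.inter_subset_left h0)))
    (measure_mono_null hfr (measure_union_null
      (nu_preimage_eval_frontier hstat hreg ha ha_tail hA 0)
      (nu_preimage_eval_frontier hstat hreg ha ha_tail hB (Fin.last ℓ))))).congr
    fun n => congrArg _ ?_
  have hshift := hstat.real_shift 1 (A := {x | scaled (a n) (x 0) ∈ A ∧ scaled (a n) (x ℓ) ∈ B})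
    (((measurable_scaled _).comp (measurable_pi_apply 0) hA.measurableSet).inter
      ((measurable_scaled _).comp (measurable_pi_apply (ℓ : ℤ)) hB.measurableSet))
  simp only [Set.mem_ofPred_eq, zero_add] at hshift
  rw [← hshift]
  simp [fst, lst, scaledStack, Set.preimage, Set.inter_def]

end VagueLimit

end RegularVariation

section Mixing

variable {Ω : Type*} {𝒜 ℬ : MeasurableSpace Ω} [mΩ : MeasurableSpace Ω] {d : ℕ} {P : Measure Ω}
  [IsProbabilityMeasure P]

section SigmaAlgebras

lemma memLp_of_abs_le {F : Ω → ℝ} {c : ℝ} (hF : Measurable F) (hFc : ∀ ω, |F ω| ≤ c)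
    (p : ℝ≥0∞) : MemLp F p P :=
  MemLp.of_bound hF.aestronglyMeasurable c (ae_of_all _ hFc)

lemma memLp_of_mem_unitInterval {F : Ω → ℝ} (hF : Measurable F) (hF01 : ∀ ω, F ω ∈ Set.Icc 0 1)
    (p : ℝ≥0∞) : MemLp F p P :=
  memLp_of_bounded (ae_of_all _ hF01) hF.aestronglyMeasurable p

lemma covariance_eq_integral_mul_sub {F H : Ω → ℝ} (hF : MemLp F 2 P) (hH : MemLp H 2 P) :
    cov[H, F; P] = ∫ ω, F ω * (H ω - P[H]) ∂P := by
  have hmul : (fun ω => F ω * (H ω - P[H])) = fun ω => H ω * F ω - P[H] * F ω := by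
    ext ω
    ring
  rw [covariance_eq_sub hH hF, hmul, integral_sub (f := fun ω => H ω * F ω)
    (hH.integrable_mul hF) ((hF.integrable one_le_two).const_mul _), integral_const_mul]
  rfl

lemma covariance_indicator_one {H : Ω → ℝ} (hH : MemLp H 2 P) {A : Set Ω}
    (hA : MeasurableSet A) : cov[H, A.indicator 1; P] = ∫ ω in A, (H ω - P[H]) ∂P := by
  have hA2 : MemLp (A.indicator (1 : Ω → ℝ)) 2 P :=
    memLp_indicator_const 2 hA 1 (Or.inr (measure_ne_top P A))
  rw [covariance_eq_integral_mul_sub hA2 hH, ← integral_indicator hA]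
  congr! 2 with ω
  by_cases hω : ω ∈ A <;> simp [hω]

/-- The integral is largest when `F` is the indicator of the event that the conditional
expectation of `H` is positive. -/
lemma integral_mul_le_of_forall_setIntegral_le (h𝒜 : 𝒜 ≤ mΩ)
    {H F : Ω → ℝ} (hH : Integrable H P) {c : ℝ}
    (hc : ∀ A, MeasurableSet[𝒜] A → ∫ ω in A, H ω ∂P ≤ c) (hF : Measurable[𝒜] F)
    (hF01 : ∀ ω, F ω ∈ Set.Icc 0 1) : ∫ ω, F ω * H ω ∂P ≤ c := by
  have hbdd : ∀ ω, ‖F ω‖ ≤ 1 := fun ω => by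
    rw [Real.norm_of_nonneg (hF01 ω).1]
    exact (hF01 ω).2
  have hFm := (hF.mono h𝒜 le_rfl).aestronglyMeasurable (μ := P)
  have hpos : MeasurableSet[𝒜] {ω | 0 < (P[H|𝒜]) ω} :=
    stronglyMeasurable_condExp.measurable measurableSet_Ioi
  have hcond : Integrable (P[H|𝒜]) P := integrable_condExp
  calc ∫ ω, F ω * H ω ∂P
      = ∫ ω, F ω * (P[H|𝒜]) ω ∂P := by
        rw [← integral_condExp h𝒜 (f := fun ω => F ω * H ω)]
        exact integral_congr_ae (condExp_mul_of_stronglyMeasurable_left hF.stronglyMeasurable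
          (hH.bdd_mul hFm (ae_of_all _ hbdd)) hH)
    _ ≤ ∫ ω, {ω | 0 < (P[H|𝒜]) ω}.indicator (P[H|𝒜]) ω ∂P := by
        refine integral_mono (hcond.bdd_mul hFm (ae_of_all _ hbdd))
          (hcond.indicator (h𝒜 _ hpos)) fun ω => ?_
        by_cases hω : 0 < (P[H|𝒜]) ω
        · simpa [hω] using mul_le_of_le_one_left hω.le (hF01 ω).2
        · simpa [hω] using mul_nonpos_of_nonneg_of_nonpos (hF01 ω).1 (not_lt.1 hω)
    _ = ∫ ω in {ω | 0 < (P[H|𝒜]) ω}, H ω ∂P := by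
        rw [integral_indicator (h𝒜 _ hpos), setIntegral_condExp h𝒜 hH hpos]
    _ ≤ c := hc _ hpos

lemma abs_covariance_le_of_forall_indicator (h𝒜 : 𝒜 ≤ mΩ) {H F : Ω → ℝ}
    (hH : MemLp H 2 P) {c : ℝ} (hc : ∀ A, MeasurableSet[𝒜] A → |cov[H, A.indicator 1; P]| ≤ c)
    (hF : Measurable[𝒜] F) (hF01 : ∀ ω, F ω ∈ Set.Icc 0 1) : |cov[H, F; P]| ≤ c := by
  have hF2 : MemLp F 2 P := memLp_of_mem_unitInterval (hF.mono h𝒜 le_rfl) hF01 2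
  have hupper : ∀ {H : Ω → ℝ}, MemLp H 2 P →
      (∀ A, MeasurableSet[𝒜] A → cov[H, A.indicator 1; P] ≤ c) → cov[H, F; P] ≤ c :=
    fun {H} hH hc => by
      rw [covariance_eq_integral_mul_sub hF2 hH]
      exact integral_mul_le_of_forall_setIntegral_le h𝒜
        ((hH.integrable one_le_two).sub (integrable_const _))
        (fun A hA => covariance_indicator_one hH (h𝒜 _ hA) ▸ hc A hA) hF hF01
  refine abs_le'.2 ⟨hupper hH fun A hA => (abs_le'.1 (hc A hA)).1, ?_⟩
  rw [← covariance_neg_left]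
  exact hupper hH.neg fun A hA => covariance_neg_left (μ := P) ▸ (abs_le'.1 (hc A hA)).2

/-- The strong mixing (`α`-mixing) coefficient of the σ-algebras `𝒜` and `ℬ` is at most `c`. -/
def AlphaDependenceLE {Ω : Type*} (𝒜 ℬ : MeasurableSpace Ω) [MeasurableSpace Ω] (P : Measure Ω)
    (c : ℝ) : Prop :=
  ∀ A B, MeasurableSet[𝒜] A → MeasurableSet[ℬ] B → |P.real (A ∩ B) - P.real A * P.real B| ≤ c

variable {c : ℝ} {F G : Ω → ℝ}

section Covariance

variable (hdep : AlphaDependenceLE 𝒜 ℬ P c) (h𝒜 : 𝒜 ≤ mΩ) (hℬ : ℬ ≤ mΩ)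
  (hF : Measurable[𝒜] F) (hG : Measurable[ℬ] G)

include hdep h𝒜 hℬ hF hG

lemma AlphaDependenceLE.abs_covariance_le_of_mem_unitInterval (hF01 : ∀ ω, F ω ∈ Set.Icc 0 1)
    (hG01 : ∀ ω, G ω ∈ Set.Icc 0 1) : |cov[F, G; P]| ≤ c := by
  have hind : ∀ {B : Set Ω}, MeasurableSet B → MemLp (B.indicator (1 : Ω → ℝ)) 2 P := fun hB =>
    memLp_indicator_const 2 hB (1 : ℝ) (Or.inr (measure_ne_top P _))
  refine abs_covariance_le_of_forall_indicator hℬ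
    (memLp_of_mem_unitInterval (hF.mono h𝒜 le_rfl) hF01 2) (fun B hB => ?_) hG hG01
  rw [covariance_comm]
  refine abs_covariance_le_of_forall_indicator h𝒜 (hind (hℬ _ hB)) (fun A hA => ?_) hF hF01
  have hmul : B.indicator (1 : Ω → ℝ) * A.indicator 1 = (A ∩ B).indicator 1 := by
    rw [Set.inter_comm, Set.inter_indicator_one]
  rw [covariance_eq_sub (hind (hℬ _ hB)) (hind (h𝒜 _ hA)), hmul,
    integral_indicator_one (hℬ _ hB), integral_indicator_one (h𝒜 _ hA),
    integral_indicator_one ((h𝒜 _ hA).inter (hℬ _ hB)), mul_comm (P.real B)]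
  exact hdep A B hA hB

lemma AlphaDependenceLE.abs_covariance_le {K L : ℝ} (hK : 0 < K) (hL : 0 < L)
    (hFK : ∀ ω, |F ω| ≤ K) (hGL : ∀ ω, |G ω| ≤ L) : |cov[F, G; P]| ≤ 4 * K * L * c := by
  have hunit : ∀ {x M : ℝ}, 0 < M → |x| ≤ M → (x + M) / (2 * M) ∈ Set.Icc 0 1 := fun hM hx => by
    obtain ⟨hl, hu⟩ := abs_le.1 hx
    exact ⟨div_nonneg (by linarith) (by linarith), (div_le_one (by linarith)).2 (by linarith)⟩
  have hFi : Integrable F P := (memLp_of_abs_le (hF.mono h𝒜 le_rfl) hFK 1).integrable le_rfl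
  have hGi : Integrable G P := (memLp_of_abs_le (hG.mono hℬ le_rfl) hGL 1).integrable le_rfl
  have hcov := hdep.abs_covariance_le_of_mem_unitInterval h𝒜 hℬ
    ((hF.add_const K).div_const (2 * K)) ((hG.add_const L).div_const (2 * L))
    (fun ω => hunit hK (hFK ω)) (fun ω => hunit hL (hGL ω))
  rw [covariance_fun_div_left, covariance_fun_div_right, covariance_add_const_left hFi,
    covariance_add_const_right hGi, div_div, abs_div,
    abs_of_pos (show 0 < 2 * L * (2 * K) by positivity), div_le_iff₀ (by positivity)] at hcov
  linarith

end Covariance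

lemma integrable_exp_mul_I {U : Ω → ℝ} (hU : Measurable U) :
    Integrable (fun ω => Complex.exp ((U ω : ℂ) * Complex.I)) P :=
  Integrable.of_bound (Complex.measurable_exp.comp
    ((Complex.measurable_ofReal.comp hU).mul_const _)).aestronglyMeasurable 1
    (ae_of_all _ fun _ => (Complex.norm_exp_ofReal_mul_I _).le)

lemma integral_exp_mul_I {U : Ω → ℝ} (hU : Measurable U) :
    ∫ ω, Complex.exp ((U ω : ℂ) * Complex.I) ∂P =
      ⟨∫ ω, Real.cos (U ω) ∂P, ∫ ω, Real.sin (U ω) ∂P⟩ := by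
  have hint := integrable_exp_mul_I (P := P) hU
  refine Complex.ext ?_ ?_
  · rw [← RCLike.re_eq_complex_re, ← integral_re hint]
    simp only [RCLike.re_eq_complex_re, Complex.exp_ofReal_mul_I_re]
  · rw [← RCLike.im_eq_complex_im, ← integral_im hint]
    simp only [RCLike.im_eq_complex_im, Complex.exp_ofReal_mul_I_im]

lemma AlphaDependenceLE.norm_integral_exp_add_sub_mul_le (hdep : AlphaDependenceLE 𝒜 ℬ P c)
    (h𝒜 : 𝒜 ≤ mΩ) (hℬ : ℬ ≤ mΩ) (hF : Measurable[𝒜] F) (hG : Measurable[ℬ] G) :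
    ‖∫ ω, Complex.exp (((F ω + G ω : ℝ) : ℂ) * Complex.I) ∂P -
      (∫ ω, Complex.exp ((F ω : ℂ) * Complex.I) ∂P) *
        ∫ ω, Complex.exp ((G ω : ℂ) * Complex.I) ∂P‖ ≤ 16 * c := by
  have hFm := hF.mono h𝒜 le_rfl
  have hGm := hG.mono hℬ le_rfl
  have hcov : ∀ {u v : ℝ → ℝ}, Measurable u → Measurable v → (∀ x, |u x| ≤ 1) →
      (∀ x, |v x| ≤ 1) →
      |∫ ω, u (F ω) * v (G ω) ∂P - (∫ ω, u (F ω) ∂P) * ∫ ω, v (G ω) ∂P| ≤ 4 * c :=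
    fun {u v} hu hv hu1 hv1 => by
      have := hdep.abs_covariance_le h𝒜 hℬ (hu.comp hF) (hv.comp hG) one_pos one_pos
        (fun _ => hu1 _) (fun _ => hv1 _)
      rwa [covariance_eq_sub (memLp_of_abs_le (hu.comp hFm) (fun _ => hu1 _) 2)
        (memLp_of_abs_le (hv.comp hGm) (fun _ => hv1 _) 2), mul_one, mul_one] at this
  have hint : ∀ {u v : ℝ → ℝ}, Measurable u → Measurable v → (∀ x, |u x| ≤ 1) →
      (∀ x, |v x| ≤ 1) → Integrable (fun ω => u (F ω) * v (G ω)) P := fun hu hv hu1 hv1 =>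
    (memLp_of_abs_le (hu.comp hFm) (fun _ => hu1 _) 2).integrable_mul
      (memLp_of_abs_le (hv.comp hGm) (fun _ => hv1 _) 2)
  have hc := Real.measurable_cos
  have hs := Real.measurable_sin
  have hc1 := Real.abs_cos_le_one
  have hs1 := Real.abs_sin_le_one
  rw [integral_exp_mul_I hFm, integral_exp_mul_I hGm,
    integral_exp_mul_I (U := fun ω => F ω + G ω) (hFm.add hGm)]
  simp only [Real.cos_add, Real.sin_add]
  rw [integral_sub (hint hc hc hc1 hc1) (hint hs hs hs1 hs1),
    integral_add (hint hs hc hs1 hc1) (hint hc hs hc1 hs1)]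
  refine (Complex.norm_le_abs_re_add_abs_im _).trans ?_
  simp only [Complex.sub_re, Complex.sub_im, Complex.mul_re, Complex.mul_im]
  have hcc := abs_le.1 (hcov hc hc hc1 hc1)
  have hss := abs_le.1 (hcov hs hs hs1 hs1)
  have hcs := abs_le.1 (hcov hc hs hc1 hs1)
  have hsc := abs_le.1 (hcov hs hc hs1 hc1)
  calc _ ≤ 8 * c + 8 * c := add_le_add (abs_le.2 ⟨by linarith, by linarith⟩)
        (abs_le.2 ⟨by linarith, by linarith⟩)
    _ = 16 * c := by ring

end SigmaAlgebras

section PastFuture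

variable {X : ℤ → Ω → EuclideanSpace ℝ (Fin d)}

/-- The σ-algebra generated by the variables `X_t`, `t ∈ T`. -/
abbrev windowAlgebra (X : ℤ → Ω → EuclideanSpace ℝ (Fin d)) (T : Set ℤ) : MeasurableSpace Ω :=
  ⨆ t : T, MeasurableSpace.comap (X t) inferInstance

lemma windowAlgebra_le (hX : ∀ t, Measurable (X t)) (T : Set ℤ) : windowAlgebra X T ≤ mΩ :=
  iSup_le fun t => (hX t).comap_le

omit mΩ in
lemma measurable_windowAlgebra {T : Set ℤ} {t : ℤ} (ht : t ∈ T) :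
    Measurable[windowAlgebra X T] (X t) :=
  (comap_measurable (X t)).mono
    (le_iSup (fun t : T => MeasurableSpace.comap (X t) inferInstance) ⟨t, ht⟩) le_rfl

omit mΩ in
lemma comap_windowAlgebra_eval (Z : Ω → ℤ → EuclideanSpace ℝ (Fin d)) (T : Set ℤ) :
    MeasurableSpace.comap Z (windowAlgebra (fun t x => x t) T) =
      windowAlgebra (fun t ω => Z ω t) T := by
  simp only [MeasurableSpace.comap_iSup, MeasurableSpace.comap_comp, Function.comp_def]

omit mΩ in
lemma windowAlgebra_shift_le {S T : Set ℤ} {s : ℤ} (hST : ∀ t ∈ S, t - s ∈ T) :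
    windowAlgebra X S ≤ windowAlgebra (fun t ω => X (t + s) ω) T :=
  iSup_le fun t => by
    convert! le_iSup (fun t : T => MeasurableSpace.comap (fun ω => X (t + s) ω) inferInstance)
      ⟨t - s, hST t t.2⟩ using 2
    simp

omit [IsProbabilityMeasure P] in
lemma alphaMixingCoeff_nonneg (h : ℕ) : 0 ≤ alphaMixingCoeff P X h :=
  Real.sSup_nonneg (by rintro q ⟨A, B, -, -, rfl⟩; exact abs_nonneg _)

lemma alphaDependenceLE_alphaMixingCoeff (h : ℕ) :
    AlphaDependenceLE (windowAlgebra X (Set.Iic 0)) (windowAlgebra X (Set.Ici h)) P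
      (alphaMixingCoeff P X h) := fun A B hA hB => by
  refine le_csSup ⟨1, ?_⟩ ⟨A, B, hA, hB, rfl⟩
  rintro q ⟨A, B, -, -, rfl⟩
  have hinter : P.real (A ∩ B) ∈ Set.Icc 0 1 := ⟨measureReal_nonneg, measureReal_le_one⟩
  have hmul : P.real A * P.real B ∈ Set.Icc 0 1 :=
    ⟨by positivity, mul_le_one₀ measureReal_le_one measureReal_nonneg measureReal_le_one⟩
  exact abs_le.2 ⟨by linarith [hinter.1, hmul.2], by linarith [hinter.2, hmul.1]⟩

lemma IsStrictlyStationary.alphaDependenceLE (hstat : IsStrictlyStationary P X) (s : ℤ) (h : ℕ) :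
    AlphaDependenceLE (windowAlgebra X (Set.Iic s)) (windowAlgebra X (Set.Ici (s + h))) P
      (alphaMixingCoeff P X h) := fun A B hA hB => by
  have hpast : windowAlgebra X (Set.Iic s) ≤ MeasurableSpace.comap (fun ω t => X (t + s) ω)
      (windowAlgebra (fun t x => x t) (Set.Iic 0)) := by
    rw [comap_windowAlgebra_eval]
    exact windowAlgebra_shift_le fun t ht => Set.mem_Iic.2 (sub_nonpos.2 ht)
  have hfut : windowAlgebra X (Set.Ici (s + h)) ≤ MeasurableSpace.comap (fun ω t => X (t + s) ω)
      (windowAlgebra (fun t x => x t) (Set.Ici (h : ℤ))) := by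
    rw [comap_windowAlgebra_eval]
    exact windowAlgebra_shift_le fun t ht => Set.mem_Ici.2 (le_sub_iff_add_le'.2 ht)
  obtain ⟨A', hA', rfl⟩ := hpast A hA
  obtain ⟨B', hB', rfl⟩ := hfut B hB
  have mA := windowAlgebra_le measurable_pi_apply _ _ hA'
  have mB := windowAlgebra_le measurable_pi_apply _ _ hB'
  have hinter : P.real ({ω | (fun t => X (t + s) ω) ∈ A'} ∩ {ω | (fun t => X (t + s) ω) ∈ B'}) =
      P.real ({ω | (fun t => X t ω) ∈ A'} ∩ {ω | (fun t => X t ω) ∈ B'}) :=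
    hstat.real_shift s (mA.inter mB)
  have hwindow : ∀ {T : Set ℤ} {C : Set (ℤ → EuclideanSpace ℝ (Fin d))},
      MeasurableSet[windowAlgebra (fun t x => x t) T] C →
      MeasurableSet[windowAlgebra X T] {ω | (fun t => X t ω) ∈ C} := fun {T C} hC => by
    rw [← comap_windowAlgebra_eval (fun ω t => X t ω)]
    exact ⟨C, hC, rfl⟩
  change |P.real ({ω | (fun t => X (t + s) ω) ∈ A'} ∩ {ω | (fun t => X (t + s) ω) ∈ B'}) -
    P.real {ω | (fun t => X (t + s) ω) ∈ A'} * P.real {ω | (fun t => X (t + s) ω) ∈ B'}| ≤ _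
  rw [hinter, hstat.real_shift s mA, hstat.real_shift s mB]
  exact alphaDependenceLE_alphaMixingCoeff h _ _ (hwindow hA') (hwindow hB')

end PastFuture

end Mixing

section Combinatorics

lemma sum_comp_le_sum_range {A : Finset ℕ} {e : ℕ → ℕ} {G : ℕ → ℝ} {N : ℕ} (hG : ∀ g, 0 ≤ G g)
    (he : Set.InjOn e A) (hN : ∀ s ∈ A, e s < N) :
    ∑ s ∈ A, G (e s) ≤ ∑ g ∈ Finset.range N, G g := by
  rw [← Finset.sum_image (f := G) he]
  refine Finset.sum_le_sum_of_subset_of_nonneg (fun g hg => ?_) fun g _ _ => hG g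
  obtain ⟨s, hs, rfl⟩ := Finset.mem_image.1 hg
  exact Finset.mem_range.2 (hN s hs)

lemma sum_dist_le {A : Finset ℕ} {G : ℕ → ℝ} {N t : ℕ} (hG : ∀ g, 0 ≤ G g)
    (hA : ∀ s ∈ A, s < N) (ht : t < N) :
    ∑ s ∈ A, G (Nat.dist s t) ≤ 2 * ∑ g ∈ Finset.range N, G g := by
  rw [← Finset.sum_filter_add_sum_filter_not A (fun s => s ≤ t), two_mul]
  refine add_le_add
    (sum_comp_le_sum_range hG (fun x hx y hy hxy => ?_) fun s hs => ?_)
    (sum_comp_le_sum_range hG (fun x hx y hy hxy => ?_) fun s hs => ?_)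
  all_goals
    simp only [Finset.coe_filter, Finset.mem_filter, Set.mem_ofPred_eq, Nat.dist] at *
    grind

lemma sum_range_sub_le {G : ℕ → ℝ} (hG : ∀ g, 0 ≤ G g) {s l : ℕ} (hs : s < l) :
    ∑ u ∈ Finset.range (s + 1), G (s - u) ≤ ∑ g ∈ Finset.range l, G g :=
  sum_comp_le_sum_range hG
    (fun x hx y hy hxy => by simp only [Finset.coe_range, Set.mem_Iio] at *; omega)
    fun u _ => by omega

lemma sum_sum_dist (L : ℕ → ℝ) (l : ℕ) :
    ∑ s ∈ Finset.range l, ∑ t ∈ Finset.range l, L (Nat.dist s t) =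
      l * L 0 + 2 * ∑ g ∈ Finset.range l, ((l - (g + 1) : ℕ) : ℝ) * L (g + 1) := by
  induction l with
  | zero => simp
  | succ l ih =>
    have hrow : ∑ t ∈ Finset.range l, L (Nat.dist l t) = ∑ g ∈ Finset.range l, L (g + 1) := by
      rw [← Finset.sum_range_reflect (fun g => L (g + 1)) l]
      refine Finset.sum_congr rfl fun t ht => congrArg L ?_
      have := Finset.mem_range.1 ht
      simp only [Nat.dist]
      omega
    have hweights : ∑ g ∈ Finset.range (l + 1), ((l + 1 - (g + 1) : ℕ) : ℝ) * L (g + 1) =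
        ∑ g ∈ Finset.range l, ((l - (g + 1) : ℕ) : ℝ) * L (g + 1) +
          ∑ g ∈ Finset.range l, L (g + 1) := by
      rw [Finset.sum_range_succ, Nat.sub_self, Nat.cast_zero, zero_mul, add_zero,
        ← Finset.sum_add_distrib]
      refine Finset.sum_congr rfl fun g hg => ?_
      rw [Nat.sub_add_comm (Finset.mem_range.1 hg)]
      push_cast
      ring
    rw [hweights, Finset.sum_range_succ _ l]
    simp only [Finset.sum_range_succ _ l, Finset.sum_add_distrib, Nat.dist_comm _ l, hrow,
      Nat.dist_self, ih]
    push_cast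
    ring

lemma sum_range_ite_lt_le {Q c : ℝ} (hQ : 0 ≤ Q) (hc : 0 ≤ c) (β : ℕ → ℝ) (l r : ℕ) :
    ∑ g ∈ Finset.range l, (if g < r then Q else c + β g) ≤
      r * Q + l * c + ∑ g ∈ Finset.Ico r l, β g := by
  have hnear : (((Finset.range l).filter (· < r)).card : ℝ) ≤ r := by
    refine Nat.cast_le.2 ((Finset.card_le_card fun g hg => ?_).trans (Finset.card_range r).le)
    exact Finset.mem_range.2 (Finset.mem_filter.1 hg).2
  have hfar : (Finset.range l).filter (¬ · < r) = Finset.Ico r l := by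
    ext g
    simp only [Finset.mem_filter, Finset.mem_range, Finset.mem_Ico]
    omega
  have hcard : ((Finset.Ico r l).card : ℝ) ≤ l :=
    Nat.cast_le.2 (by rw [Nat.card_Ico]; exact Nat.sub_le l r)
  rw [Finset.sum_ite, hfar, Finset.sum_add_distrib, Finset.sum_const, Finset.sum_const,
    nsmul_eq_mul, nsmul_eq_mul, ← add_assoc]
  gcongr

variable {y : ℕ → ℝ}

lemma sum_pow_two_le (hy : ∀ t, 0 ≤ y t) (l : ℕ) :
    (∑ t ∈ Finset.range l, y t) ^ 2 ≤
      2 * ∑ s ∈ Finset.range l, ∑ u ∈ Finset.range (s + 1), y u * y s := by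
  induction l with
  | zero => simp
  | succ l ih =>
    rw [Finset.sum_range_succ, Finset.sum_range_succ _ l, ← Finset.sum_mul,
      Finset.sum_range_succ _ l]
    nlinarith [hy l]

lemma sum_pow_three_le (hy : ∀ t, 0 ≤ y t) (l : ℕ) :
    (∑ t ∈ Finset.range l, y t) ^ 3 ≤ 6 * ∑ t ∈ Finset.range l, ∑ s ∈ Finset.range (t + 1),
      ∑ u ∈ Finset.range (s + 1), y u * y s * y t := by
  induction l with
  | zero => simp
  | succ l ih =>
    have hsq := mul_le_mul_of_nonneg_right (sum_pow_two_le hy (l + 1)) (hy l)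
    have hlast : ∑ s ∈ Finset.range (l + 1), ∑ u ∈ Finset.range (s + 1), y u * y s * y l =
        (∑ s ∈ Finset.range (l + 1), ∑ u ∈ Finset.range (s + 1), y u * y s) * y l := by
      simp only [Finset.sum_mul]
    have hT : 0 ≤ ∑ t ∈ Finset.range l, y t := Finset.sum_nonneg fun t _ => hy t
    rw [Finset.sum_range_succ (fun t => ∑ s ∈ Finset.range (t + 1),
      ∑ u ∈ Finset.range (s + 1), y u * y s * y t), hlast]
    rw [Finset.sum_range_succ] at hsq ⊢
    set T := ∑ t ∈ Finset.range l, y t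
    have hcube : (T + y l) ^ 3 ≤ T ^ 3 + 3 * ((T + y l) ^ 2 * y l) := by
      nlinarith [mul_nonneg (sq_nonneg (y l)) hT, pow_nonneg (hy l) 3]
    linarith

end Combinatorics

section Moments

variable {Ω : Type*} [mΩ : MeasurableSpace Ω] {d : ℕ} {P : Measure Ω}
  {X : ℤ → Ω → EuclideanSpace ℝ (Fin d)}

/-- The covariance at lag `g` of the sequence `φ(X_t)`. -/
noncomputable def lagCov (P : Measure Ω) (X : ℤ → Ω → EuclideanSpace ℝ (Fin d))
    (φ : EuclideanSpace ℝ (Fin d) → ℝ) (g : ℕ) : ℝ :=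
  cov[fun ω => φ (X 0 ω), fun ω => φ (X g ω); P]

/-- The product moment at lag `g` of the sequence `ψ(X_t)`. -/
noncomputable def lagProd (P : Measure Ω) (X : ℤ → Ω → EuclideanSpace ℝ (Fin d))
    (ψ : EuclideanSpace ℝ (Fin d) → ℝ) (g : ℕ) : ℝ :=
  ∫ ω, ψ (X 0 ω) * ψ (X g ω) ∂P

/-- The sum of `u(X_t)` over the block `s ≤ t < s + l`. -/
def blockSum (X : ℤ → Ω → EuclideanSpace ℝ (Fin d)) (u : EuclideanSpace ℝ (Fin d) → ℝ)
    (s l : ℕ) (ω : Ω) : ℝ :=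
  ∑ i ∈ Finset.range l, u (X (s + i : ℕ) ω)

section Stationary

variable (hstat : IsStrictlyStationary P X) {φ : EuclideanSpace ℝ (Fin d) → ℝ}
  (hφ : Measurable φ)
include hstat hφ

lemma integral_comp_eq (s : ℤ) : ∫ ω, φ (X s ω) ∂P = ∫ ω, φ (X 0 ω) ∂P := by
  simpa using hstat.integral_shift s (F := fun y => φ (y 0)) (hφ.comp (measurable_pi_apply 0))

lemma integral_mul_eq_lagProd {u s : ℕ} (hus : u ≤ s) :
    ∫ ω, φ (X u ω) * φ (X s ω) ∂P = lagProd P X φ (s - u) := by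
  obtain ⟨g, rfl⟩ := Nat.exists_eq_add_of_le hus
  have := hstat.integral_shift u (F := fun y => φ (y 0) * φ (y g))
    ((hφ.comp (measurable_pi_apply 0)).mul (hφ.comp (measurable_pi_apply _)))
  simpa [lagProd, add_comm] using this

lemma covariance_comp_eq_lagCov (s t : ℕ) :
    cov[fun ω => φ (X s ω), fun ω => φ (X t ω); P] = lagCov P X φ (Nat.dist s t) := by
  wlog hst : s ≤ t generalizing s t
  · rw [covariance_comm, this t s (le_of_not_ge hst), Nat.dist_comm]
  obtain ⟨g, rfl⟩ := Nat.exists_eq_add_of_le hst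
  have := hstat.integral_shift s
    (F := fun y => (φ (y 0) - ∫ ω, φ (X 0 ω) ∂P) * (φ (y g) - ∫ ω, φ (X 0 ω) ∂P))
    (((hφ.comp (measurable_pi_apply (0 : ℤ))).sub_const _).mul
      ((hφ.comp (measurable_pi_apply (g : ℤ))).sub_const _))
  simp only [lagCov, covariance, integral_comp_eq hstat hφ]
  simpa [Nat.dist, add_comm] using this

lemma integral_exp_blockSum_eq (s l : ℕ) :
    ∫ ω, Complex.exp ((blockSum X φ s l ω : ℂ) * Complex.I) ∂P =
      ∫ ω, Complex.exp ((blockSum X φ 0 l ω : ℂ) * Complex.I) ∂P := by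
  have hsum : Measurable fun y : ℤ → EuclideanSpace ℝ (Fin d) =>
      ∑ i ∈ Finset.range l, φ (y (i : ℕ)) :=
    Finset.measurable_fun_sum _ fun i _ => hφ.comp (measurable_pi_apply _)
  have := hstat.integral_shift s
    (F := fun y => Complex.exp (((∑ i ∈ Finset.range l, φ (y (i : ℕ)) : ℝ) : ℂ) * Complex.I))
    (Complex.measurable_exp.comp ((Complex.measurable_ofReal.comp hsum).mul_const _))
  simpa [blockSum, add_comm] using this

end Stationary

lemma lagProd_nonneg {ψ : EuclideanSpace ℝ (Fin d) → ℝ} (hψ0 : ∀ x, 0 ≤ ψ x) (g : ℕ) :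
    0 ≤ lagProd P X ψ g :=
  integral_nonneg fun _ => mul_nonneg (hψ0 _) (hψ0 _)

lemma measurable_blockSum (hX : ∀ t, Measurable (X t)) {u : EuclideanSpace ℝ (Fin d) → ℝ}
    (hu : Measurable u) (s l : ℕ) : Measurable (blockSum X u s l) :=
  Finset.measurable_fun_sum _ fun _ _ => hu.comp (hX _)

section Variance

variable (hX : ∀ t, Measurable (X t)) (hstat : IsStrictlyStationary P X)
  {φ : EuclideanSpace ℝ (Fin d) → ℝ} (hφ : Measurable φ) {c : ℝ} (hc : ∀ x, |φ x| ≤ c)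
  [IsProbabilityMeasure P]
include hX hstat hφ hc

lemma variance_sum_comp (A : Finset ℕ) :
    Var[fun ω => ∑ t ∈ A, φ (X t ω); P] =
      ∑ s ∈ A, ∑ t ∈ A, lagCov P X φ (Nat.dist s t) := by
  rw [variance_fun_sum' (X := fun (t : ℕ) ω => φ (X t ω)) fun t _ =>
    memLp_of_abs_le (hφ.comp (hX t)) (fun _ => hc _) 2]
  simp only [covariance_comp_eq_lagCov hstat hφ]

lemma variance_sum_comp_le {A : Finset ℕ} {N : ℕ} (hA : ∀ t ∈ A, t < N) :
    Var[fun ω => ∑ t ∈ A, φ (X t ω); P] ≤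
      2 * A.card * ∑ g ∈ Finset.range N, |lagCov P X φ g| := by
  rw [variance_sum_comp hX hstat hφ hc, mul_right_comm, mul_comm _ (A.card : ℝ), ← nsmul_eq_mul]
  refine Finset.sum_le_card_nsmul _ _ _ fun s hs => ?_
  refine (Finset.sum_le_sum fun t _ => le_abs_self _).trans ?_
  simp only [Nat.dist_comm s]
  exact sum_dist_le (fun g => abs_nonneg (lagCov P X φ g)) hA (hA s hs)

lemma variance_blockSum (l : ℕ) :
    Var[blockSum X φ 0 l; P] = l * lagCov P X φ 0 +
      2 * ∑ g ∈ Finset.range l, ((l - (g + 1) : ℕ) : ℝ) * lagCov P X φ (g + 1) := by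
  rw [← sum_sum_dist, ← variance_sum_comp hX hstat hφ hc]
  congr 1
  ext ω
  simp only [blockSum, zero_add]

end Variance

section ThirdMoment

variable (hX : ∀ t, Measurable (X t)) (hstat : IsStrictlyStationary P X)
  {ψ : EuclideanSpace ℝ (Fin d) → ℝ} (hψ : Measurable ψ) (hψ01 : ∀ x, ψ x ∈ Set.Icc 0 1)
  [IsProbabilityMeasure P]
include hX hψ hψ01

lemma integrable_comp_mul (u s : ℤ) : Integrable (fun ω => ψ (X u ω) * ψ (X s ω)) P :=
  Integrable.of_mem_Icc 0 1 ((hψ.comp (hX u)).mul (hψ.comp (hX s))).aemeasurable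
    (ae_of_all _ fun _ => unitInterval.mul_mem (hψ01 _) (hψ01 _))

lemma integrable_comp_mul_mul (u s t : ℤ) :
    Integrable (fun ω => ψ (X u ω) * ψ (X s ω) * ψ (X t ω)) P :=
  Integrable.of_mem_Icc 0 1
    (((hψ.comp (hX u)).mul (hψ.comp (hX s))).mul (hψ.comp (hX t))).aemeasurable
    (ae_of_all _ fun _ => unitInterval.mul_mem (unitInterval.mul_mem (hψ01 _) (hψ01 _)) (hψ01 _))

lemma lagProd_le_integral (g : ℕ) : lagProd P X ψ g ≤ ∫ ω, ψ (X 0 ω) ∂P :=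
  integral_mono (integrable_comp_mul hX hψ hψ01 0 g)
    (Integrable.of_mem_Icc 0 1 (hψ.comp (hX 0)).aemeasurable (ae_of_all _ fun _ => hψ01 _))
    fun _ => mul_le_of_le_one_right (hψ01 _).1 (hψ01 _).2

lemma integral_blockSum_pow_three_le_sum (l : ℕ) :
    ∫ ω, blockSum X ψ 0 l ω ^ 3 ∂P ≤
      6 * ∑ t ∈ Finset.range l, ∑ s ∈ Finset.range (t + 1), ∑ u ∈ Finset.range (s + 1),
        ∫ ω, ψ (X (u : ℕ) ω) * ψ (X (s : ℕ) ω) * ψ (X (t : ℕ) ω) ∂P := by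
  have hi := fun t s u : ℕ => integrable_comp_mul_mul (P := P) hX hψ hψ01 u s t
  have hi' := fun t s : ℕ => integrable_finsetSum (Finset.range (s + 1)) fun u _ => hi t s u
  have hi'' := fun t : ℕ => integrable_finsetSum (Finset.range (t + 1)) fun s _ => hi' t s
  simp only [← integral_finsetSum _ fun u _ => hi _ _ u, ← integral_finsetSum _ fun s _ => hi' _ s,
    ← integral_finsetSum _ fun t _ => hi'' t, ← integral_const_mul]
  refine integral_mono_of_nonneg (ae_of_all _ fun _ => ?_)
    ((integrable_finsetSum _ fun t _ => hi'' t).const_mul 6) (ae_of_all _ fun ω => ?_)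
  · exact pow_nonneg (Finset.sum_nonneg fun t _ => (hψ01 _).1) 3
  · simpa [blockSum] using sum_pow_three_le (fun t => (hψ01 (X (t : ℕ) ω)).1) l

include hstat

variable {u s t : ℕ} (hus : u ≤ s)
include hus

lemma integral_triple_le (t : ℕ) :
    ∫ ω, ψ (X u ω) * ψ (X s ω) * ψ (X t ω) ∂P ≤ lagProd P X ψ (s - u) := by
  rw [← integral_mul_eq_lagProd hstat hψ hus]
  exact integral_mono (integrable_comp_mul_mul hX hψ hψ01 u s t)
    (integrable_comp_mul hX hψ hψ01 u s) fun _ =>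
      mul_le_of_le_one_right (mul_nonneg (hψ01 _).1 (hψ01 _).1) (hψ01 _).2

lemma integral_triple_le_add_alpha (hst : s ≤ t) :
    ∫ ω, ψ (X u ω) * ψ (X s ω) * ψ (X t ω) ∂P ≤
      lagProd P X ψ (s - u) * (∫ ω, ψ (X 0 ω) ∂P) + alphaMixingCoeff P X (t - s) := by
  have hpair : ∀ ω, ψ (X u ω) * ψ (X s ω) ∈ Set.Icc 0 1 := fun _ =>
    unitInterval.mul_mem (hψ01 _) (hψ01 _)
  have hcov := (hstat.alphaDependenceLE s (t - s)).abs_covariance_le_of_mem_unitInterval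
    (windowAlgebra_le hX _) (windowAlgebra_le hX _) (F := fun ω => ψ (X u ω) * ψ (X s ω))
    (G := fun ω => ψ (X t ω))
    ((hψ.comp (measurable_windowAlgebra (Set.mem_Iic.2 (by exact_mod_cast hus)))).mul
      (hψ.comp (measurable_windowAlgebra (Set.mem_Iic.2 le_rfl))))
    (hψ.comp (measurable_windowAlgebra (Set.mem_Ici.2 (by omega)))) hpair (fun _ => hψ01 _)
  have hle := (le_abs_self _).trans hcov
  have hpairL2 : MemLp (fun ω => ψ (X u ω) * ψ (X s ω)) 2 P :=
    memLp_of_mem_unitInterval ((hψ.comp (hX u)).mul (hψ.comp (hX s))) hpair 2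
  have hlastL2 : MemLp (fun ω => ψ (X t ω)) 2 P :=
    memLp_of_mem_unitInterval (hψ.comp (hX t)) (fun _ => hψ01 _) 2
  rw [covariance_eq_sub hpairL2 hlastL2, integral_comp_eq hstat hψ t,
    integral_mul_eq_lagProd hstat hψ hus] at hle
  simp only [Pi.mul_apply] at hle
  linarith

omit hus

lemma integral_blockSum_pow_three_le (l : ℕ) :
    ∫ ω, blockSum X ψ 0 l ω ^ 3 ∂P ≤ 6 * (l * (l * ∑ g ∈ Finset.range l, lagProd P X ψ g)) := by
  have hnn := lagProd_nonneg (P := P) (X := X) fun x => (hψ01 x).1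
  refine (integral_blockSum_pow_three_le_sum hX hψ hψ01 l).trans
    (mul_le_mul_of_nonneg_left ?_ (by norm_num))
  refine (Finset.sum_le_card_nsmul _ _ (l * ∑ g ∈ Finset.range l, lagProd P X ψ g)
    fun t ht => ?_).trans (by simp)
  have htl := Finset.mem_range.1 ht
  refine (Finset.sum_le_card_nsmul _ _ (∑ g ∈ Finset.range l, lagProd P X ψ g)
    fun s hs => ?_).trans ?_
  · have hst := Finset.mem_range.1 hs
    refine (Finset.sum_le_sum fun u hu => integral_triple_le hX hstat hψ hψ01
      (Nat.lt_succ_iff.1 (Finset.mem_range.1 hu)) t).trans ?_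
    exact sum_range_sub_le hnn (by omega)
  · rw [Finset.card_range, nsmul_eq_mul]
    exact mul_le_mul_of_nonneg_right (by exact_mod_cast htl) (Finset.sum_nonneg fun g _ => hnn g)

lemma sum_integral_triple_le {s t l : ℕ} (hst : s ≤ t) (hsl : s < l) (r : ℕ) :
    ∑ u ∈ Finset.range (s + 1), ∫ ω, ψ (X (u : ℕ) ω) * ψ (X (s : ℕ) ω) * ψ (X (t : ℕ) ω) ∂P ≤
      if t - s < r then ∑ g ∈ Finset.range l, lagProd P X ψ g
      else (∑ g ∈ Finset.range l, lagProd P X ψ g) * (∫ ω, ψ (X 0 ω) ∂P) +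
        l * alphaMixingCoeff P X (t - s) := by
  have hsum : ∑ u ∈ Finset.range (s + 1), lagProd P X ψ (s - u) ≤
      ∑ g ∈ Finset.range l, lagProd P X ψ g :=
    sum_range_sub_le (lagProd_nonneg fun x => (hψ01 x).1) hsl
  have hp : 0 ≤ ∫ ω, ψ (X 0 ω) ∂P := integral_nonneg fun ω => (hψ01 _).1
  split_ifs
  · exact (Finset.sum_le_sum fun u hu => integral_triple_le hX hstat hψ hψ01
      (Nat.lt_succ_iff.1 (Finset.mem_range.1 hu)) t).trans hsum
  · refine (Finset.sum_le_sum fun u hu => integral_triple_le_add_alpha hX hstat hψ hψ01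
      (Nat.lt_succ_iff.1 (Finset.mem_range.1 hu)) hst).trans ?_
    rw [Finset.sum_add_distrib, ← Finset.sum_mul, Finset.sum_const, Finset.card_range, nsmul_eq_mul]
    exact add_le_add (mul_le_mul_of_nonneg_right hsum hp)
      (mul_le_mul_of_nonneg_right (by exact_mod_cast hsl) (alphaMixingCoeff_nonneg _))

lemma integral_blockSum_pow_three_le_add_alpha (l r : ℕ) :
    ∫ ω, blockSum X ψ 0 l ω ^ 3 ∂P ≤
      6 * (l * (r * (∑ g ∈ Finset.range l, lagProd P X ψ g) +
        l * ((∑ g ∈ Finset.range l, lagProd P X ψ g) * ∫ ω, ψ (X 0 ω) ∂P) +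
        l * ∑ g ∈ Finset.Ico r l, alphaMixingCoeff P X g)) := by
  refine (integral_blockSum_pow_three_le_sum hX hψ hψ01 l).trans
    (mul_le_mul_of_nonneg_left ?_ (by norm_num))
  have hQ : 0 ≤ ∑ g ∈ Finset.range l, lagProd P X ψ g :=
    Finset.sum_nonneg fun g _ => lagProd_nonneg (fun x => (hψ01 x).1) g
  have hp : 0 ≤ ∫ ω, ψ (X 0 ω) ∂P := integral_nonneg fun ω => (hψ01 _).1
  have hbound := sum_range_ite_lt_le hQ (mul_nonneg hQ hp)
    (fun g => l * alphaMixingCoeff P X g) l r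
  rw [← Finset.mul_sum] at hbound
  refine (Finset.sum_le_card_nsmul _ _ _ fun t ht => ?_).trans
    ((nsmul_le_nsmul_right hbound _).trans_eq (by rw [Finset.card_range, nsmul_eq_mul]))
  have htl := Finset.mem_range.1 ht
  refine (Finset.sum_le_sum fun s hs => ?_).trans (sum_range_sub_le (fun g => ?_) htl)
  · have hst := Nat.lt_succ_iff.1 (Finset.mem_range.1 hs)
    exact sum_integral_triple_le hX hstat hψ hψ01 hst (hst.trans_lt htl) r
  · split_ifs
    · exact hQ
    · exact add_nonneg (mul_nonneg hQ hp)
        (mul_nonneg (Nat.cast_nonneg l) (alphaMixingCoeff_nonneg g))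

end ThirdMoment

section Blocks

variable {u : EuclideanSpace ℝ (Fin d) → ℝ} (hu : Measurable u)

omit mΩ in
include hu in
lemma measurable_windowAlgebra_blockSum {T : Set ℤ} {s l : ℕ}
    (hT : ∀ i < l, ((s + i : ℕ) : ℤ) ∈ T) : Measurable[windowAlgebra X T] (blockSum X u s l) :=
  Finset.measurable_fun_sum _ fun i hi =>
    hu.comp (measurable_windowAlgebra (hT i (Finset.mem_range.1 hi)))

variable (hX : ∀ t, Measurable (X t)) (hstat : IsStrictlyStationary P X) [IsProbabilityMeasure P]
include hu hX hstat

lemma norm_integral_exp_sum_blockSum_sub_le {l r m : ℕ} (hlr : l + r ≤ m) (k : ℕ) :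
    ‖∫ ω, Complex.exp (((∑ j ∈ Finset.range k, blockSum X u (j * m + 1) l ω : ℝ) : ℂ) *
        Complex.I) ∂P -
      (∫ ω, Complex.exp ((blockSum X u 0 l ω : ℂ) * Complex.I) ∂P) ^ k‖ ≤
      16 * k * alphaMixingCoeff P X r := by
  set χ := ∫ ω, Complex.exp ((blockSum X u 0 l ω : ℂ) * Complex.I) ∂P
  have hχ : ‖χ‖ ≤ 1 := by
    refine (norm_integral_le_of_norm_le_const (C := 1) (ae_of_all _ fun ω => ?_)).trans (by simp)
    rw [Complex.norm_exp_ofReal_mul_I]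
  induction k with
  | zero => simp
  | succ k ih =>
    have hpast : Measurable[windowAlgebra X (Set.Iic ((k : ℤ) * m + 1 - r))]
        fun ω => ∑ j ∈ Finset.range k, blockSum X u (j * m + 1) l ω := by
      refine Finset.measurable_fun_sum _ fun j hj =>
        measurable_windowAlgebra_blockSum hu fun i hi => Set.mem_Iic.2 ?_
      have hjk : (j + 1) * m ≤ k * m := Nat.mul_le_mul_right m (Finset.mem_range.1 hj)
      rw [Nat.add_mul, one_mul] at hjk
      zify at *
      linarith
    have hfuture : Measurable[windowAlgebra X (Set.Ici ((k : ℤ) * m + 1 - r + r))]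
        (blockSum X u (k * m + 1) l) :=
      measurable_windowAlgebra_blockSum hu fun i _ => Set.mem_Ici.2 (by push_cast; omega)
    have hsplit := (hstat.alphaDependenceLE _ r).norm_integral_exp_add_sub_mul_le
      (windowAlgebra_le hX _) (windowAlgebra_le hX _) hpast hfuture
    rw [integral_exp_blockSum_eq hstat hu] at hsplit
    simp only [Finset.sum_range_succ _ k]
    refine (norm_sub_le_norm_sub_add_norm_sub _ _ _).trans
      ((add_le_add hsplit (?_ : _ ≤ 16 * k * alphaMixingCoeff P X r)).trans_eq
        (by push_cast; ring))
    rw [pow_succ, ← sub_mul, norm_mul]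
    exact (mul_le_of_le_one_right (norm_nonneg _) hχ).trans ih

end Blocks

end Moments

section UniformTails

/-- The series `∑ g, f n g` have absolute tails that are small uniformly in large `n`. This allows
termwise passage to the limit when no summable sequence dominates all the `f n`. -/
def HasUniformlySmallTails (f : ℕ → ℕ → ℝ) : Prop :=
  ∀ ε : ℝ, 0 < ε → ∃ k : ℕ, ∀ᶠ n in atTop, ∀ N : ℕ, ∑ g ∈ Finset.Ico k N, |f n g| ≤ ε

lemma sum_range_le_add_sum_Ico {F : ℕ → ℝ} (hF : ∀ g, 0 ≤ F g) (k N : ℕ) :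
    ∑ g ∈ Finset.range N, F g ≤ ∑ g ∈ Finset.range k, F g + ∑ g ∈ Finset.Ico k N, F g := by
  rcases le_total k N with h | h
  · rw [Finset.sum_range_add_sum_Ico _ h]
  · rw [Finset.Ico_eq_empty_of_le h, Finset.sum_empty, add_zero]
    exact Finset.sum_le_sum_of_subset_of_nonneg (Finset.range_mono h) fun g _ _ => hF g

lemma abs_sum_range_sub_sum_range_le (F : ℕ → ℝ) {k M N : ℕ} (hM : k ≤ M) (hN : k ≤ N) :
    |∑ g ∈ Finset.range M, F g - ∑ g ∈ Finset.range N, F g| ≤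
      ∑ g ∈ Finset.Ico k (max M N), |F g| := by
  wlog h : N ≤ M generalizing M N
  · rw [abs_sub_comm, max_comm]
    exact this hN hM (not_le.1 h).le
  rw [← Finset.sum_Ico_eq_sub _ h, max_eq_left h]
  exact (Finset.abs_sum_le_sum_abs _ _).trans (Finset.sum_le_sum_of_subset_of_nonneg
    (Finset.Ico_subset_Ico_left hN) fun g _ _ => abs_nonneg _)

namespace HasUniformlySmallTails

variable {f : ℕ → ℕ → ℝ}

lemma comp_succ (hf : HasUniformlySmallTails f) :
    HasUniformlySmallTails fun n g => f n (g + 1) := by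
  intro ε hε
  obtain ⟨k, hk⟩ := hf ε hε
  refine ⟨k, hk.mono fun n hn N => le_trans ?_ (hn (N + 1))⟩
  rw [Finset.sum_Ico_add' (fun g => |f n g|)]
  exact Finset.sum_le_sum_of_subset_of_nonneg (Finset.Ico_subset_Ico_left k.le_succ)
    fun g _ _ => abs_nonneg _

lemma bounded_mul (hf : HasUniformlySmallTails f) {w : ℕ → ℕ → ℝ} {C : ℝ}
    (hw : ∀ᶠ n in atTop, ∀ g, |w n g| ≤ C) : HasUniformlySmallTails fun n g => w n g * f n g := by
  obtain ⟨n₀, hn₀⟩ := hw.exists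
  have hC : 0 ≤ C := (abs_nonneg _).trans (hn₀ 0)
  intro ε hε
  obtain ⟨k, hk⟩ := hf (ε / (C + 1)) (by positivity)
  refine ⟨k, ?_⟩
  filter_upwards [hk, hw] with n hn hwn N
  calc ∑ g ∈ Finset.Ico k N, |w n g * f n g|
      ≤ ∑ g ∈ Finset.Ico k N, (C + 1) * |f n g| := Finset.sum_le_sum fun g _ => by
        rw [abs_mul]
        exact mul_le_mul_of_nonneg_right ((hwn g).trans (le_add_of_nonneg_right zero_le_one))
          (abs_nonneg _)
    _ ≤ (C + 1) * (ε / (C + 1)) := by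
        rw [← Finset.mul_sum]
        exact mul_le_mul_of_nonneg_left (hn N) (by positivity)
    _ = ε := mul_div_cancel₀ _ (by positivity)

lemma exists_sum_range_le (hf : HasUniformlySmallTails f)
    (hb : ∀ g, IsBoundedUnder (· ≤ ·) atTop fun n => |f n g|) :
    ∃ C, ∀ᶠ n in atTop, ∀ N : ℕ, ∑ g ∈ Finset.range N, |f n g| ≤ C := by
  obtain ⟨k, hk⟩ := hf 1 one_pos
  choose b hb' using hb
  refine ⟨∑ g ∈ Finset.range k, b g + 1, ?_⟩
  filter_upwards [hk, (Finset.range k).eventually_all.2 fun g _ => eventually_map.1 (hb' g)]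
    with n hn hbn N
  exact (sum_range_le_add_sum_Ico (fun g => abs_nonneg (f n g)) k N).trans
    (add_le_add (Finset.sum_le_sum hbn) (hn N))

variable {G : ℕ → ℝ} (hG : ∀ g, Tendsto (fun n => f n g) atTop (𝓝 (G g)))

include hG

lemma summable_limit (hf : HasUniformlySmallTails f) : Summable G := by
  obtain ⟨C, hC⟩ := hf.exists_sum_range_le fun g => (hG g).abs.isBoundedUnder_le
  refine (summable_of_sum_range_le (c := C) (fun g => abs_nonneg (G g)) fun N => ?_).of_abs
  exact le_of_tendsto (tendsto_finsetSum _ fun g _ => (hG g).abs) (hC.mono fun n hn => hn N)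

lemma tendsto_sum_range (hf : HasUniformlySmallTails f) {N : ℕ → ℕ} (hN : Tendsto N atTop atTop) :
    Tendsto (fun n => ∑ g ∈ Finset.range (N n), f n g) atTop (𝓝 (∑' g, G g)) := by
  refine TendstoUniformlyOnFilter.tendsto_of_eventually_tendsto
    (F := fun k n => ∑ g ∈ Finset.range k, f n g) (p := atTop) ?_
    (Eventually.of_forall fun k => tendsto_finsetSum (Finset.range k) fun g _ => hG g)
    (hf.summable_limit hG).hasSum.tendsto_sum_nat
  refine Metric.tendstoUniformlyOnFilter_iff.2 fun ε hε => ?_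
  obtain ⟨k, hk⟩ := hf (ε / 2) (half_pos hε)
  filter_upwards [(eventually_ge_atTop k).prod_mk (hk.and (hN.eventually_ge_atTop k))]
    with ⟨i, n⟩ ⟨hi, hn, hNn⟩
  exact ((abs_sum_range_sub_sum_range_le _ hNn hi).trans (hn _)).trans_lt (half_lt_self hε)

end HasUniformlySmallTails

end UniformTails

section TailArrays

variable {Ω : Type*} [mΩ : MeasurableSpace Ω] {d : ℕ} {P : Measure Ω}
  {X : ℤ → Ω → EuclideanSpace ℝ (Fin d)} {a : ℕ → ℝ} {m r : ℕ → ℕ}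

lemma MixingCondition.sum_alpha_le (hM : MixingCondition P X a m r) {ε : ℝ} (hε : 0 < ε) :
    ∀ᶠ n in atTop, ∀ N : ℕ,
      (m n : ℝ) * ∑ g ∈ Finset.Ico (r n) N, alphaMixingCoeff P X g ≤ ε := by
  filter_upwards [hM.mixing_rate.eventually (gt_mem_nhds (ENNReal.ofReal_pos.2 hε))] with n hn N
  rw [← ENNReal.ofReal_le_ofReal_iff hε.le, ENNReal.ofReal_mul (Nat.cast_nonneg _),
    ENNReal.ofReal_natCast, ENNReal.ofReal_sum_of_nonneg fun g _ => alphaMixingCoeff_nonneg g,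
    Finset.sum_Ico_eq_sum_range]
  exact (mul_le_mul_right (ENNReal.sum_le_tsum _) _).trans hn.le

lemma MixingCondition.eventually_pos (hM : MixingCondition P X a m r) :
    ∀ᶠ n in atTop, 0 < m n ∧ 0 < r n ∧ 0 < n ∧ r n ≤ m n ∧ m n ≤ n := by
  filter_upwards [hM.tendsto_m.eventually_gt_atTop 0, hM.tendsto_r.eventually_gt_atTop 0,
    eventually_gt_atTop 0, hM.r_div_m.eventually (gt_mem_nhds one_pos),
    hM.m_div_n.eventually (gt_mem_nhds one_pos)] with n hm hr hn hrm hmn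
  rw [div_lt_one (Nat.cast_pos.2 hm), Nat.cast_lt] at hrm
  rw [div_lt_one (Nat.cast_pos.2 hn), Nat.cast_lt] at hmn
  exact ⟨hm, hr, hn, hrm.le, hmn.le⟩

lemma sum_Ico_le_add {F F₁ F₂ : ℕ → ℝ} {k r N : ℕ} (h₁ : ∀ g, F g ≤ F₁ g) (h₂ : ∀ g, F g ≤ F₂ g)
    (h₁0 : ∀ g, 0 ≤ F₁ g) (h₂0 : ∀ g, 0 ≤ F₂ g) :
    ∑ g ∈ Finset.Ico k N, F g ≤ ∑ g ∈ Finset.Icc k r, F₁ g + ∑ g ∈ Finset.Ico r N, F₂ g := by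
  rw [← Finset.sum_filter_add_sum_filter_not (Finset.Ico k N) (fun g => g ≤ r)]
  refine add_le_add ((Finset.sum_le_sum fun g _ => h₁ g).trans
    (Finset.sum_le_sum_of_subset_of_nonneg (fun g hg => ?_) fun g _ _ => h₁0 g))
    ((Finset.sum_le_sum fun g _ => h₂ g).trans
    (Finset.sum_le_sum_of_subset_of_nonneg (fun g hg => ?_) fun g _ _ => h₂0 g))
  · simp only [Finset.mem_filter, Finset.mem_Ico] at hg
    exact Finset.mem_Icc.2 ⟨hg.1.1, hg.2⟩
  · simp only [Finset.mem_filter, Finset.mem_Ico] at hg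
    exact Finset.mem_Ico.2 ⟨by omega, hg.1.2⟩

/-- A triangular array `ψ n (X t)` of `[0, 1]`-valued functionals (such as indicators of rare
events) of expected size `O(1 / m n)`, whose joint moments do not cluster up to lag `r n`. -/
structure RareEventArray (P : Measure Ω) (X : ℤ → Ω → EuclideanSpace ℝ (Fin d)) (m r : ℕ → ℕ)
    (ψ : ℕ → EuclideanSpace ℝ (Fin d) → ℝ) : Prop where
  measurable : ∀ n, Measurable (ψ n)
  mem_Icc : ∀ n x, ψ n x ∈ Set.Icc 0 1
  mean : ∃ C, ∀ᶠ n in atTop, (m n : ℝ) * ∫ ω, ψ n (X 0 ω) ∂P ≤ C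
  anti_clustering : ∀ ε : ℝ, 0 < ε → ∃ k : ℕ, ∀ᶠ n in atTop,
    (m n : ℝ) * ∑ g ∈ Finset.Icc k (r n), lagProd P X (ψ n) g ≤ ε

/-- A triangular array `φ n (X t)` of real functionals dominated, up to the factor `c`, by a rare
event array `ψ`. It plays the role of a linear combination of indicators of rare events. -/
structure TailArray (P : Measure Ω) (X : ℤ → Ω → EuclideanSpace ℝ (Fin d)) (m r : ℕ → ℕ)
    (φ ψ : ℕ → EuclideanSpace ℝ (Fin d) → ℝ) (c : ℝ) : Prop where
  rare : RareEventArray P X m r ψ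
  measurable : ∀ n, Measurable (φ n)
  pos : 0 < c
  dominated : ∀ n x, |φ n x| ≤ c * ψ n x

namespace RareEventArray

variable {ψ : ℕ → EuclideanSpace ℝ (Fin d) → ℝ}

lemma tailArray (hψ : RareEventArray P X m r ψ) : TailArray P X m r ψ ψ 1 where
  rare := hψ
  measurable := hψ.measurable
  pos := one_pos
  dominated n x := by rw [abs_of_nonneg (hψ.mem_Icc n x).1, one_mul]

lemma mean_nonneg (hψ : RareEventArray P X m r ψ) (n : ℕ) : 0 ≤ ∫ ω, ψ n (X 0 ω) ∂P :=
  integral_nonneg fun _ => (hψ.mem_Icc n _).1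

lemma tendsto_mean_sq (hψ : RareEventArray P X m r ψ) (hM : MixingCondition P X a m r) :
    Tendsto (fun n => (m n : ℝ) * (r n + 1) * (∫ ω, ψ n (X 0 ω) ∂P) ^ 2) atTop (𝓝 0) := by
  obtain ⟨C, hC⟩ := hψ.mean
  have hm_inv : Tendsto (fun n => (m n : ℝ)⁻¹) atTop (𝓝 0) :=
    (tendsto_natCast_atTop_atTop.comp hM.tendsto_m).inv_tendsto_atTop
  have hbound : Tendsto (fun n => C ^ 2 * ((r n : ℝ) / m n + (m n : ℝ)⁻¹)) atTop (𝓝 0) := by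
    simpa only [add_zero, mul_zero] using (hM.r_div_m.add hm_inv).const_mul (C ^ 2)
  refine squeeze_zero' (Eventually.of_forall fun n => by positivity) ?_ hbound
  filter_upwards [hC, hM.eventually_pos] with n hn hpos
  have hm0 : (0 : ℝ) < m n := Nat.cast_pos.2 hpos.1
  have hp := hψ.mean_nonneg n
  calc (m n : ℝ) * (r n + 1) * (∫ ω, ψ n (X 0 ω) ∂P) ^ 2
      = ((m n : ℝ) * ∫ ω, ψ n (X 0 ω) ∂P) ^ 2 * ((r n : ℝ) / m n + (m n : ℝ)⁻¹) := by field_simp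
    _ ≤ C ^ 2 * ((r n : ℝ) / m n + (m n : ℝ)⁻¹) := by gcongr

end RareEventArray

namespace TailArray

variable {φ ψ : ℕ → EuclideanSpace ℝ (Fin d) → ℝ} {c : ℝ}

lemma abs_le (hA : TailArray P X m r φ ψ c) (n : ℕ) (x : EuclideanSpace ℝ (Fin d)) :
    |φ n x| ≤ c :=
  (hA.dominated n x).trans (mul_le_of_le_one_right hA.pos.le (hA.rare.mem_Icc n x).2)

variable [IsProbabilityMeasure P]

section Measurable

variable (hA : TailArray P X m r φ ψ c) (hX : ∀ t, Measurable (X t))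

include hA hX

lemma memLp (n : ℕ) (t : ℤ) (p : ℝ≥0∞) : MemLp (fun ω => φ n (X t ω)) p P :=
  memLp_of_abs_le ((hA.measurable n).comp (hX t)) (fun _ => hA.abs_le n _) p

lemma abs_mean_le (n : ℕ) : |∫ ω, φ n (X 0 ω) ∂P| ≤ c * ∫ ω, ψ n (X 0 ω) ∂P := by
  rw [← integral_const_mul]
  exact abs_integral_le_integral_abs.trans (integral_mono
    ((hA.memLp hX n 0 1).integrable le_rfl).abs
    (((hA.rare.tailArray.memLp hX n 0 1).integrable le_rfl).const_mul c)
    fun ω => hA.dominated n _)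

lemma abs_lagProd_le (n g : ℕ) : |lagProd P X (φ n) g| ≤ c ^ 2 * lagProd P X (ψ n) g := by
  rw [lagProd, lagProd, ← integral_const_mul]
  refine abs_integral_le_integral_abs.trans (integral_mono
    ((hA.memLp hX n 0 2).integrable_mul (hA.memLp hX n g 2)).abs
    ((integrable_comp_mul hX (hA.rare.measurable n) (hA.rare.mem_Icc n) 0 g).const_mul _)
    fun ω => ?_)
  calc |φ n (X 0 ω) * φ n (X g ω)| ≤ c * ψ n (X 0 ω) * (c * ψ n (X g ω)) := by
        rw [abs_mul]
        exact mul_le_mul (hA.dominated n _) (hA.dominated n _) (abs_nonneg _)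
          (mul_nonneg hA.pos.le (hA.rare.mem_Icc n _).1)
    _ = c ^ 2 * (ψ n (X 0 ω) * ψ n (X g ω)) := by ring

variable (hstat : IsStrictlyStationary P X)

include hstat

lemma lagCov_eq_sub (n g : ℕ) :
    lagCov P X (φ n) g = lagProd P X (φ n) g - (∫ ω, φ n (X 0 ω) ∂P) ^ 2 := by
  rw [lagCov, covariance_eq_sub (hA.memLp hX n 0 2) (hA.memLp hX n g 2),
    integral_comp_eq hstat (hA.measurable n) g, sq]
  rfl

lemma abs_lagCov_le (n g : ℕ) :
    |lagCov P X (φ n) g| ≤ c ^ 2 * (lagProd P X (ψ n) g + (∫ ω, ψ n (X 0 ω) ∂P) ^ 2) := by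
  rw [hA.lagCov_eq_sub hX hstat, mul_add, ← mul_pow]
  refine (abs_sub _ _).trans (add_le_add (hA.abs_lagProd_le hX n g) ?_)
  rw [abs_pow]
  exact pow_le_pow_left₀ (abs_nonneg _) (hA.abs_mean_le hX n) 2

lemma abs_lagCov_le_alpha (n g : ℕ) :
    |lagCov P X (φ n) g| ≤ 4 * c ^ 2 * alphaMixingCoeff P X g := by
  refine ((hstat.alphaDependenceLE 0 g).abs_covariance_le (windowAlgebra_le hX _)
    (windowAlgebra_le hX _) ((hA.measurable n).comp (measurable_windowAlgebra (by simp)))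
    ((hA.measurable n).comp (measurable_windowAlgebra (by simp))) hA.pos hA.pos
    (fun ω => hA.abs_le n _) fun ω => hA.abs_le n _).trans_eq (by ring)

lemma sum_abs_lagCov_le (n k N : ℕ) :
    ∑ g ∈ Finset.Ico k N, |lagCov P X (φ n) g| ≤
      c ^ 2 * (∑ g ∈ Finset.Icc k (r n), lagProd P X (ψ n) g +
        (r n + 1) * (∫ ω, ψ n (X 0 ω) ∂P) ^ 2) +
      4 * c ^ 2 * ∑ g ∈ Finset.Ico (r n) N, alphaMixingCoeff P X g := by
  have hcard : ((r n + 1 - k : ℕ) : ℝ) ≤ r n + 1 := by exact_mod_cast Nat.sub_le _ _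
  refine (sum_Ico_le_add (r := r n) (hA.abs_lagCov_le hX hstat n)
    (hA.abs_lagCov_le_alpha hX hstat n)
    (fun g => mul_nonneg (sq_nonneg c)
      (add_nonneg (lagProd_nonneg (fun x => (hA.rare.mem_Icc n x).1) g) (sq_nonneg _)))
    (fun g => mul_nonneg (by positivity) (alphaMixingCoeff_nonneg g))).trans ?_
  rw [← Finset.mul_sum, ← Finset.mul_sum, Finset.sum_add_distrib, Finset.sum_const,
    nsmul_eq_mul, Nat.card_Icc]
  gcongr

variable (hM : MixingCondition P X a m r)

include hM

lemma hasUniformlySmallTails :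
    HasUniformlySmallTails fun n g => (m n : ℝ) * lagCov P X (φ n) g := by
  intro ε hε
  have hc := hA.pos
  obtain ⟨k, hk⟩ := hA.rare.anti_clustering (ε / (3 * c ^ 2)) (by positivity)
  refine ⟨k, ?_⟩
  filter_upwards [hk, (hA.rare.tendsto_mean_sq hM).eventually
      (ge_mem_nhds (show 0 < ε / (3 * c ^ 2) by positivity)),
    hM.sum_alpha_le (show 0 < ε / (12 * c ^ 2) by positivity)] with n hclust hmean halpha N
  simp only [abs_mul, Nat.abs_cast, ← Finset.mul_sum]
  calc (m n : ℝ) * ∑ g ∈ Finset.Ico k N, |lagCov P X (φ n) g|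
      ≤ m n * (c ^ 2 * (∑ g ∈ Finset.Icc k (r n), lagProd P X (ψ n) g +
          (r n + 1) * (∫ ω, ψ n (X 0 ω) ∂P) ^ 2) +
        4 * c ^ 2 * ∑ g ∈ Finset.Ico (r n) N, alphaMixingCoeff P X g) :=
        mul_le_mul_of_nonneg_left (hA.sum_abs_lagCov_le hX hstat n k N) (Nat.cast_nonneg _)
    _ = c ^ 2 * (m n * ∑ g ∈ Finset.Icc k (r n), lagProd P X (ψ n) g) +
        c ^ 2 * (m n * (r n + 1) * (∫ ω, ψ n (X 0 ω) ∂P) ^ 2) +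
        4 * c ^ 2 * (m n * ∑ g ∈ Finset.Ico (r n) N, alphaMixingCoeff P X g) := by ring
    _ ≤ c ^ 2 * (ε / (3 * c ^ 2)) + c ^ 2 * (ε / (3 * c ^ 2)) +
        4 * c ^ 2 * (ε / (12 * c ^ 2)) := by
        have := halpha N
        gcongr
    _ = ε := by field_simp; norm_num

lemma isBoundedUnder_lagCov (g : ℕ) :
    IsBoundedUnder (· ≤ ·) atTop fun n => |(m n : ℝ) * lagCov P X (φ n) g| := by
  obtain ⟨C, hC⟩ := hA.rare.mean
  refine ⟨c ^ 2 * (C + 1), eventually_map.2 ?_⟩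
  filter_upwards [hC, (hA.rare.tendsto_mean_sq hM).eventually (ge_mem_nhds one_pos)] with n hn hsq
  set p := ∫ ω, ψ n (X 0 ω) ∂P
  have hm0 : (0 : ℝ) ≤ m n := Nat.cast_nonneg _
  have hmr : (m n : ℝ) ≤ m n * (r n + 1) :=
    le_mul_of_one_le_right hm0 (le_add_of_nonneg_left (Nat.cast_nonneg _))
  have hlag := lagProd_le_integral (P := P) hX (hA.rare.measurable n) (hA.rare.mem_Icc n) g
  rw [abs_mul, Nat.abs_cast]
  calc (m n : ℝ) * |lagCov P X (φ n) g|
      ≤ m n * (c ^ 2 * (p + p ^ 2)) := by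
        have := hA.abs_lagCov_le hX hstat n g
        gcongr
        exact this.trans (by gcongr)
    _ = c ^ 2 * (m n * p + m n * p ^ 2) := by ring
    _ ≤ c ^ 2 * (C + m n * (r n + 1) * p ^ 2) := by gcongr
    _ ≤ c ^ 2 * (C + 1) := by gcongr

lemma exists_sum_abs_lagCov_le :
    ∃ C, ∀ᶠ n in atTop, ∀ N : ℕ,
      (m n : ℝ) * ∑ g ∈ Finset.range N, |lagCov P X (φ n) g| ≤ C := by
  simpa only [abs_mul, Nat.abs_cast, ← Finset.mul_sum] using
    (hA.hasUniformlySmallTails hX hstat hM).exists_sum_range_le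
      (hA.isBoundedUnder_lagCov hX hstat hM)

end Measurable

section Limit

variable (hA : TailArray P X m r φ ψ c) (hX : ∀ t, Measurable (X t))
  (hstat : IsStrictlyStationary P X) (hM : MixingCondition P X a m r) {G : ℕ → ℝ}
  (hG : ∀ g, Tendsto (fun n => (m n : ℝ) * lagProd P X (φ n) g) atTop (𝓝 (G g)))

include hA hX hstat hM hG

lemma tendsto_lagCov (g : ℕ) :
    Tendsto (fun n => (m n : ℝ) * lagCov P X (φ n) g) atTop (𝓝 (G g)) := by
  have hmean : Tendsto (fun n => (m n : ℝ) * (∫ ω, φ n (X 0 ω) ∂P) ^ 2) atTop (𝓝 0) := by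
    have hbound := (hA.rare.tendsto_mean_sq hM).const_mul (c ^ 2)
    rw [mul_zero] at hbound
    refine squeeze_zero (fun n => by positivity) (fun n => ?_) hbound
    have hm0 : (0 : ℝ) ≤ m n := Nat.cast_nonneg _
    have hsq := pow_le_pow_left₀ (abs_nonneg _) (hA.abs_mean_le hX n) 2
    rw [sq_abs, mul_pow] at hsq
    calc (m n : ℝ) * (∫ ω, φ n (X 0 ω) ∂P) ^ 2
        ≤ m n * (r n + 1) * (c ^ 2 * (∫ ω, ψ n (X 0 ω) ∂P) ^ 2) :=
          mul_le_mul (le_mul_of_one_le_right hm0 (le_add_of_nonneg_left (Nat.cast_nonneg _)))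
            hsq (sq_nonneg _) (by positivity)
      _ = c ^ 2 * (m n * (r n + 1) * (∫ ω, ψ n (X 0 ω) ∂P) ^ 2) := by ring
  simpa only [hA.lagCov_eq_sub hX hstat, mul_sub, sub_zero] using (hG g).sub hmean

lemma summable_limit : Summable G :=
  (hA.hasUniformlySmallTails hX hstat hM).summable_limit (hA.tendsto_lagCov hX hstat hM hG)

lemma tendsto_variance_blockSum {l : ℕ → ℕ}
    (hl : Tendsto (fun n => (l n : ℝ) / m n) atTop (𝓝 1)) :
    Tendsto (fun n => Var[blockSum X (φ n) 0 (l n); P]) atTop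
      (𝓝 (G 0 + 2 * ∑' g, G (g + 1))) := by
  have hm : Tendsto (fun n => (m n : ℝ)) atTop atTop :=
    tendsto_natCast_atTop_atTop.comp hM.tendsto_m
  have hm0 : ∀ᶠ n in atTop, (m n : ℝ) ≠ 0 := hm.eventually_ne_atTop 0
  have hl_atTop : Tendsto l atTop atTop :=
    tendsto_natCast_atTop_iff.1 ((hl.pos_mul_atTop one_pos hm).congr'
      (hm0.mono fun n hn => div_mul_cancel₀ _ hn))
  set w : ℕ → ℕ → ℝ := fun n g => ((l n - (g + 1) : ℕ) : ℝ) / m n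
  have hw_le : ∀ᶠ n in atTop, ∀ g, |w n g| ≤ 2 :=
    (hl.eventually (ge_mem_nhds one_lt_two)).mono fun n hn g => by
      rw [abs_of_nonneg (by positivity)]
      exact (div_le_div_of_nonneg_right (Nat.cast_le.2 (Nat.sub_le _ _))
        (Nat.cast_nonneg _)).trans hn
  have hw : ∀ g, Tendsto (fun n => w n g) atTop (𝓝 1) := fun g => by
    have hlim := hl.sub (hm.const_div_atTop ((g + 1 : ℕ) : ℝ))
    rw [sub_zero] at hlim
    refine hlim.congr' ((hl_atTop.eventually_ge_atTop (g + 1)).mono fun n hn => ?_)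
    simp only [w, Nat.cast_sub hn, sub_div]
  have hcov := hA.tendsto_lagCov hX hstat hM hG
  have htails := (hA.hasUniformlySmallTails hX hstat hM).comp_succ.bounded_mul hw_le
  have hsum := htails.tendsto_sum_range (fun g => (hw g).mul (hcov (g + 1))) hl_atTop
  have hlim := (hl.mul (hcov 0)).add (hsum.const_mul 2)
  simp only [one_mul] at hlim
  refine hlim.congr' (hm0.mono fun n hn => ?_)
  have hcancel : ∀ x y : ℝ, x / m n * (m n * y) = x * y := fun x y => by
    rw [← mul_assoc, div_mul_cancel₀ x hn]
  simp only [variance_blockSum hX hstat (hA.measurable n) (hA.abs_le n), w, hcancel]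

lemma limit_variance_nonneg : 0 ≤ G 0 + 2 * ∑' g, G (g + 1) := by
  refine ge_of_tendsto' (hA.tendsto_variance_blockSum hX hstat hM hG (l := m) ?_)
    fun n => variance_nonneg _ _
  refine tendsto_const_nhds.congr' (hM.eventually_pos.mono fun n hn => ?_)
  exact (div_self (Nat.cast_ne_zero.2 hn.1.ne')).symm

end Limit

end TailArray

namespace RareEventArray

lemma exists_sum_lagProd_le {ψ : ℕ → EuclideanSpace ℝ (Fin d) → ℝ} [IsProbabilityMeasure P]
    (hψ : RareEventArray P X m r ψ) (hX : ∀ t, Measurable (X t))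
    (hstat : IsStrictlyStationary P X) (hM : MixingCondition P X a m r) :
    ∃ C, ∀ᶠ n in atTop, (m n : ℝ) * ∑ g ∈ Finset.range (m n), lagProd P X (ψ n) g ≤ C := by
  obtain ⟨C, hC⟩ := hψ.mean
  obtain ⟨D, hD⟩ := hψ.tailArray.exists_sum_abs_lagCov_le hX hstat hM
  refine ⟨D + C ^ 2, ?_⟩
  filter_upwards [hC, hD] with n hn hcov
  set p := ∫ ω, ψ n (X 0 ω) ∂P
  have hmp : 0 ≤ (m n : ℝ) * p := mul_nonneg (Nat.cast_nonneg _) (hψ.mean_nonneg n)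
  have hlag : ∀ g, lagProd P X (ψ n) g ≤ |lagCov P X (ψ n) g| + p ^ 2 := fun g =>
    sub_le_iff_le_add.1 ((hψ.tailArray.lagCov_eq_sub hX hstat n g).ge.trans (le_abs_self _))
  calc (m n : ℝ) * ∑ g ∈ Finset.range (m n), lagProd P X (ψ n) g
      ≤ m n * ∑ g ∈ Finset.range (m n), (|lagCov P X (ψ n) g| + p ^ 2) :=
        mul_le_mul_of_nonneg_left (Finset.sum_le_sum fun g _ => hlag g) (Nat.cast_nonneg _)
    _ = m n * ∑ g ∈ Finset.range (m n), |lagCov P X (ψ n) g| + (m n * p) ^ 2 := by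
        rw [Finset.sum_add_distrib, Finset.sum_const, Finset.card_range, nsmul_eq_mul]; ring
    _ ≤ D + C ^ 2 := add_le_add (hcov _) (pow_le_pow_left₀ hmp hn 2)

end RareEventArray

end TailArrays

section CharacteristicFunctions

lemma norm_exp_mul_I_sub_le (x : ℝ) :
    ‖Complex.exp ((x : ℂ) * Complex.I) - (1 + (x : ℂ) * Complex.I - (x : ℂ) ^ 2 / 2)‖ ≤
      4 * |x| ^ 3 := by
  have hnorm : ‖(x : ℂ) * Complex.I‖ = |x| := by simp
  rcases le_total |x| 1 with hx | hx
  · have htaylor := Complex.exp_bound (x := (x : ℂ) * Complex.I) (hnorm.le.trans hx) (n := 3)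
      (by norm_num)
    have hpoly : ∑ j ∈ Finset.range 3, ((x : ℂ) * Complex.I) ^ j / (j.factorial : ℂ) =
        1 + (x : ℂ) * Complex.I - (x : ℂ) ^ 2 / 2 := by
      simp [Finset.sum_range_succ, mul_pow]; ring
    rw [hpoly, hnorm] at htaylor
    norm_num [Nat.factorial] at htaylor
    linarith [pow_nonneg (abs_nonneg x) 3]
  · have hpoly : ‖1 + (x : ℂ) * Complex.I - (x : ℂ) ^ 2 / 2‖ ≤ 1 + |x| + |x| ^ 2 / 2 :=
      (norm_sub_le _ _).trans (add_le_add ((norm_add_le _ _).trans (by simp)) (by simp))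
    have hexp := Complex.norm_exp_ofReal_mul_I x
    have h₁ : |x| ≤ |x| ^ 3 := le_self_pow₀ hx three_ne_zero
    have h₂ : |x| ^ 2 ≤ |x| ^ 3 := pow_le_pow_right₀ hx (by norm_num)
    refine (norm_sub_le _ _).trans ?_
    linarith

lemma norm_exp_mul_I_sub_exp_mul_I_le (x y : ℝ) :
    ‖Complex.exp ((x : ℂ) * Complex.I) - Complex.exp ((y : ℂ) * Complex.I)‖ ≤ |x - y| := by
  have hfactor : Complex.exp ((x : ℂ) * Complex.I) - Complex.exp ((y : ℂ) * Complex.I) =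
      Complex.exp ((y : ℂ) * Complex.I) * (Complex.exp (Complex.I * ((x - y : ℝ) : ℂ)) - 1) := by
    rw [mul_sub, ← Complex.exp_add, mul_one]
    push_cast
    ring_nf
  rw [hfactor, norm_mul, Complex.norm_exp_ofReal_mul_I, one_mul]
  exact Real.norm_exp_I_mul_ofReal_sub_one_le

lemma tendsto_mul_log_one_add_sub {w : ℕ → ℂ} {k : ℕ → ℕ} {t : ℂ} (hw : Tendsto w atTop (𝓝 0))
    (h : Tendsto (fun n => (k n : ℂ) * w n) atTop (𝓝 t)) :
    Tendsto (fun n => (k n : ℂ) * (Complex.log (1 + w n) - w n)) atTop (𝓝 0) := by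
  obtain ⟨c, hc⟩ := (Complex.log_sub_self_isBigO.comp_tendsto hw).bound
  have hbound : Tendsto (fun n => c * (‖(k n : ℂ) * w n‖ * ‖w n‖)) atTop (𝓝 0) := by
    simpa using (h.norm.mul hw.norm).const_mul c
  refine squeeze_zero_norm' (hc.mono fun n hn => ?_) hbound
  simp only [Function.comp_apply, norm_pow] at hn
  rw [norm_mul, norm_mul]
  calc ‖(k n : ℂ)‖ * ‖Complex.log (1 + w n) - w n‖
      ≤ ‖(k n : ℂ)‖ * (c * ‖w n‖ ^ 2) := by gcongr
    _ = c * (‖(k n : ℂ)‖ * ‖w n‖ * ‖w n‖) := by ring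

lemma tendsto_pow_exp_of_tendsto_mul_sub_one {z : ℕ → ℂ} {k : ℕ → ℕ} {t : ℂ}
    (hk : Tendsto k atTop atTop) (h : Tendsto (fun n => (k n : ℂ) * (z n - 1)) atTop (𝓝 t)) :
    Tendsto (fun n => z n ^ k n) atTop (𝓝 (Complex.exp t)) := by
  have hk_inv : Tendsto (fun n => ((k n : ℂ))⁻¹) atTop (𝓝 0) :=
    tendsto_inv₀_cobounded.comp (tendsto_natCast_atTop_cobounded.comp hk)
  have hw : Tendsto (fun n => z n - 1) atTop (𝓝 0) := by
    have hprod := hk_inv.mul h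
    rw [zero_mul] at hprod
    exact hprod.congr' ((hk.eventually_gt_atTop 0).mono fun n hn =>
      inv_mul_cancel_left₀ (Nat.cast_ne_zero.2 hn.ne') _)
  have hlog := (tendsto_mul_log_one_add_sub hw h).add h
  rw [zero_add] at hlog
  refine ((Complex.continuous_exp.tendsto t).comp hlog).congr' ?_
  filter_upwards [hw.eventually_ne (show (0 : ℂ) ≠ -1 by simp)] with n hn
  have hz : z n ≠ 0 := fun h0 => hn (by simp [h0])
  simp only [Function.comp_apply]
  rw [← mul_add, sub_add_cancel, add_sub_cancel, Complex.exp_nat_mul, Complex.exp_log hz]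

variable {Ω : Type*} [MeasurableSpace Ω] {P : Measure Ω} [IsProbabilityMeasure P]

lemma integral_abs_le_sqrt_variance {Z : Ω → ℝ} (hZ : MemLp Z 2 P) (h0 : ∫ ω, Z ω ∂P = 0) :
    ∫ ω, |Z ω| ∂P ≤ √Var[Z; P] := by
  refine Real.le_sqrt_of_sq_le ?_
  have habs := variance_nonneg (fun ω => |Z ω|) P
  rw [variance_eq_sub (X := fun ω => |Z ω|) hZ.abs] at habs
  simp only [Pi.pow_apply, sq_abs] at habs
  rw [variance_of_integral_eq_zero hZ.aemeasurable h0]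
  linarith

lemma norm_integral_exp_sub_one_sub_variance_le {Z : Ω → ℝ} (hZm : Measurable Z)
    (hZ : MemLp Z 3 P) (h0 : ∫ ω, Z ω ∂P = 0) :
    ‖∫ ω, Complex.exp ((Z ω : ℂ) * Complex.I) ∂P - (1 - (Var[Z; P] : ℂ) / 2)‖ ≤
      4 * ∫ ω, |Z ω| ^ 3 ∂P := by
  have hlin : Integrable (fun ω => 1 + (Z ω : ℂ) * Complex.I) P :=
    (integrable_const _).add ((hZ.integrable (by norm_num)).ofReal.mul_const _)
  have hsq : Integrable (fun ω => (Z ω : ℂ) ^ 2 / 2) P := by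
    simpa using ((hZ.mono_exponent (p := 2) (by norm_num)).integrable_sq.ofReal
      (𝕜 := ℂ)).div_const 2
  have hpoly : ∫ ω, (1 + (Z ω : ℂ) * Complex.I - (Z ω : ℂ) ^ 2 / 2) ∂P =
      1 - (Var[Z; P] : ℂ) / 2 := by
    rw [integral_sub hlin hsq, integral_add (integrable_const _)
      ((hZ.integrable (by norm_num)).ofReal.mul_const _), integral_mul_const,
      integral_complex_ofReal, h0, integral_div,
      variance_of_integral_eq_zero hZm.aemeasurable h0, ← integral_complex_ofReal]
    simp
  rw [← hpoly, ← integral_sub (integrable_exp_mul_I hZm) (hlin.sub' hsq), ← integral_const_mul]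
  exact norm_integral_le_of_norm_le ((hZ.integrable_norm_pow (by norm_num)).const_mul 4)
    (ae_of_all _ fun ω => norm_exp_mul_I_sub_le (Z ω))

lemma norm_integral_exp_sub_integral_exp_le {U V : Ω → ℝ} (hU : Measurable U) (hV : Measurable V)
    (hUV : MemLp (fun ω => U ω - V ω) 2 P) (h0 : ∫ ω, U ω - V ω ∂P = 0) :
    ‖∫ ω, Complex.exp ((U ω : ℂ) * Complex.I) ∂P - ∫ ω, Complex.exp ((V ω : ℂ) * Complex.I) ∂P‖ ≤
      √Var[fun ω => U ω - V ω; P] := by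
  rw [← integral_sub (integrable_exp_mul_I hU) (integrable_exp_mul_I hV)]
  exact (norm_integral_le_of_norm_le (hUV.integrable one_le_two).abs
    (ae_of_all _ fun ω => norm_exp_mul_I_sub_exp_mul_I_le _ _)).trans
    (integral_abs_le_sqrt_variance hUV h0)

end CharacteristicFunctions

section BlockPartition

lemma injOn_block_index {l m k : ℕ} (hlm : l ≤ m) :
    Set.InjOn (fun p : ℕ × ℕ => p.1 * m + 1 + p.2)
      (Finset.range k ×ˢ Finset.range l : Finset (ℕ × ℕ)) := by
  have hdiv : ∀ j i : ℕ, i < l → (j * m + i) / m = j := fun j i hi => by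
    rw [Nat.mul_comm, Nat.mul_add_div (by omega), Nat.div_eq_of_lt (by omega), add_zero]
  rintro ⟨j, i⟩ hi ⟨j', i'⟩ hi' heq
  simp only [Finset.coe_product, Finset.coe_range, Set.mem_prod, Set.mem_Iio] at hi hi'
  have hsum : j * m + i = j' * m + i' := by simp only at heq; omega
  have hj : j = j' := by rw [← hdiv j i hi.2, hsum, hdiv j' i' hi'.2]
  subst hj
  rw [Prod.mk.injEq]
  omega

lemma exists_block_partition {l m : ℕ} (n : ℕ) (hlm : l ≤ m) :
    ∃ A : Finset ℕ, A ⊆ Finset.Icc 1 n ∧ A.card + (n / m) * l = n ∧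
      ∀ f : ℕ → ℝ, ∑ t ∈ Finset.Icc 1 n, f t =
        ∑ j ∈ Finset.range (n / m), ∑ i ∈ Finset.range l, f (j * m + 1 + i) + ∑ t ∈ A, f t := by
  have hinj := injOn_block_index (k := n / m) hlm
  set B := (Finset.range (n / m) ×ˢ Finset.range l).image fun p => p.1 * m + 1 + p.2
  have hBsub : B ⊆ Finset.Icc 1 n := by
    intro t ht
    obtain ⟨⟨j, i⟩, hp, rfl⟩ := Finset.mem_image.1 ht
    simp only [Finset.mem_product, Finset.mem_range] at hp
    have hj : (j + 1) * m ≤ n := (Nat.mul_le_mul_right m hp.1).trans (Nat.div_mul_le_self n m)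
    rw [Nat.add_mul, one_mul] at hj
    simp only [Finset.mem_Icc]
    omega
  have hBcard : B.card = (n / m) * l := by
    rw [Finset.card_image_of_injOn hinj, Finset.card_product, Finset.card_range, Finset.card_range]
  refine ⟨Finset.Icc 1 n \ B, Finset.sdiff_subset, ?_, fun f => ?_⟩
  · rw [← hBcard, Finset.card_sdiff_add_card_eq_card hBsub, Nat.card_Icc, Nat.add_sub_cancel]
  · rw [← Finset.sum_sdiff hBsub, add_comm, Finset.sum_image hinj, Finset.sum_product]

lemma card_div_le_of_card_add_eq {l m r n A : ℕ} (hm : 0 < m) (hn : 0 < n) (hlr : l + r = m)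
    (hA : A + (n / m) * l = n) : (A : ℝ) / n ≤ (m : ℝ) / n + (r : ℝ) / m := by
  have hcard : A ≤ m + n / m * r := by
    have hblocks : n / m * l + n / m * r = n / m * m := by rw [← Nat.mul_add, hlr]
    have hdiv := Nat.div_add_mod' n m
    have hmod := Nat.mod_lt n hm
    omega
  have : (0 : ℝ) < n := Nat.cast_pos.2 hn
  have : (0 : ℝ) < m := Nat.cast_pos.2 hm
  calc (A : ℝ) / n ≤ (m + ((n / m : ℕ) : ℝ) * r) / n := by gcongr; exact_mod_cast hcard
    _ ≤ (m + (n : ℝ) / m * r) / n := by gcongr; exact Nat.cast_div_le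
    _ = (m : ℝ) / n + (r : ℝ) / m := by field_simp

end BlockPartition

section GrowthRates

variable {Ω : Type*} [mΩ : MeasurableSpace Ω] {d : ℕ} {P : Measure Ω}
  {X : ℤ → Ω → EuclideanSpace ℝ (Fin d)} {a : ℕ → ℝ} {m r : ℕ → ℕ}

lemma tendsto_zero_of_sq_le {f g : ℕ → ℝ} (hfg : ∀ᶠ n in atTop, f n ^ 2 ≤ g n)
    (hg : Tendsto g atTop (𝓝 0)) : Tendsto f atTop (𝓝 0) := by
  have hsqrt := (Real.continuous_sqrt.tendsto 0).comp hg
  rw [Real.sqrt_zero] at hsqrt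
  exact squeeze_zero_norm' (hfg.mono fun n hn => Real.abs_le_sqrt hn) hsqrt

lemma MixingCondition.tendsto_sqrt (hM : MixingCondition P X a m r) :
    Tendsto (fun n : ℕ => √((m n : ℝ) / n)) atTop (𝓝 0) :=
  tendsto_zero_of_sq_le (Eventually.of_forall fun n => (Real.sq_sqrt (by positivity)).le) hM.m_div_n

lemma tendsto_sqrt_mul_of_isLittleO
    (hm : (fun n : ℕ => (m n : ℝ)) =o[atTop] fun n : ℕ => (n : ℝ) ^ (1 / 3 : ℝ)) :
    Tendsto (fun n : ℕ => √((m n : ℝ) / n) * m n) atTop (𝓝 0) := by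
  have hcube := hm.tendsto_div_nhds_zero.pow 3
  rw [zero_pow three_ne_zero] at hcube
  refine tendsto_zero_of_sq_le (Eventually.of_forall fun n => le_of_eq ?_) hcube
  have hroot : ((n : ℝ) ^ (1 / 3 : ℝ)) ^ 3 = n := by
    rw [← Real.rpow_natCast, ← Real.rpow_mul (Nat.cast_nonneg n)]
    norm_num
  rw [mul_pow, Real.sq_sqrt (by positivity), div_pow, hroot]
  ring

lemma tendsto_sqrt_mul_of_mul_pow_three
    (hr : Tendsto (fun n : ℕ => (m n : ℝ) * (r n : ℝ) ^ 3 / n) atTop (𝓝 0)) :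
    Tendsto (fun n : ℕ => √((m n : ℝ) / n) * r n) atTop (𝓝 0) := by
  refine tendsto_zero_of_sq_le (Eventually.of_forall fun n => ?_) hr
  have hpow : (r n : ℝ) ^ 2 ≤ (r n : ℝ) ^ 3 := by
    rcases (r n).eq_zero_or_pos with h0 | hpos
    · simp [h0]
    · exact pow_le_pow_right₀ (Nat.one_le_cast.2 hpos) (by norm_num)
  calc (√((m n : ℝ) / n) * r n) ^ 2 = (m n : ℝ) * (r n : ℝ) ^ 2 / n := by
        rw [mul_pow, Real.sq_sqrt (by positivity)]; ring
    _ ≤ (m n : ℝ) * (r n : ℝ) ^ 3 / n := by gcongr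

lemma MixingCondition.tendsto_sqrt_mul_sum_alpha (hM : MixingCondition P X a m r)
    (hα : Tendsto (fun n : ℕ => (m n : ℝ) ^ 4 / n *
      ∑ j ∈ Finset.Icc (r n) (m n), alphaMixingCoeff P X j) atTop (𝓝 0)) :
    Tendsto (fun n : ℕ => √((m n : ℝ) / n) * ((m n : ℝ) ^ 2 *
      ∑ j ∈ Finset.Icc (r n) (m n), alphaMixingCoeff P X j)) atTop (𝓝 0) := by
  refine tendsto_zero_of_sq_le ?_ hα
  filter_upwards [hM.sum_alpha_le one_pos] with n hn
  set S := ∑ j ∈ Finset.Icc (r n) (m n), alphaMixingCoeff P X j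
  have hS0 : 0 ≤ S := Finset.sum_nonneg fun g _ => alphaMixingCoeff_nonneg g
  have hmS : (m n : ℝ) * S ≤ 1 := hn (m n + 1)
  calc (√((m n : ℝ) / n) * ((m n : ℝ) ^ 2 * S)) ^ 2
      = ((m n : ℝ) ^ 4 / n * S) * (m n * S) := by
        rw [mul_pow, Real.sq_sqrt (by positivity)]; ring
    _ ≤ (m n : ℝ) ^ 4 / n * S := mul_le_of_le_one_right (by positivity) hmS

lemma MixingCondition.tendsto_numBlocks_mul (hM : MixingCondition P X a m r) :
    Tendsto (fun n : ℕ => ((n / m n : ℕ) : ℝ) * ((m n : ℝ) / n)) atTop (𝓝 1) := by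
  have hlower : Tendsto (fun n : ℕ => 1 - (m n : ℝ) / n) atTop (𝓝 1) := by
    simpa using hM.m_div_n.const_sub 1
  refine tendsto_of_tendsto_of_tendsto_of_le_of_le' hlower tendsto_const_nhds ?_ ?_ <;>
    filter_upwards [hM.eventually_pos] with n hn
  · have hn0 : (0 : ℝ) < n := Nat.cast_pos.2 hn.2.2.1
    have hdiv : (n : ℝ) ≤ (n / m n : ℕ) * m n + m n := by
      have := Nat.div_add_mod' n (m n)
      have := Nat.mod_lt n hn.1
      exact_mod_cast (by omega : n ≤ n / m n * m n + m n)
    rw [← mul_div_assoc, one_sub_div hn0.ne']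
    gcongr
    linarith
  · rw [← mul_div_assoc, div_le_one (Nat.cast_pos.2 hn.2.2.1)]
    exact_mod_cast Nat.div_mul_le_self n (m n)

lemma MixingCondition.tendsto_numBlocks (hM : MixingCondition P X a m r) :
    Tendsto (fun n : ℕ => n / m n) atTop atTop := by
  have hpos : ∀ᶠ n : ℕ in atTop, (0 : ℝ) < (m n : ℝ) / n := hM.eventually_pos.mono fun n hn =>
    div_pos (Nat.cast_pos.2 hn.1) (Nat.cast_pos.2 hn.2.2.1)
  have hinv : Tendsto (fun n : ℕ => ((m n : ℝ) / n)⁻¹) atTop atTop :=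
    Tendsto.inv_tendsto_nhdsGT_zero (tendsto_nhdsWithin_iff.2 ⟨hM.m_div_n, hpos⟩)
  rw [← tendsto_natCast_atTop_iff (R := ℝ)]
  exact (hM.tendsto_numBlocks_mul.pos_mul_atTop one_pos hinv).congr'
    (hpos.mono fun n hn => mul_inv_cancel_right₀ hn.ne' _)

lemma MixingCondition.tendsto_bigBlock_div (hM : MixingCondition P X a m r) :
    Tendsto (fun n => ((m n - r n : ℕ) : ℝ) / m n) atTop (𝓝 1) := by
  have hsub := hM.r_div_m.const_sub 1
  rw [sub_zero] at hsub
  refine hsub.congr' (hM.eventually_pos.mono fun n hn => ?_)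
  have hm0 : (m n : ℝ) ≠ 0 := Nat.cast_ne_zero.2 hn.1.ne'
  simp only [Nat.cast_sub hn.2.2.2.1, sub_div, div_self hm0]

end GrowthRates

section ThirdMoments

variable {Ω : Type*} [mΩ : MeasurableSpace Ω] {d : ℕ} {P : Measure Ω} [IsProbabilityMeasure P]
  {X : ℤ → Ω → EuclideanSpace ℝ (Fin d)} {a : ℕ → ℝ} {m r : ℕ → ℕ}
  {ψ : ℕ → EuclideanSpace ℝ (Fin d) → ℝ}

namespace RareEventArray

variable (hψ : RareEventArray P X m r ψ) (hX : ∀ t, Measurable (X t))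
  (hstat : IsStrictlyStationary P X) (hM : MixingCondition P X a m r)
  {l : ℕ → ℕ} (hl : ∀ n, l n ≤ m n)

include hψ

omit [IsProbabilityMeasure P] in
lemma integral_blockSum_pow_three_nonneg (n s l : ℕ) :
    0 ≤ ∫ ω, blockSum X (ψ n) s l ω ^ 3 ∂P :=
  integral_nonneg fun _ => pow_nonneg (Finset.sum_nonneg fun _ _ => (hψ.mem_Icc n _).1) 3

include hX hstat hM hl

lemma exists_mul_sum_lagProd_le :
    ∃ Q, ∀ᶠ n in atTop, (l n : ℝ) * ∑ g ∈ Finset.range (l n), lagProd P X (ψ n) g ≤ Q := by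
  obtain ⟨Q, hQ⟩ := hψ.exists_sum_lagProd_le hX hstat hM
  have hnn : ∀ n g, 0 ≤ lagProd P X (ψ n) g := fun n => lagProd_nonneg fun x => (hψ.mem_Icc n x).1
  refine ⟨Q, hQ.mono fun n hn => le_trans ?_ hn⟩
  exact mul_le_mul (Nat.cast_le.2 (hl n)) (Finset.sum_le_sum_of_subset_of_nonneg
    (Finset.range_mono (hl n)) fun g _ _ => hnn n g) (Finset.sum_nonneg fun g _ => hnn n g)
    (Nat.cast_nonneg _)

lemma tendsto_third_moment_of_sqrt_mul
    (hm : Tendsto (fun n : ℕ => √((m n : ℝ) / n) * m n) atTop (𝓝 0)) :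
    Tendsto (fun n => √((m n : ℝ) / n) * ∫ ω, blockSum X (ψ n) 0 (l n) ω ^ 3 ∂P) atTop
      (𝓝 0) := by
  obtain ⟨Q, hQ⟩ := hψ.exists_mul_sum_lagProd_le hX hstat hM hl
  have hbound := hm.mul_const (6 * Q)
  rw [zero_mul] at hbound
  refine squeeze_zero' (Eventually.of_forall fun n => mul_nonneg (Real.sqrt_nonneg _)
    (hψ.integral_blockSum_pow_three_nonneg n 0 (l n))) (hQ.mono fun n hn => ?_) hbound
  have hlagProd : 0 ≤ ∑ g ∈ Finset.range (l n), lagProd P X (ψ n) g :=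
    Finset.sum_nonneg fun g _ => lagProd_nonneg (fun x => (hψ.mem_Icc n x).1) g
  calc √((m n : ℝ) / n) * ∫ ω, blockSum X (ψ n) 0 (l n) ω ^ 3 ∂P
      ≤ √((m n : ℝ) / n) *
          (6 * (l n * (l n * ∑ g ∈ Finset.range (l n), lagProd P X (ψ n) g))) :=
        mul_le_mul_of_nonneg_left
          (integral_blockSum_pow_three_le hX hstat (hψ.measurable n) (hψ.mem_Icc n) (l n))
          (Real.sqrt_nonneg _)
    _ ≤ √((m n : ℝ) / n) * (6 * (m n * Q)) := by
        have := Nat.cast_le (α := ℝ).2 (hl n)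
        gcongr
    _ = √((m n : ℝ) / n) * m n * (6 * Q) := by ring

lemma tendsto_third_moment_of_alpha
    (hr : Tendsto (fun n : ℕ => √((m n : ℝ) / n) * r n) atTop (𝓝 0))
    (hα : Tendsto (fun n : ℕ => √((m n : ℝ) / n) * ((m n : ℝ) ^ 2 *
      ∑ j ∈ Finset.Icc (r n) (m n), alphaMixingCoeff P X j)) atTop (𝓝 0)) :
    Tendsto (fun n => √((m n : ℝ) / n) * ∫ ω, blockSum X (ψ n) 0 (l n) ω ^ 3 ∂P) atTop
      (𝓝 0) := by
  obtain ⟨Q, hQ⟩ := hψ.exists_mul_sum_lagProd_le hX hstat hM hl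
  obtain ⟨C, hC⟩ := hψ.mean
  have hbound := (((hr.mul_const Q).add (hM.tendsto_sqrt.mul_const (Q * C))).add hα).const_mul 6
  simp only [zero_mul, add_zero, mul_zero] at hbound
  refine squeeze_zero' (Eventually.of_forall fun n => mul_nonneg (Real.sqrt_nonneg _)
    (hψ.integral_blockSum_pow_three_nonneg n 0 (l n))) ?_ hbound
  filter_upwards [hQ, hC] with n hn hCn
  have hmoment := integral_blockSum_pow_three_le_add_alpha hX hstat (hψ.measurable n)
    (hψ.mem_Icc n) (l n) (r n)
  set q := ∑ g ∈ Finset.range (l n), lagProd P X (ψ n) g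
  set p := ∫ ω, ψ n (X 0 ω) ∂P
  set S := ∑ j ∈ Finset.Icc (r n) (m n), alphaMixingCoeff P X j
  set T := ∑ g ∈ Finset.Ico (r n) (l n), alphaMixingCoeff P X g
  have hp : 0 ≤ p := hψ.mean_nonneg n
  have hq : 0 ≤ q := Finset.sum_nonneg fun g _ => lagProd_nonneg (fun x => (hψ.mem_Icc n x).1) g
  have hlm : (l n : ℝ) ≤ m n := Nat.cast_le.2 (hl n)
  have hlp : (l n : ℝ) * p ≤ C := (mul_le_mul_of_nonneg_right hlm hp).trans hCn
  have hT : 0 ≤ T := Finset.sum_nonneg fun g _ => alphaMixingCoeff_nonneg g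
  have hTS : T ≤ S := Finset.sum_le_sum_of_subset_of_nonneg
    (Finset.Ico_subset_Icc_self.trans (Finset.Icc_subset_Icc_right (hl n)))
    fun g _ _ => alphaMixingCoeff_nonneg g
  calc √((m n : ℝ) / n) * ∫ ω, blockSum X (ψ n) 0 (l n) ω ^ 3 ∂P
      ≤ √((m n : ℝ) / n) * (6 * (l n * (r n * q + l n * (q * p) + l n * T))) :=
        mul_le_mul_of_nonneg_left hmoment (Real.sqrt_nonneg _)
    _ = √((m n : ℝ) / n) * (6 * (r n * (l n * q) + l n * q * (l n * p) + l n ^ 2 * T)) := by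
        ring
    _ ≤ √((m n : ℝ) / n) * (6 * (r n * Q + Q * C + (m n : ℝ) ^ 2 * S)) := by
        have := mul_nonneg (Nat.cast_nonneg (α := ℝ) (l n)) hq
        have := mul_nonneg (Nat.cast_nonneg (α := ℝ) (l n)) hp
        gcongr
        linarith
    _ = _ := by ring

lemma tendsto_third_moment (hg : GrowthCondition P X m r) :
    Tendsto (fun n => √((m n : ℝ) / n) * ∫ ω, blockSum X (ψ n) 0 (l n) ω ^ 3 ∂P) atTop
      (𝓝 0) := by
  rcases hg.2 with hm | ⟨hα, hr⟩
  · exact hψ.tendsto_third_moment_of_sqrt_mul hX hstat hM hl (tendsto_sqrt_mul_of_isLittleO hm)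
  · exact hψ.tendsto_third_moment_of_alpha hX hstat hM hl (tendsto_sqrt_mul_of_mul_pow_three hr)
      (hM.tendsto_sqrt_mul_sum_alpha hα)

end RareEventArray

end ThirdMoments

section CentralLimitTheorem

variable {Ω : Type*} [mΩ : MeasurableSpace Ω] {d : ℕ} {P : Measure Ω}
  {X : ℤ → Ω → EuclideanSpace ℝ (Fin d)} {a : ℕ → ℝ} {m r : ℕ → ℕ}
  {φ ψ : ℕ → EuclideanSpace ℝ (Fin d) → ℝ} {c : ℝ} {G : ℕ → ℝ}

/-- The functional `φ n`, centred and scaled so that its sum over `1 ≤ t ≤ n` has a variance of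
order one. -/
noncomputable def standardized (P : Measure Ω) (X : ℤ → Ω → EuclideanSpace ℝ (Fin d)) (m : ℕ → ℕ)
    (φ : ℕ → EuclideanSpace ℝ (Fin d) → ℝ) (n : ℕ) (x : EuclideanSpace ℝ (Fin d)) : ℝ :=
  √((m n : ℝ) / n) * (φ n x - ∫ ω, φ n (X 0 ω) ∂P)

/-- The partial sum whose asymptotic normality is the central limit theorem for `φ`. -/
noncomputable def normalizedSum (P : Measure Ω) (X : ℤ → Ω → EuclideanSpace ℝ (Fin d)) (m : ℕ → ℕ)
    (φ : ℕ → EuclideanSpace ℝ (Fin d) → ℝ) (n : ℕ) (ω : Ω) : ℝ :=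
  ∑ t ∈ Finset.Icc 1 n, standardized P X m φ n (X (t : ℕ) ω)

lemma measurable_standardized {n : ℕ} (hφ : Measurable (φ n)) :
    Measurable (standardized P X m φ n) :=
  (hφ.sub_const _).const_mul _

lemma measurable_normalizedSum (hX : ∀ t, Measurable (X t)) {n : ℕ} (hφ : Measurable (φ n)) :
    Measurable (normalizedSum P X m φ n) :=
  Finset.measurable_fun_sum _ fun _ _ => (measurable_standardized hφ).comp (hX _)

variable [IsProbabilityMeasure P]

namespace TailArray

section FixedIndex

variable (hA : TailArray P X m r φ ψ c) (hX : ∀ t, Measurable (X t))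

include hA hX

lemma memLp_sum_standardized (n : ℕ) (A : Finset ℕ) (e : ℕ → ℤ) (p : ℝ≥0∞) :
    MemLp (fun ω => ∑ t ∈ A, standardized P X m φ n (X (e t) ω)) p P :=
  memLp_finsetSum A fun t _ => ((hA.memLp hX n (e t) p).sub (memLp_const _)).const_mul _

lemma variance_sum_standardized (n : ℕ) (A : Finset ℕ) (e : ℕ → ℤ) :
    Var[fun ω => ∑ t ∈ A, standardized P X m φ n (X (e t) ω); P] =
      (m n : ℝ) / n * Var[fun ω => ∑ t ∈ A, φ n (X (e t) ω); P] := by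
  have hmeas : Measurable fun ω => ∑ t ∈ A, φ n (X (e t) ω) :=
    Finset.measurable_fun_sum _ fun _ _ => (hA.measurable n).comp (hX _)
  simp only [standardized, ← Finset.mul_sum, Finset.sum_sub_distrib]
  rw [variance_const_mul, variance_sub_const hmeas.aestronglyMeasurable,
    Real.sq_sqrt (by positivity)]

lemma integral_sum_standardized (hstat : IsStrictlyStationary P X) (n : ℕ) (A : Finset ℕ)
    (e : ℕ → ℤ) : ∫ ω, ∑ t ∈ A, standardized P X m φ n (X (e t) ω) ∂P = 0 := by
  have hint : ∀ t, Integrable (fun ω => φ n (X t ω)) P := fun t =>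
    (hA.memLp hX n t 1).integrable le_rfl
  have hint_standardized : ∀ t, Integrable (fun ω => standardized P X m φ n (X t ω)) P := fun t =>
    ((hint t).sub (integrable_const _)).const_mul _
  have hcentred : ∀ t, ∫ ω, standardized P X m φ n (X t ω) ∂P = 0 := fun t => by
    simp only [standardized]
    rw [integral_const_mul, integral_sub (hint t) (integrable_const _),
      integral_comp_eq hstat (hA.measurable n), integral_const, probReal_univ, one_smul, sub_self,
      mul_zero]
  rw [integral_finsetSum _ fun t _ => hint_standardized (e t)]
  exact Finset.sum_eq_zero fun t _ => hcentred _

lemma abs_blockSum_standardized_le (n l : ℕ) (ω : Ω) :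
    |blockSum X (standardized P X m φ n) 0 l ω| ≤
      √((m n : ℝ) / n) * (c * (blockSum X (ψ n) 0 l ω + l * ∫ ω, ψ n (X 0 ω) ∂P)) := by
  have hterm : ∀ t, |φ n (X t ω) - ∫ ω, φ n (X 0 ω) ∂P| ≤
      c * ψ n (X t ω) + c * ∫ ω, ψ n (X 0 ω) ∂P := fun t =>
    (abs_sub _ _).trans (add_le_add (hA.dominated n _) (hA.abs_mean_le hX n))
  simp only [blockSum, standardized, ← Finset.mul_sum, abs_mul, abs_of_nonneg (Real.sqrt_nonneg _)]
  refine mul_le_mul_of_nonneg_left ((Finset.abs_sum_le_sum_abs _ _).trans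
    ((Finset.sum_le_sum fun t _ => hterm _).trans_eq ?_)) (Real.sqrt_nonneg _)
  rw [Finset.sum_add_distrib, ← Finset.mul_sum, Finset.sum_const, Finset.card_range, nsmul_eq_mul]
  ring

lemma integral_abs_blockSum_standardized_pow_three_le (n l : ℕ) :
    ∫ ω, |blockSum X (standardized P X m φ n) 0 l ω| ^ 3 ∂P ≤
      4 * c ^ 3 * ((m n : ℝ) / n * (√((m n : ℝ) / n) *
        (∫ ω, blockSum X (ψ n) 0 l ω ^ 3 ∂P + (l * ∫ ω, ψ n (X 0 ω) ∂P) ^ 3))) := by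
  set s := √((m n : ℝ) / n)
  set q := l * ∫ ω, ψ n (X 0 ω) ∂P
  have hq : 0 ≤ q := mul_nonneg (Nat.cast_nonneg _) (hA.rare.mean_nonneg n)
  have hc := hA.pos
  have hT0 : ∀ ω, 0 ≤ blockSum X (ψ n) 0 l ω := fun ω =>
    Finset.sum_nonneg fun _ _ => (hA.rare.mem_Icc n _).1
  have hT : Integrable (fun ω => blockSum X (ψ n) 0 l ω ^ 3) P := by
    have hLp : MemLp (blockSum X (ψ n) 0 l) 3 P :=
      memLp_finsetSum _ fun t _ => hA.rare.tailArray.memLp hX n _ 3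
    simpa only [Real.norm_eq_abs, abs_of_nonneg (hT0 _)] using hLp.integrable_norm_pow (by norm_num)
  have hpointwise : ∀ ω, |blockSum X (standardized P X m φ n) 0 l ω| ^ 3 ≤
      4 * c ^ 3 * s ^ 3 * (blockSum X (ψ n) 0 l ω ^ 3 + q ^ 3) := fun ω =>
    calc |blockSum X (standardized P X m φ n) 0 l ω| ^ 3
        ≤ (s * (c * (blockSum X (ψ n) 0 l ω + q))) ^ 3 :=
          pow_le_pow_left₀ (abs_nonneg _) (hA.abs_blockSum_standardized_le hX n l ω) 3
      _ = c ^ 3 * s ^ 3 * (blockSum X (ψ n) 0 l ω + q) ^ 3 := by ring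
      _ ≤ c ^ 3 * s ^ 3 * (2 ^ (3 - 1) * (blockSum X (ψ n) 0 l ω ^ 3 + q ^ 3)) :=
          mul_le_mul_of_nonneg_left (add_pow_le (hT0 ω) hq 3) (by positivity)
      _ = 4 * c ^ 3 * s ^ 3 * (blockSum X (ψ n) 0 l ω ^ 3 + q ^ 3) := by ring
  calc ∫ ω, |blockSum X (standardized P X m φ n) 0 l ω| ^ 3 ∂P
      ≤ ∫ ω, 4 * c ^ 3 * s ^ 3 * (blockSum X (ψ n) 0 l ω ^ 3 + q ^ 3) ∂P :=
        integral_mono_of_nonneg (ae_of_all _ fun ω => by positivity)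
          ((hT.add (integrable_const _)).const_mul _) (ae_of_all _ hpointwise)
    _ = 4 * c ^ 3 * s ^ 3 * (∫ ω, blockSum X (ψ n) 0 l ω ^ 3 ∂P + q ^ 3) := by
        rw [integral_const_mul, integral_add hT (integrable_const _), integral_const,
          probReal_univ, one_smul]
    _ = _ := by
        rw [← Real.sq_sqrt (show 0 ≤ (m n : ℝ) / n by positivity)]
        ring

end FixedIndex

variable (hA : TailArray P X m r φ ψ c) (hX : ∀ t, Measurable (X t))
  (hstat : IsStrictlyStationary P X) (hM : MixingCondition P X a m r)

include hA hX hstat hM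

lemma exists_variance_sum_standardized_le :
    ∃ C, ∀ᶠ n : ℕ in atTop, ∀ A ⊆ Finset.Icc 1 n,
      Var[fun ω => ∑ t ∈ A, standardized P X m φ n (X t ω); P] ≤ 2 * (A.card / n) * C := by
  obtain ⟨C, hC⟩ := hA.exists_sum_abs_lagCov_le hX hstat hM
  refine ⟨C, hC.mono fun n hn A hAn => ?_⟩
  have hvar := variance_sum_comp_le (P := P) hX hstat (hA.measurable n) (hA.abs_le n) (A := A)
    (N := n + 1) fun t ht => Nat.lt_succ_of_le (Finset.mem_Icc.1 (hAn ht)).2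
  rw [hA.variance_sum_standardized hX n A fun t => t]
  calc (m n : ℝ) / n * Var[fun ω => ∑ t ∈ A, φ n (X t ω); P]
      ≤ (m n : ℝ) / n * (2 * A.card * ∑ g ∈ Finset.range (n + 1), |lagCov P X (φ n) g|) := by
        gcongr
    _ = 2 * (A.card / n) * (m n * ∑ g ∈ Finset.range (n + 1), |lagCov P X (φ n) g|) := by ring
    _ ≤ 2 * (A.card / n) * C := by gcongr; exact hn (n + 1)

lemma tendsto_integral_exp_normalizedSum_sub :
    Tendsto (fun n => ∫ ω, Complex.exp ((normalizedSum P X m φ n ω : ℂ) * Complex.I) ∂P -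
      ∫ ω, Complex.exp (((∑ j ∈ Finset.range (n / m n),
        blockSum X (standardized P X m φ n) (j * m n + 1) (m n - r n) ω : ℝ) : ℂ) * Complex.I) ∂P)
      atTop (𝓝 0) := by
  obtain ⟨C, hC⟩ := hA.exists_variance_sum_standardized_le hX hstat hM
  have hbound : Tendsto (fun n : ℕ => √(2 * ((m n : ℝ) / n + (r n : ℝ) / m n) * |C|)) atTop
      (𝓝 0) := by
    have hlim := ((hM.m_div_n.add hM.r_div_m).const_mul 2).mul_const |C|
    rw [add_zero, mul_zero, zero_mul] at hlim
    simpa only [Real.sqrt_zero] using hlim.sqrt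
  refine squeeze_zero_norm' ?_ hbound
  filter_upwards [hC, hM.eventually_pos] with n hn ⟨hm, _, hn0, hrm, _⟩
  obtain ⟨A, hAn, hAcard, hsplit⟩ := exists_block_partition n (Nat.sub_le (m n) (r n))
  set W : Ω → ℝ := fun ω => ∑ j ∈ Finset.range (n / m n),
    blockSum X (standardized P X m φ n) (j * m n + 1) (m n - r n) ω
  have hremainder : (fun ω => normalizedSum P X m φ n ω - W ω) =
      fun ω => ∑ t ∈ A, standardized P X m φ n (X (t : ℕ) ω) := by
    ext ω
    rw [normalizedSum, hsplit fun t => standardized P X m φ n (X (t : ℕ) ω), add_comm]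
    exact add_sub_cancel_right _ _
  have hW : Measurable W := Finset.measurable_fun_sum _ fun _ _ =>
    measurable_blockSum hX (measurable_standardized (hA.measurable n)) _ _
  refine (norm_integral_exp_sub_integral_exp_le
    (measurable_normalizedSum hX (hA.measurable n)) hW ?_ ?_).trans (Real.sqrt_le_sqrt ?_)
  · exact hremainder ▸ hA.memLp_sum_standardized hX n A (fun t => t) 2
  · exact hremainder ▸ hA.integral_sum_standardized hX hstat n A fun t => t
  · rw [hremainder]
    calc _ ≤ 2 * ((A.card : ℝ) / n) * C := hn A hAn
      _ ≤ 2 * ((A.card : ℝ) / n) * |C| := by gcongr; exact le_abs_self C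
      _ ≤ 2 * ((m n : ℝ) / n + (r n : ℝ) / m n) * |C| := by
        gcongr
        exact card_div_le_of_card_add_eq hm hn0 (Nat.sub_add_cancel hrm) hAcard

section Blocks

variable {l : ℕ → ℕ}

lemma tendsto_numBlocks_mul_variance
    (hG : ∀ g, Tendsto (fun n => (m n : ℝ) * lagProd P X (φ n) g) atTop (𝓝 (G g)))
    (hl : Tendsto (fun n => (l n : ℝ) / m n) atTop (𝓝 1)) :
    Tendsto (fun n => ((n / m n : ℕ) : ℝ) *
      Var[blockSum X (standardized P X m φ n) 0 (l n); P]) atTop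
      (𝓝 (G 0 + 2 * ∑' g, G (g + 1))) := by
  have hlim := hM.tendsto_numBlocks_mul.mul (hA.tendsto_variance_blockSum hX hstat hM hG hl)
  rw [one_mul] at hlim
  refine hlim.congr fun n => ?_
  rw [mul_assoc]
  exact congrArg _ (hA.variance_sum_standardized hX n _ fun i => ((0 + i : ℕ) : ℤ)).symm

variable (hg : GrowthCondition P X m r)

include hg

lemma tendsto_numBlocks_mul_third_moment (hlm : ∀ n, l n ≤ m n) :
    Tendsto (fun n => ((n / m n : ℕ) : ℝ) *
      ∫ ω, |blockSum X (standardized P X m φ n) 0 (l n) ω| ^ 3 ∂P) atTop (𝓝 0) := by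
  obtain ⟨C, hC⟩ := hA.rare.mean
  have hrare := hA.rare.tendsto_third_moment hX hstat hM hlm hg
  have hbound := (hM.tendsto_numBlocks_mul.mul (hrare.add (hM.tendsto_sqrt.mul_const (C ^ 3)))
    ).const_mul (4 * c ^ 3)
  rw [zero_mul, add_zero, mul_zero, mul_zero] at hbound
  have hc := hA.pos
  refine squeeze_zero' (Eventually.of_forall fun n => by positivity) ?_ hbound
  filter_upwards [hC] with n hn
  have hp := hA.rare.mean_nonneg n
  have hlp : (l n : ℝ) * ∫ ω, ψ n (X 0 ω) ∂P ≤ C :=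
    (mul_le_mul_of_nonneg_right (Nat.cast_le.2 (hlm n)) hp).trans hn
  refine (mul_le_mul_of_nonneg_left
    (hA.integral_abs_blockSum_standardized_pow_three_le hX n (l n)) (Nat.cast_nonneg _)).trans ?_
  calc _ = 4 * c ^ 3 * (((n / m n : ℕ) : ℝ) * ((m n : ℝ) / n) *
        (√((m n : ℝ) / n) * ∫ ω, blockSum X (ψ n) 0 (l n) ω ^ 3 ∂P +
          √((m n : ℝ) / n) * (l n * ∫ ω, ψ n (X 0 ω) ∂P) ^ 3)) := by ring
    _ ≤ _ := by gcongr

lemma tendsto_integral_exp_blockSum_pow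
    (hG : ∀ g, Tendsto (fun n => (m n : ℝ) * lagProd P X (φ n) g) atTop (𝓝 (G g)))
    (hlm : ∀ n, l n ≤ m n) (hl : Tendsto (fun n => (l n : ℝ) / m n) atTop (𝓝 1)) :
    Tendsto (fun n => (∫ ω, Complex.exp ((blockSum X (standardized P X m φ n) 0 (l n) ω : ℂ) *
      Complex.I) ∂P) ^ (n / m n)) atTop
      (𝓝 (Complex.exp (-((G 0 + 2 * ∑' g, G (g + 1) : ℝ) : ℂ) / 2))) := by
  set U : ℕ → Ω → ℝ := fun n => blockSum X (standardized P X m φ n) 0 (l n)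
  set χ : ℕ → ℂ := fun n => ∫ ω, Complex.exp ((U n ω : ℂ) * Complex.I) ∂P
  refine tendsto_pow_exp_of_tendsto_mul_sub_one hM.tendsto_numBlocks ?_
  have hvariance := (Complex.continuous_ofReal.tendsto _).comp
    (hA.tendsto_numBlocks_mul_variance hX hstat hM hG hl)
  have hthird := (hA.tendsto_numBlocks_mul_third_moment hX hstat hM hg hlm).const_mul 4
  rw [mul_zero] at hthird
  have htaylor : Tendsto (fun n => ((n / m n : ℕ) : ℂ) * (χ n - (1 - (Var[U n; P] : ℂ) / 2))) atTop
      (𝓝 0) := by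
    refine squeeze_zero_norm (fun n => ?_) hthird
    rw [norm_mul, Complex.norm_natCast, mul_left_comm]
    exact mul_le_mul_of_nonneg_left (norm_integral_exp_sub_one_sub_variance_le
      (measurable_blockSum hX (measurable_standardized (hA.measurable n)) _ _)
      (hA.memLp_sum_standardized hX n _ (fun i => ((0 + i : ℕ) : ℤ)) 3)
      (hA.integral_sum_standardized hX hstat n _ fun i => ((0 + i : ℕ) : ℤ))) (Nat.cast_nonneg _)
  have hsum := htaylor.add (hvariance.neg.div_const 2)
  rw [zero_add] at hsum
  refine hsum.congr fun n => ?_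
  simp only [Function.comp_apply, Complex.ofReal_mul, Complex.ofReal_natCast]
  ring

end Blocks

variable (hg : GrowthCondition P X m r)

include hg

lemma tendsto_integral_exp_sum_blockSum_sub :
    Tendsto (fun n => ∫ ω, Complex.exp (((∑ j ∈ Finset.range (n / m n),
        blockSum X (standardized P X m φ n) (j * m n + 1) (m n - r n) ω : ℝ) : ℂ) * Complex.I) ∂P -
      (∫ ω, Complex.exp ((blockSum X (standardized P X m φ n) 0 (m n - r n) ω : ℂ) *
        Complex.I) ∂P) ^ (n / m n)) atTop (𝓝 0) := by
  have hbound := hg.1.const_mul 16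
  rw [mul_zero] at hbound
  refine squeeze_zero_norm' (hM.eventually_pos.mono fun n hn => ?_) hbound
  refine (norm_integral_exp_sum_blockSum_sub_le (measurable_standardized (hA.measurable n)) hX hstat
    (Nat.sub_add_cancel hn.2.2.2.1).le (n / m n)).trans ?_
  rw [mul_assoc]
  have := alphaMixingCoeff_nonneg (P := P) (X := X) (r n)
  gcongr
  exact Nat.cast_div_le

theorem tendsto_integral_exp_normalizedSum
    (hG : ∀ g, Tendsto (fun n => (m n : ℝ) * lagProd P X (φ n) g) atTop (𝓝 (G g))) :
    Tendsto (fun n => ∫ ω, Complex.exp ((normalizedSum P X m φ n ω : ℂ) * Complex.I) ∂P) atTop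
      (𝓝 (Complex.exp (-((G 0 + 2 * ∑' g, G (g + 1) : ℝ) : ℂ) / 2))) := by
  have hgaussian := hA.tendsto_integral_exp_blockSum_pow hX hstat hM hg hG
    (fun n => Nat.sub_le (m n) (r n)) hM.tendsto_bigBlock_div
  have hsum := ((hA.tendsto_integral_exp_normalizedSum_sub hX hstat hM).add
    (hA.tendsto_integral_exp_sum_blockSum_sub hX hstat hM hg)).add hgaussian
  rw [add_zero, zero_add] at hsum
  exact hsum.congr fun n => by ring

end TailArray

end CentralLimitTheorem

section Indicators

variable {Ω : Type*} [mΩ : MeasurableSpace Ω] {d : ℕ} {P : Measure Ω}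
  {X : ℤ → Ω → EuclideanSpace ℝ (Fin d)} {a : ℕ → ℝ} {m r : ℕ → ℕ} {α : ℝ}
  {μ : (h : ℕ) → Measure (ExtSpace h d)}

/-- The indicator function of the event `x⁻¹ v ∈ C`. -/
noncomputable def eventInd (x : ℝ) (C : Set (Fin d → EReal)) (v : EuclideanSpace ℝ (Fin d)) : ℝ :=
  (scaled x ⁻¹' C).indicator 1 v

lemma measurable_eventInd (x : ℝ) {C : Set (Fin d → EReal)} (hC : MeasurableSet C) :
    Measurable (eventInd x C) :=
  measurable_one.indicator (measurable_scaled x hC)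

lemma eventInd_mem_Icc (x : ℝ) (C : Set (Fin d → EReal)) (v : EuclideanSpace ℝ (Fin d)) :
    eventInd x C v ∈ Set.Icc 0 1 :=
  ⟨Set.indicator_nonneg (fun _ _ => zero_le_one) v,
    Set.indicator_le_self' (fun _ _ => zero_le_one) v⟩

lemma eventInd_mono (x : ℝ) {C D : Set (Fin d → EReal)} (h : C ⊆ D)
    (v : EuclideanSpace ℝ (Fin d)) : eventInd x C v ≤ eventInd x D v :=
  Set.indicator_le_indicator_of_subset (Set.preimage_mono h) (fun _ => zero_le_one) v

lemma integral_eventInd (hX : ∀ t, Measurable (X t)) (x : ℝ) {C : Set (Fin d → EReal)}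
    (hC : MeasurableSet C) (t : ℤ) :
    ∫ ω, eventInd x C (X t ω) ∂P = P.real {ω | scaled x (X t ω) ∈ C} :=
  integral_indicator_one (hX t (measurable_scaled x hC))

lemma integral_eventInd_mul (hX : ∀ t, Measurable (X t)) (x : ℝ) {C D : Set (Fin d → EReal)}
    (hC : MeasurableSet C) (hD : MeasurableSet D) (s t : ℤ) :
    ∫ ω, eventInd x C (X s ω) * eventInd x D (X t ω) ∂P =
      P.real {ω | scaled x (X s ω) ∈ C ∧ scaled x (X t ω) ∈ D} := by
  have hprod : (fun ω => eventInd x C (X s ω) * eventInd x D (X t ω)) =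
      {ω | scaled x (X s ω) ∈ C ∧ scaled x (X t ω) ∈ D}.indicator 1 :=
    (Set.inter_indicator_one (M₀ := ℝ)).symm
  rw [hprod]
  exact integral_indicator_one
    ((hX s (measurable_scaled x hC)).inter (hX t (measurable_scaled x hD)))

lemma lagProd_sum_mul {ι : Type*} [Fintype ι] {f : ι → EuclideanSpace ℝ (Fin d) → ℝ} (z : ι → ℝ)
    (g : ℕ) (hf : ∀ i j, Integrable (fun ω => f i (X 0 ω) * f j (X g ω)) P) :
    lagProd P X (fun v => ∑ i, z i * f i v) g =
      ∑ i, ∑ j, z i * z j * ∫ ω, f i (X 0 ω) * f j (X g ω) ∂P := by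
  have hzf := fun i j => (hf i j).const_mul (z i * z j)
  simp only [lagProd, Finset.sum_mul_sum, mul_mul_mul_comm (z _) (f _ _)]
  simp only [← integral_const_mul, integral_finsetSum _ fun i _ =>
    integrable_finsetSum _ fun j _ => hzf i j, integral_finsetSum _ fun j _ => hzf _ j]

lemma IsAdmissible.union {ν : Measure (Fin d → EReal)} {A B : Set (Fin d → EReal)}
    (hA : IsAdmissible ν A) (hB : IsAdmissible ν B) : IsAdmissible ν (A ∪ B) := by
  rw [Set.union_eq_iUnion]
  exact .iUnion (Bool.forall_bool.2 ⟨hB, hA⟩)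

lemma exists_sum_lagProd_eventInd_le [IsFiniteMeasure P] (hX : ∀ t, Measurable (X t))
    (ha : Tendsto a atTop atTop) (hM : MixingCondition P X a m r) {B : Set (Fin d → EReal)}
    (hB : MeasurableSet B) (hB0 : 0 ∉ closure B) {ε : ℝ} (hε : 0 < ε) :
    ∃ k : ℕ, ∀ᶠ n in atTop,
      (m n : ℝ) * ∑ g ∈ Finset.Icc k (r n), lagProd P X (eventInd (a (m n)) B) g ≤ ε := by
  obtain ⟨δ, hδ, hBδ⟩ := exists_norm_gt_of_scaled_mem hB0
  obtain ⟨k, hk⟩ := ((hM.anti_clustering δ hδ).eventually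
    (gt_mem_nhds (ENNReal.ofReal_pos.2 hε))).exists
  refine ⟨k, ?_⟩
  filter_upwards [eventually_lt_of_limsup_lt hk,
    (ha.comp hM.tendsto_m).eventually_gt_atTop 0] with n hn han
  rw [← ENNReal.ofReal_le_ofReal_iff hε.le, ENNReal.ofReal_mul (Nat.cast_nonneg _),
    ENNReal.ofReal_natCast, ENNReal.ofReal_sum_of_nonneg
      fun g _ => lagProd_nonneg (fun x => (eventInd_mem_Icc _ _ x).1) g]
  refine le_trans (mul_le_mul_right (Finset.sum_le_sum fun g _ => ?_) _) hn.le
  rw [lagProd, integral_eventInd_mul hX _ hB hB, ofReal_measureReal]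
  exact measure_mono fun ω hω => ⟨hBδ _ _ han hω.2, hBδ _ _ han hω.1⟩

variable [IsProbabilityMeasure P] (hX : ∀ t, Measurable (X t)) (hstat : IsStrictlyStationary P X)
  (hreg : IsRegularlyVarying P X α μ) (ha : Tendsto a atTop atTop)
  (ha_tail : Tendsto (fun n : ℕ => (n : ℝ) * P.real {ω | a n < ‖X 0 ω‖}) atTop (𝓝 1))
  (hM : MixingCondition P X a m r)

include hX hstat hreg ha ha_tail hM

lemma tendsto_mul_tailProb {C : Set (Fin d → EReal)} (hC : IsAdmissible (marginal μ) C) :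
    Tendsto (fun n => (m n : ℝ) * tailProb P X a m C n) atTop (𝓝 ((marginal μ).real C)) := by
  have hlim := (tendsto_nat_mul_joint hstat hreg ha ha_tail hX hC hC 0).comp hM.tendsto_m
  rw [tau_zero hstat hreg ha ha_tail hC.measurableSet hC.measurableSet, Set.inter_self] at hlim
  simpa only [tailProb, Function.comp_def, Nat.cast_zero, and_self] using hlim

lemma rareEventArray_eventInd {B : Set (Fin d → EReal)} (hB : IsAdmissible (marginal μ) B) :
    RareEventArray P X m r (fun n => eventInd (a (m n)) B) where
  measurable n := measurable_eventInd _ hB.measurableSet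
  mem_Icc n := eventInd_mem_Icc _ B
  mean := by
    refine ⟨(marginal μ).real B + 1, ?_⟩
    filter_upwards [(tendsto_mul_tailProb hX hstat hreg ha ha_tail hM hB).eventually
      (gt_mem_nhds (lt_add_one _))] with n hn
    rw [integral_eventInd hX _ hB.measurableSet]
    exact hn.le
  anti_clustering _ := exists_sum_lagProd_eventInd_le hX ha hM hB.measurableSet hB.bounded_away

lemma tendsto_mul_integral_eventInd_mul {A B : Set (Fin d → EReal)}
    (hA : IsAdmissible (marginal μ) A) (hB : IsAdmissible (marginal μ) B) (g : ℕ) :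
    Tendsto (fun n => (m n : ℝ) *
      ∫ ω, eventInd (a (m n)) A (X 0 ω) * eventInd (a (m n)) B (X g ω) ∂P) atTop
      (𝓝 (tau (nu P X a μ) A B g)) := by
  simp only [integral_eventInd_mul hX _ hA.measurableSet hB.measurableSet]
  exact (tendsto_nat_mul_joint hstat hreg ha ha_tail hX hA hB g).comp hM.tendsto_m

theorem summable_tau {A B : Set (Fin d → EReal)} (hA : IsAdmissible (marginal μ) A)
    (hB : IsAdmissible (marginal μ) B) : Summable fun ℓ : ℕ => tau (nu P X a μ) A B ℓ := by
  have hAB := hA.union hB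
  have hsum := (rareEventArray_eventInd hX hstat hreg ha ha_tail hM hAB).tailArray.summable_limit
    hX hstat hM (tendsto_mul_integral_eventInd_mul hX hstat hreg ha ha_tail hM hAB hAB)
  refine Summable.of_nonneg_of_le (fun ℓ => measureReal_nonneg) (fun ℓ => ?_) hsum
  refine le_of_tendsto_of_tendsto' (tendsto_nat_mul_joint hstat hreg ha ha_tail hX hA hB ℓ)
    (tendsto_nat_mul_joint hstat hreg ha ha_tail hX hAB hAB ℓ) fun n => ?_
  exact mul_le_mul_of_nonneg_left (measureReal_mono fun ω hω => ⟨.inl hω.1, .inr hω.2⟩)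
    (Nat.cast_nonneg _)

section LinearCombinations

variable {ι : Type*} [Fintype ι] {D : ι → Set (Fin d → EReal)}
  (hD : ∀ i, IsAdmissible (marginal μ) (D i)) (z : ι → ℝ)

include hD

lemma tailArray_sum_eventInd :
    TailArray P X m r (fun n v => ∑ i, z i * eventInd (a (m n)) (D i) v)
      (fun n => eventInd (a (m n)) (⋃ i, D i)) (∑ i, |z i| + 1) where
  rare := rareEventArray_eventInd hX hstat hreg ha ha_tail hM (.iUnion hD)
  measurable n := Finset.measurable_fun_sum _ fun i _ =>
    (measurable_eventInd _ (hD i).measurableSet).const_mul _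
  pos := add_pos_of_nonneg_of_pos (Finset.sum_nonneg fun i _ => abs_nonneg _) one_pos
  dominated n v :=
    calc |∑ i, z i * eventInd (a (m n)) (D i) v|
        ≤ ∑ i, |z i * eventInd (a (m n)) (D i) v| := Finset.abs_sum_le_sum_abs _ _
      _ ≤ ∑ i, |z i| * eventInd (a (m n)) (⋃ i, D i) v := Finset.sum_le_sum fun i _ => by
          rw [abs_mul, abs_of_nonneg (eventInd_mem_Icc _ _ v).1]
          gcongr
          exact eventInd_mono _ (Set.subset_iUnion D i) v
      _ ≤ (∑ i, |z i| + 1) * eventInd (a (m n)) (⋃ i, D i) v := by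
          rw [add_mul, Finset.sum_mul, one_mul]
          exact le_add_of_nonneg_right (eventInd_mem_Icc _ _ v).1

lemma tendsto_mul_lagProd_sum_eventInd (g : ℕ) :
    Tendsto (fun n => (m n : ℝ) *
      lagProd P X (fun v => ∑ i, z i * eventInd (a (m n)) (D i) v) g) atTop
      (𝓝 (∑ i, ∑ j, z i * z j * tau (nu P X a μ) (D i) (D j) g)) := by
  have hlim : Tendsto (fun n => ∑ i, ∑ j, z i * z j * ((m n : ℝ) *
      ∫ ω, eventInd (a (m n)) (D i) (X 0 ω) * eventInd (a (m n)) (D j) (X g ω) ∂P)) atTop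
      (𝓝 (∑ i, ∑ j, z i * z j * tau (nu P X a μ) (D i) (D j) g)) :=
    tendsto_finsetSum _ fun i _ => tendsto_finsetSum _ fun j _ =>
      (tendsto_mul_integral_eventInd_mul hX hstat hreg ha ha_tail hM (hD i) (hD j) g).const_mul _
  have hint : ∀ n i j, Integrable (fun ω =>
      eventInd (a (m n)) (D i) (X 0 ω) * eventInd (a (m n)) (D j) (X g ω)) P := fun n i j => by
    have hmeas := fun i => measurable_eventInd (a (m n)) (hD i).measurableSet
    exact Integrable.of_mem_Icc 0 1
      (((hmeas i).comp (hX 0)).mul ((hmeas j).comp (hX g))).aemeasurable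
      (ae_of_all _ fun _ => unitInterval.mul_mem (eventInd_mem_Icc _ _ _) (eventInd_mem_Icc _ _ _))
  refine hlim.congr fun n => ?_
  simp only [lagProd_sum_mul z g (hint n), Finset.mul_sum, mul_left_comm (m n : ℝ)]

lemma sum_tau_eq_sum_asympCov :
    ∑ i, ∑ j, z i * z j * tau (nu P X a μ) (D i) (D j) 0 +
      2 * ∑' g : ℕ, ∑ i, ∑ j, z i * z j * tau (nu P X a μ) (D i) (D j) (g + 1) =
    ∑ i, ∑ j, z i * z j * asympCov (marginal μ) (nu P X a μ) (D i) (D j) := by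
  set T : ι → ι → ℝ := fun i j => ∑' g : ℕ, tau (nu P X a μ) (D i) (D j) (g + 1)
  have hs : ∀ i j, Summable fun g : ℕ => tau (nu P X a μ) (D i) (D j) (g + 1) := fun i j =>
    (summable_nat_add_iff 1).2 (summable_tau hX hstat hreg ha ha_tail hM (hD i) (hD j))
  have htsum : ∑' g : ℕ, ∑ i, ∑ j, z i * z j * tau (nu P X a μ) (D i) (D j) (g + 1) =
      ∑ i, ∑ j, z i * z j * T i j :=
    (hasSum_sum fun i _ => hasSum_sum fun j _ => (hs i j).hasSum.mul_left (z i * z j)).tsum_eq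
  have hcov : ∀ i j, asympCov (marginal μ) (nu P X a μ) (D i) (D j) =
      tau (nu P X a μ) (D i) (D j) 0 + (T i j + T j i) := fun i j => by
    rw [asympCov, (hs i j).tsum_add (hs j i), tau_zero hstat hreg ha ha_tail (hD i).measurableSet
      (hD j).measurableSet]
  have hswap : ∑ i, ∑ j, z i * z j * T j i = ∑ i, ∑ j, z i * z j * T i j := by
    rw [Finset.sum_comm]
    simp only [mul_comm (z _) (z _)]
  simp only [hcov, mul_add, Finset.sum_add_distrib, htsum, hswap, two_mul]

end LinearCombinations

end Indicators

section Distribution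

lemma multivariateGaussian_zero_map_toEuclideanLin {ι κ : Type*} [Fintype ι] [DecidableEq ι]
    [Fintype κ] [DecidableEq κ] {S : Matrix ι ι ℝ} (hS : S.PosSemidef) (A : Matrix κ ι ℝ) :
    (multivariateGaussian 0 S).map A.toEuclideanLin =
      multivariateGaussian 0 (A * S * A.transpose) := by
  have hS' := hS.mul_mul_conjTranspose_same A
  rw [Matrix.conjTranspose_eq_transpose_of_trivial] at hS'
  set L := A.toEuclideanLin.toContinuousLinearMap with hL
  have hadj (x : EuclideanSpace ℝ κ) :
      (ContinuousLinearMap.adjoint L x).ofLp = A.transpose.mulVec x.ofLp := by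
    rw [hL, ← LinearMap.adjoint_toContinuousLinearMap,
      ← Matrix.toEuclideanLin_conjTranspose_eq_adjoint,
      Matrix.conjTranspose_eq_transpose_of_trivial]
    rfl
  change (multivariateGaussian 0 S).map L = _
  refine IsGaussian.ext ?_ ?_
  · simp only [id, L.integral_id_map IsGaussian.integrable_id, integral_id_multivariateGaussian,
      map_zero]
  · ext x y
    rw [covarianceBilin_map IsGaussian.memLp_two_id, covarianceBilin_multivariateGaussian hS,
      covarianceBilin_multivariateGaussian hS', hadj, hadj, Matrix.mulVec_transpose,
      ← Matrix.dotProduct_mulVec, Matrix.mulVec_mulVec, Matrix.mulVec_mulVec, Matrix.mul_assoc]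

variable {Ω : Type*} [MeasurableSpace Ω] {P : Measure Ω}

lemma tendstoInMeasure_const_of_tendsto_integral_of_tendsto_variance [IsFiniteMeasure P]
    {ι : Type*} {l : Filter ι} {Z : ι → Ω → ℝ} {c : ℝ} (hZ : ∀ n, MemLp (Z n) 2 P)
    (hmean : Tendsto (fun n => ∫ ω, Z n ω ∂P) l (𝓝 c))
    (hvar : Tendsto (fun n => Var[Z n; P]) l (𝓝 0)) :
    TendstoInMeasure P Z l fun _ => c := by
  rw [tendstoInMeasure_iff_norm]
  intro ε hε
  have hbound : Tendsto (fun n => ENNReal.ofReal (Var[Z n; P] / (ε / 2) ^ 2)) l (𝓝 0) := by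
    simpa using ENNReal.tendsto_ofReal (hvar.div_const ((ε / 2) ^ 2))
  refine tendsto_of_tendsto_of_tendsto_of_le_of_le' tendsto_const_nhds hbound
    (Eventually.of_forall fun _ => zero_le) ?_
  filter_upwards [Metric.tendsto_nhds.1 hmean (ε / 2) (half_pos hε)] with n hn
  refine (measure_mono fun ω hω => ?_).trans (meas_ge_le_variance_div_sq (hZ n) (half_pos hε))
  rw [Real.dist_eq] at hn
  have hω' : ε ≤ |Z n ω - c| := hω
  change ε / 2 ≤ |Z n ω - ∫ ω, Z n ω ∂P|
  linarith [abs_sub_le (Z n ω) (∫ ω, Z n ω ∂P) c]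

lemma tendstoInMeasure_comp_prodMk_const {ι E F G : Type*} {l : Filter ι} [PseudoEMetricSpace E]
    [TopologicalSpace F] [PseudoEMetricSpace G] {f : ι → Ω → E} {c : E} {u : ι → F} {b : F}
    {g : E × F → G} (hg : ContinuousAt g (c, b)) (hf : TendstoInMeasure P f l fun _ => c)
    (hu : Tendsto u l (𝓝 b)) :
    TendstoInMeasure P (fun n ω => g (f n ω, u n)) l fun _ => g (c, b) := by
  intro ε hε
  obtain ⟨U, hU, V, hV, hUV⟩ :=
    mem_nhds_prod_iff.1 (hg.preimage_mem_nhds (Metric.eball_mem_nhds _ hε))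
  obtain ⟨δ, hδ, hball⟩ := EMetric.mem_nhds_iff.1 hU
  refine tendsto_of_tendsto_of_tendsto_of_le_of_le' tendsto_const_nhds (hf δ hδ)
    (Eventually.of_forall fun _ => zero_le) ?_
  filter_upwards [hu hV] with n hn
  refine measure_mono fun ω hω => ?_
  by_contra hfar
  have hnear : edist (f n ω) c < δ := not_le.1 hfar
  have hclose : edist (g (f n ω, u n)) (g (c, b)) < ε :=
    hUV (Set.mk_mem_prod (hball hnear) hn)
  exact hclose.not_ge hω

variable [IsProbabilityMeasure P]

lemma tendstoInDistribution_of_tendsto_measure_ne {ι E E' : Type*} {l : Filter ι}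
    [l.IsCountablyGenerated] [SeminormedAddCommGroup E] [SecondCountableTopology E]
    [MeasurableSpace E] [BorelSpace E] [MeasurableSpace E'] {ρ : Measure E'}
    [IsProbabilityMeasure ρ] {S T : ι → Ω → E} {Z : E' → E}
    (hS : TendstoInDistribution S l Z (fun _ => P) ρ) (hT : ∀ n, AEMeasurable (T n) P)
    (hne : Tendsto (fun n => P {ω | T n ω ≠ S n ω}) l (𝓝 0)) :
    TendstoInDistribution T l Z (fun _ => P) ρ := by
  refine tendstoInDistribution_of_tendstoInMeasure_sub T Z hS (fun ε hε => ?_) hT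
  refine tendsto_of_tendsto_of_tendsto_of_le_of_le tendsto_const_nhds hne
    (fun _ => zero_le) fun n => measure_mono fun ω hω heq => ?_
  refine hε.not_ge (le_of_le_of_eq (Set.mem_ofPred_eq ▸ hω) ?_)
  simp [heq]

lemma tendstoInDistribution_of_map_eq {ι E E' : Type*} {l : Filter ι} [TopologicalSpace E]
    [MeasurableSpace E] [OpensMeasurableSpace E] [MeasurableSpace E'] {ρ : Measure E'}
    [IsProbabilityMeasure ρ] {ρ' : Measure E} [IsProbabilityMeasure ρ'] {T : ι → Ω → E}
    {Z : E' → E} (h : TendstoInDistribution T l Z (fun _ => P) ρ) (hZ : ρ.map Z = ρ') :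
    TendstoInDistribution T l id (fun _ => P) ρ' where
  forall_aemeasurable := h.forall_aemeasurable
  aemeasurable_limit := aemeasurable_id
  tendsto := h.tendsto.trans (le_of_eq (congrArg 𝓝 (Subtype.ext (hZ.trans Measure.map_id.symm))))

end Distribution

section LimitCovariance

variable {d h : ℕ} {μ : Measure (Fin d → EReal)} {ν : (h : ℕ) → Measure (ExtSpace h d)}
  {D : Fin (h + 1) → Set (Fin d → EReal)}

lemma FMat_mulVec (z : Fin (h + 1) → ℝ) (i : Fin h) : (FMat μ D).mulVec z i =
    μ.real (D (Fin.last h)) * z i.castSucc - μ.real (D i.castSucc) * z (Fin.last h) := by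
  simp only [Matrix.mulVec, dotProduct, FMat, Fin.sum_univ_castSucc, if_true, Fin.castSucc_ne_last,
    if_false, Fin.castSucc_inj, ite_mul, zero_mul, Finset.sum_ite_eq', Finset.mem_univ]
  ring

-- `c⁻² F` is the derivative of `(x, y) ↦ x / y` at the point with coordinates `μ(D_i)`.
lemma smul_FMat_mulVec (hpos : μ.real (D (Fin.last h)) ≠ 0) (z : Fin (h + 1) → ℝ) (i : Fin h) :
    ((μ.real (D (Fin.last h)) ^ 2)⁻¹ • FMat μ D).mulVec z i = (μ.real (D (Fin.last h)))⁻¹ *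
      (z i.castSucc - ratio μ (D (Fin.last h)) (D i.castSucc) * z (Fin.last h)) := by
  rw [Matrix.smul_mulVec, Pi.smul_apply, smul_eq_mul, FMat_mulVec, ratio]
  field_simp

lemma limitCov_eq_mul_mul_transpose : limitCov μ ν D =
    ((μ.real (D (Fin.last h)) ^ 2)⁻¹ • FMat μ D) * SigmaMat μ ν D *
      ((μ.real (D (Fin.last h)) ^ 2)⁻¹ • FMat μ D).transpose := by
  rw [limitCov, Matrix.transpose_smul, Matrix.smul_mul, Matrix.smul_mul, Matrix.mul_smul,
    smul_smul, ← mul_inv, ← pow_add]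

lemma posSemidef_limitCov (hS : (SigmaMat μ ν D).PosSemidef) : (limitCov μ ν D).PosSemidef := by
  rw [limitCov_eq_mul_mul_transpose, ← Matrix.conjTranspose_eq_transpose_of_trivial]
  exact hS.mul_mul_conjTranspose_same _

lemma isHermitian_SigmaMat : (SigmaMat μ ν D).IsHermitian := by
  ext i j
  simp only [Matrix.conjTranspose_apply, SigmaMat, asympCov, star_trivial, Set.inter_comm (D j),
    add_comm (tau _ (D j) _ _)]

lemma dotProduct_SigmaMat_mulVec (z : Fin (h + 1) → ℝ) : z ⬝ᵥ (SigmaMat μ ν D).mulVec z =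
    ∑ i, ∑ j, z i * z j * asympCov μ ν (D i) (D j) := by
  simp only [dotProduct, Matrix.mulVec, Finset.mul_sum, SigmaMat, mul_assoc,
    mul_comm (asympCov _ _ _ _)]

end LimitCovariance

section RatioEstimators

variable {Ω : Type*} [mΩ : MeasurableSpace Ω] {d : ℕ} {P : Measure Ω}
  {X : ℤ → Ω → EuclideanSpace ℝ (Fin d)} {a : ℕ → ℝ} {m r : ℕ → ℕ} {α : ℝ}
  {μ : (h : ℕ) → Measure (ExtSpace h d)} {n : ℕ} {C D : Set (Fin d → EReal)}

omit mΩ in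
lemma Phat_eq_sum_eventInd (ω : Ω) : Phat X a m C n ω =
    (m n : ℝ) / n * ∑ t ∈ Finset.Icc 1 n, eventInd (a (m n)) C (X (t : ℤ) ω) := by
  classical
  simp only [Phat, eventInd, Set.indicator_apply, Set.mem_preimage, Pi.one_apply]

lemma Phat_eq_add_normalizedSum (hX : ∀ t, Measurable (X t)) (hC : MeasurableSet C) (hn : 0 < n)
    (ω : Ω) : Phat X a m C n ω = m n * tailProb P X a m C n +
      √((m n : ℝ) / n) * normalizedSum P X m (fun n => eventInd (a (m n)) C) n ω := by
  have hn0 : (n : ℝ) ≠ 0 := Nat.cast_ne_zero.2 hn.ne'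
  simp only [normalizedSum, standardized, ← Finset.mul_sum, Finset.sum_sub_distrib]
  rw [Phat_eq_sum_eventInd, ← mul_assoc, Real.mul_self_sqrt (by positivity),
    integral_eventInd hX _ hC, Finset.sum_const, Nat.card_Icc, Nat.add_sub_cancel, nsmul_eq_mul,
    tailProb]
  field_simp
  ring

lemma measurable_Phat (hX : ∀ t, Measurable (X t)) (hC : MeasurableSet C) :
    Measurable (Phat X a m C n) := by
  rw [funext fun ω => Phat_eq_sum_eventInd (X := X) (a := a) (m := m) (n := n) (C := C) ω]
  exact (Finset.measurable_fun_sum _ fun _ _ =>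
    (measurable_eventInd _ hC).comp (hX _)).const_mul _

lemma sqrt_mul_Rhat_sub_Rpre_eq (hX : ∀ t, Measurable (X t)) (hC : MeasurableSet C)
    (hD : MeasurableSet D) (hm : 0 < m n) (hn : 0 < n) (htail : tailProb P X a m C n ≠ 0) {ω : Ω}
    (hω : Phat X a m C n ω ≠ 0) :
    √((n : ℝ) / m n) * (Rhat X a m C D n ω - Rpre P X a m C D n) = (Phat X a m C n ω)⁻¹ *
      (normalizedSum P X m (fun n => eventInd (a (m n)) D) n ω -
        Rpre P X a m C D n * normalizedSum P X m (fun n => eventInd (a (m n)) C) n ω) := by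
  have hm0 : (0 : ℝ) < m n := Nat.cast_pos.2 hm
  have hn0 : (0 : ℝ) < n := Nat.cast_pos.2 hn
  set GC := normalizedSum P X m (fun n => eventInd (a (m n)) C) n ω
  set GD := normalizedSum P X m (fun n => eventInd (a (m n)) D) n ω
  have hsqrt : √((n : ℝ) / m n) * √((m n : ℝ) / n) = 1 := by
    rw [← Real.sqrt_mul (by positivity), div_mul_div_cancel₀ hm0.ne', div_self hn0.ne',
      Real.sqrt_one]
  have hnum : Phat X a m D n ω - Rpre P X a m C D n * Phat X a m C n ω =
      √((m n : ℝ) / n) * (GD - Rpre P X a m C D n * GC) := by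
    rw [Phat_eq_add_normalizedSum (P := P) hX hC hn, Phat_eq_add_normalizedSum (P := P) hX hD hn,
      Rpre]
    field_simp
    ring
  calc √((n : ℝ) / m n) * (Rhat X a m C D n ω - Rpre P X a m C D n)
      = √((n : ℝ) / m n) * ((Phat X a m C n ω)⁻¹ *
          (Phat X a m D n ω - Rpre P X a m C D n * Phat X a m C n ω)) := by
        rw [Rhat]
        field_simp
    _ = √((n : ℝ) / m n) * √((m n : ℝ) / n) * ((Phat X a m C n ω)⁻¹ *
          (GD - Rpre P X a m C D n * GC)) := by
        rw [hnum]
        ring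
    _ = _ := by rw [hsqrt, one_mul]

variable [IsProbabilityMeasure P] (hX : ∀ t, Measurable (X t))

include hX

lemma normalizedSum_sum {ι : Type*} [Fintype ι] {f : ι → ℕ → EuclideanSpace ℝ (Fin d) → ℝ}
    (hf : ∀ j, Measurable (f j n)) (hf01 : ∀ j x, f j n x ∈ Set.Icc 0 1) (z : ι → ℝ) (ω : Ω) :
    normalizedSum P X m (fun n v => ∑ j, z j * f j n v) n ω =
      ∑ j, z j * normalizedSum P X m (f j) n ω := by
  have hint : ∀ j, Integrable (fun ω => z j * f j n (X 0 ω)) P := fun j =>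
    ((memLp_of_mem_unitInterval ((hf j).comp (hX 0)) (fun ω => hf01 j _) 1).integrable
      le_rfl).const_mul _
  simp only [normalizedSum, standardized]
  rw [integral_finsetSum _ fun j _ => hint j]
  simp only [integral_const_mul, ← Finset.sum_sub_distrib, ← mul_sub, Finset.mul_sum]
  rw [Finset.sum_comm]
  simp only [mul_left_comm]

variable (hstat : IsStrictlyStationary P X) (hreg : IsRegularlyVarying P X α μ)
  (ha : Tendsto a atTop atTop)
  (ha_tail : Tendsto (fun n : ℕ => (n : ℝ) * P.real {ω | a n < ‖X 0 ω‖}) atTop (𝓝 1))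
  (hM : MixingCondition P X a m r)

include hstat hreg ha ha_tail hM

section SingleSet

variable (hC : IsAdmissible (marginal μ) C)

include hC

lemma tendsto_integral_Phat :
    Tendsto (fun n => ∫ ω, Phat X a m C n ω ∂P) atTop (𝓝 ((marginal μ).real C)) := by
  have hA := (rareEventArray_eventInd hX hstat hreg ha ha_tail hM hC).tailArray
  refine (tendsto_mul_tailProb hX hstat hreg ha ha_tail hM hC).congr' ?_
  filter_upwards [eventually_gt_atTop 0] with n hn
  have hint : Integrable (normalizedSum P X m (fun n => eventInd (a (m n)) C) n) P :=
    (hA.memLp_sum_standardized hX n (Finset.Icc 1 n) (fun t => t) 1).integrable le_rfl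
  have hcentred : ∫ ω, normalizedSum P X m (fun n => eventInd (a (m n)) C) n ω ∂P = 0 :=
    hA.integral_sum_standardized hX hstat n _ fun t => t
  simp only [Phat_eq_add_normalizedSum (P := P) hX hC.measurableSet hn]
  rw [integral_add (integrable_const _) (hint.const_mul _), integral_const, probReal_univ, one_smul,
    integral_const_mul, hcentred, mul_zero, add_zero]

lemma tendsto_variance_Phat : Tendsto (fun n => Var[Phat X a m C n; P]) atTop (𝓝 0) := by
  have hA := (rareEventArray_eventInd hX hstat hreg ha ha_tail hM hC).tailArray
  obtain ⟨K, hK⟩ := hA.exists_variance_sum_standardized_le hX hstat hM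
  have hbound : Tendsto (fun n : ℕ => (m n : ℝ) / n * (2 * K)) atTop (𝓝 0) := by
    simpa using hM.m_div_n.mul_const (2 * K)
  refine tendsto_of_tendsto_of_tendsto_of_le_of_le' tendsto_const_nhds hbound
    (Eventually.of_forall fun _ => variance_nonneg _ _) ?_
  filter_upwards [hK, eventually_gt_atTop 0] with n hKn hn
  have hn0 : (n : ℝ) ≠ 0 := Nat.cast_ne_zero.2 hn.ne'
  have hmeas : Measurable (normalizedSum P X m (fun n => eventInd (a (m n)) C) n) :=
    measurable_normalizedSum hX (measurable_eventInd _ hC.measurableSet)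
  have hvar : Var[normalizedSum P X m (fun n => eventInd (a (m n)) C) n; P] ≤ 2 * K := by
    have hle := hKn (Finset.Icc 1 n) subset_rfl
    rwa [Nat.card_Icc, Nat.add_sub_cancel, div_self hn0, mul_one] at hle
  rw [funext fun ω => Phat_eq_add_normalizedSum (P := P) (a := a) (m := m) hX hC.measurableSet hn ω,
    variance_const_add (hmeas.const_mul _).aestronglyMeasurable, variance_const_mul,
    Real.sq_sqrt (by positivity)]
  gcongr

theorem tendstoInMeasure_Phat :
    TendstoInMeasure P (Phat X a m C) atTop fun _ => (marginal μ).real C := by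
  refine tendstoInMeasure_const_of_tendsto_integral_of_tendsto_variance (fun n => ?_)
    (tendsto_integral_Phat hX hstat hreg ha ha_tail hM hC)
    (tendsto_variance_Phat hX hstat hreg ha ha_tail hM hC)
  have hA := (rareEventArray_eventInd hX hstat hreg ha ha_tail hM hC).tailArray
  rw [funext fun ω => Phat_eq_sum_eventInd (X := X) (a := a) (m := m) (n := n) (C := C) ω]
  exact (memLp_finsetSum (Finset.Icc 1 n) fun t _ => hA.memLp hX n (t : ℕ) 2).const_mul _

variable (hpos : 0 < (marginal μ).real C)

include hpos

lemma tendsto_measure_Phat_eq_zero :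
    Tendsto (fun n => P {ω | Phat X a m C n ω = 0}) atTop (𝓝 0) := by
  refine tendsto_of_tendsto_of_tendsto_of_le_of_le tendsto_const_nhds
    (tendstoInMeasure_Phat hX hstat hreg ha ha_tail hM hC (ENNReal.ofReal ((marginal μ).real C))
      (ENNReal.ofReal_pos.2 hpos)) (fun _ => zero_le) fun n => measure_mono fun ω hω => ?_
  have hzero : Phat X a m C n ω = 0 := hω
  rw [Set.mem_ofPred_eq, hzero, edist_dist, dist_zero_left, Real.norm_of_nonneg hpos.le]

lemma eventually_tailProb_ne_zero : ∀ᶠ n in atTop, tailProb P X a m C n ≠ 0 :=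
  ((tendsto_mul_tailProb hX hstat hreg ha ha_tail hM hC).eventually_ne hpos.ne').mono
    fun _ => right_ne_zero_of_mul

lemma tendsto_Rpre (hD : IsAdmissible (marginal μ) D) :
    Tendsto (Rpre P X a m C D) atTop (𝓝 (ratio (marginal μ) C D)) := by
  refine ((tendsto_mul_tailProb hX hstat hreg ha ha_tail hM hD).div
    (tendsto_mul_tailProb hX hstat hreg ha ha_tail hM hC) hpos.ne').congr' ?_
  filter_upwards [hM.eventually_pos] with n hn
  exact mul_div_mul_left _ _ (Nat.cast_ne_zero.2 hn.1.ne')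

lemma tendsto_sqrt_mul_Rpre_sub_ratio
    (hbias : Tendsto (fun n : ℕ => √((n : ℝ) * m n) * ((marginal μ).real D * tailProb P X a m C n -
      (marginal μ).real C * tailProb P X a m D n)) atTop (𝓝 0)) :
    Tendsto (fun n : ℕ => √((n : ℝ) / m n) *
      (Rpre P X a m C D n - ratio (marginal μ) C D)) atTop (𝓝 0) := by
  have hmean := tendsto_mul_tailProb hX hstat hreg ha ha_tail hM hC
  have hlim := hbias.neg.div (hmean.mul_const ((marginal μ).real C)) (by positivity)
  rw [neg_zero, zero_div] at hlim
  refine hlim.congr' ?_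
  filter_upwards [hM.eventually_pos,
    eventually_tailProb_ne_zero hX hstat hreg ha ha_tail hM hC hpos] with n hn htail
  have hm0 : (0 : ℝ) < m n := Nat.cast_pos.2 hn.1
  have hsqrt : √((n : ℝ) * m n) = √((n : ℝ) / m n) * m n := by
    rw [← Real.sqrt_mul_self hm0.le, ← Real.sqrt_mul (by positivity), Real.sqrt_mul_self hm0.le]
    congr 1
    field_simp
  rw [Pi.div_apply, hsqrt, Rpre, ratio]
  field_simp
  ring

end SingleSet

section FiniteFamily

variable {h : ℕ} {D : Fin (h + 1) → Set (Fin d → EReal)}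
  (hD : ∀ i, IsAdmissible (marginal μ) (D i))

include hD

lemma posSemidef_SigmaMat : (SigmaMat (marginal μ) (nu P X a μ) D).PosSemidef := by
  refine Matrix.PosSemidef.of_dotProduct_mulVec_nonneg isHermitian_SigmaMat fun z => ?_
  have hvar := (tailArray_sum_eventInd hX hstat hreg ha ha_tail hM hD z).limit_variance_nonneg
    hX hstat hM (tendsto_mul_lagProd_sum_eventInd hX hstat hreg ha ha_tail hM hD z)
  rwa [sum_tau_eq_sum_asympCov hX hstat hreg ha ha_tail hM hD, ← dotProduct_SigmaMat_mulVec] at hvar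

variable (hg : GrowthCondition P X m r)

include hg

theorem tendstoInDistribution_normalizedSum :
    TendstoInDistribution (fun (n : ℕ) (ω : Ω) => WithLp.toLp 2 fun j : Fin (h + 1) =>
        normalizedSum P X m (fun n => eventInd (a (m n)) (D j)) n ω)
      atTop (id : EuclideanSpace ℝ (Fin (h + 1)) → EuclideanSpace ℝ (Fin (h + 1))) (fun _ => P)
      (multivariateGaussian 0 (SigmaMat (marginal μ) (nu P X a μ) D)) := by
  have hS := posSemidef_SigmaMat hX hstat hreg ha ha_tail hM hD
  have hind := fun (n : ℕ) j => measurable_eventInd (a (m n)) (hD j).measurableSet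
  have hmeas : ∀ n, Measurable fun ω => (WithLp.toLp 2 fun j : Fin (h + 1) =>
      normalizedSum P X m (fun n => eventInd (a (m n)) (D j)) n ω :
        EuclideanSpace ℝ (Fin (h + 1))) := fun n =>
    (WithLp.measurable_toLp 2 _).comp (measurable_pi_lambda _ fun j =>
      measurable_normalizedSum hX (hind n j))
  refine ⟨fun n => (hmeas n).aemeasurable, aemeasurable_id, ?_⟩
  refine ProbabilityMeasure.tendsto_iff_tendsto_charFun.2 fun z => ?_
  have hclt := (tailArray_sum_eventInd hX hstat hreg ha ha_tail hM hD
    z.ofLp).tendsto_integral_exp_normalizedSum hX hstat hM hg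
      (tendsto_mul_lagProd_sum_eventInd hX hstat hreg ha ha_tail hM hD z.ofLp)
  rw [sum_tau_eq_sum_asympCov hX hstat hreg ha ha_tail hM hD, ← dotProduct_SigmaMat_mulVec] at hclt
  simp only [ProbabilityMeasure.coe_mk, Measure.map_id]
  rw [charFun_multivariateGaussian hS, inner_zero_right, Complex.ofReal_zero, zero_mul, zero_sub,
    ← neg_div]
  refine hclt.congr fun n => ?_
  rw [charFun_apply, integral_map (hmeas n).aemeasurable (by fun_prop)]
  have hlin := normalizedSum_sum (P := P) (m := m) hX (hind n)
    (f := fun j n => eventInd (a (m n)) (D j)) (fun j => eventInd_mem_Icc _ (D j)) z.ofLp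
  simp only [hlin, EuclideanSpace.inner_eq_star_dotProduct, star_trivial, dotProduct]

variable (hpos : 0 < (marginal μ).real (D (Fin.last h)))

include hpos

theorem tendstoInDistribution_Rhat_sub_Rpre :
    TendstoInDistribution (fun (n : ℕ) (ω : Ω) => WithLp.toLp 2 fun i : Fin h =>
        √((n : ℝ) / m n) * (Rhat X a m (D (Fin.last h)) (D i.castSucc) n ω -
          Rpre P X a m (D (Fin.last h)) (D i.castSucc) n))
      atTop (id : EuclideanSpace ℝ (Fin h) → EuclideanSpace ℝ (Fin h)) (fun _ => P)
      (multivariateGaussian 0 (limitCov (marginal μ) (nu P X a μ) D)) := by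
  set C := D (Fin.last h)
  have hC : IsAdmissible (marginal μ) C := hD (Fin.last h)
  set ρ : Fin h → ℝ := fun i => ratio (marginal μ) C (D i.castSucc)
  set ρn : ℕ → Fin h → ℝ := fun n i => Rpre P X a m C (D i.castSucc) n
  have hρ : Tendsto ρn atTop (𝓝 ρ) := tendsto_pi_nhds.2 fun i =>
    tendsto_Rpre hX hstat hreg ha ha_tail hM hC hpos (hD i.castSucc)
  have hmeas := fun n j => measurable_Phat (a := a) (m := m) (n := n) hX (hD j).measurableSet
  have hnuisance : TendstoInMeasure P (fun n ω => ((Phat X a m C n ω)⁻¹, ρn n)) atTop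
      fun _ => (((marginal μ).real C)⁻¹, ρ) :=
    tendstoInMeasure_comp_prodMk_const (g := fun q : ℝ × (Fin h → ℝ) => (q.1⁻¹, q.2))
      ((continuousAt_fst.inv₀ hpos.ne').prodMk continuousAt_snd)
      (tendstoInMeasure_Phat hX hstat hreg ha ha_tail hM hC) hρ
  set g : EuclideanSpace ℝ (Fin (h + 1)) × (ℝ × (Fin h → ℝ)) → EuclideanSpace ℝ (Fin h) :=
    fun q => WithLp.toLp 2 fun i => q.2.1 * (q.1 i.castSucc - q.2.2 i * q.1 (Fin.last h))
  have hg_cont : Continuous g := by fun_prop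
  have hslutsky := (tendstoInDistribution_normalizedSum hX hstat hreg ha ha_tail hM hD
    hg).continuous_comp_prodMk_of_tendstoInMeasure_const hg_cont hnuisance
      fun n => ((hmeas n _).inv.prodMk measurable_const).aemeasurable
  refine tendstoInDistribution_of_map_eq
    (tendstoInDistribution_of_tendsto_measure_ne hslutsky (fun n => ?_) ?_) ?_
  · exact ((WithLp.measurable_toLp 2 _).comp (measurable_pi_lambda _ fun i =>
      (((hmeas n _).div (hmeas n _)).sub_const _).const_mul _)).aemeasurable
  · refine tendsto_of_tendsto_of_tendsto_of_le_of_le' tendsto_const_nhds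
      (tendsto_measure_Phat_eq_zero hX hstat hreg ha ha_tail hM hC hpos)
      (Eventually.of_forall fun _ => zero_le) ?_
    filter_upwards [hM.eventually_pos,
      eventually_tailProb_ne_zero hX hstat hreg ha ha_tail hM hC hpos] with n hn htail
    refine measure_mono fun ω => not_imp_not.1 fun hω => not_not.2 (congrArg _ (funext fun i => ?_))
    exact sqrt_mul_Rhat_sub_Rpre_eq hX hC.measurableSet (hD _).measurableSet hn.1 hn.2.2.1 htail hω
  · rw [limitCov_eq_mul_mul_transpose, ← multivariateGaussian_zero_map_toEuclideanLin
      (posSemidef_SigmaMat hX hstat hreg ha ha_tail hM hD)]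
    congr 1
    ext z i
    exact (smul_FMat_mulVec hpos.ne' z.ofLp i).symm

theorem tendstoInDistribution_Rhat_sub_ratio
    (hbias : ∀ i : Fin h, Tendsto (fun n : ℕ => √((n : ℝ) * m n) *
      ((marginal μ).real (D i.castSucc) * tailProb P X a m (D (Fin.last h)) n -
        (marginal μ).real (D (Fin.last h)) * tailProb P X a m (D i.castSucc) n)) atTop (𝓝 0)) :
    TendstoInDistribution (fun (n : ℕ) (ω : Ω) => WithLp.toLp 2 fun i : Fin h =>
        √((n : ℝ) / m n) * (Rhat X a m (D (Fin.last h)) (D i.castSucc) n ω -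
          ratio (marginal μ) (D (Fin.last h)) (D i.castSucc)))
      atTop (id : EuclideanSpace ℝ (Fin h) → EuclideanSpace ℝ (Fin h)) (fun _ => P)
      (multivariateGaussian 0 (limitCov (marginal μ) (nu P X a μ) D)) := by
  set C := D (Fin.last h)
  set bias : ℕ → EuclideanSpace ℝ (Fin h) := fun n => WithLp.toLp 2 fun i =>
    √((n : ℝ) / m n) * (Rpre P X a m C (D i.castSucc) n - ratio (marginal μ) C (D i.castSucc))
  have hbias0 : Tendsto bias atTop (𝓝 0) :=
    ((PiLp.continuous_toLp 2 _).tendsto 0).comp (tendsto_pi_nhds.2 fun i =>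
      tendsto_sqrt_mul_Rpre_sub_ratio hX hstat hreg ha ha_tail hM (hD _) hpos (hbias i))
  have hshift := (tendstoInDistribution_Rhat_sub_Rpre hX hstat hreg ha ha_tail hM hD hg
    hpos).add_of_tendstoInMeasure_const (tendstoInMeasure_of_tendsto_ae
      (fun n => aestronglyMeasurable_const (b := bias n)) (ae_of_all P fun _ => hbias0))
        fun n => aemeasurable_const
  refine hshift.congr (fun n => ae_of_all _ fun ω => ?_) (ae_of_all _ fun z => add_zero z)
  ext i
  change _ * (_ - Rpre P X a m C (D i.castSucc) n) + _ * _ = _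
  rw [← mul_add, sub_add_sub_cancel]

end FiniteFamily

end RatioEstimators

end Extremogram

open Extremogram in
theorem corollary3p3 {Ω : Type*} [MeasurableSpace Ω] (P : Measure Ω) [IsProbabilityMeasure P]
    (d : ℕ) (X : ℤ → Ω → EuclideanSpace ℝ (Fin d)) (hX : ∀ t, Measurable (X t))
    (hstat : IsStrictlyStationary P X)
    (α : ℝ) (hα : 0 < α) (μ : (h : ℕ) → Measure (ExtSpace h d))
    (hreg : IsRegularlyVarying P X α μ)
    (a : ℕ → ℝ) (ha : Tendsto a atTop atTop)
    (ha_tail : Tendsto (fun n : ℕ => (n : ℝ) * P.real {ω | a n < ‖X 0 ω‖}) atTop (𝓝 1))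
    (m r : ℕ → ℕ) (hM : MixingCondition P X a m r) (hgrowth : GrowthCondition P X m r)
    (h : ℕ) (D : Fin h → Set (Fin d → EReal)) (C : Set (Fin d → EReal))
    (hD : ∀ i, IsAdmissible (marginal μ) (D i)) (hC : IsAdmissible (marginal μ) C)
    (hCpos : 0 < marginal μ C) :
    -- the series in the covariances converge, and the limit covariance matrix is a genuine one
    (∀ i j : Fin (h + 1), Summable fun ℓ : ℕ =>
      tau (nu P X a μ) (Fin.snoc (α := fun _ => Set (Fin d → EReal)) D C i)
        (Fin.snoc (α := fun _ => Set (Fin d → EReal)) D C j) (ℓ + 1)) ∧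
    (limitCov (marginal μ) (nu P X a μ)
      (Fin.snoc (α := fun _ => Set (Fin d → EReal)) D C)).PosSemidef ∧
    -- centering at the pre-asymptotic ratios
    TendstoInDistribution
      (fun (n : ℕ) (ω : Ω) => WithLp.toLp 2 fun i : Fin h =>
        Real.sqrt ((n : ℝ) / m n) * (Rhat X a m C (D i) n ω - Rpre P X a m C (D i) n))
      atTop (id : EuclideanSpace ℝ (Fin h) → EuclideanSpace ℝ (Fin h)) (fun _ => P)
      (multivariateGaussian 0 (limitCov (marginal μ) (nu P X a μ)
        (Fin.snoc (α := fun _ => Set (Fin d → EReal)) D C))) ∧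
    -- centering at the true ratios, under the bias condition
    ((∀ i, Tendsto (fun n : ℕ => Real.sqrt ((n : ℝ) * m n) *
        ((marginal μ).real (D i) * tailProb P X a m C n -
          (marginal μ).real C * tailProb P X a m (D i) n)) atTop (𝓝 0)) →
      TendstoInDistribution
        (fun (n : ℕ) (ω : Ω) => WithLp.toLp 2 fun i : Fin h =>
          Real.sqrt ((n : ℝ) / m n) * (Rhat X a m C (D i) n ω - ratio (marginal μ) C (D i)))
        atTop (id : EuclideanSpace ℝ (Fin h) → EuclideanSpace ℝ (Fin h)) (fun _ => P)
        (multivariateGaussian 0 (limitCov (marginal μ) (nu P X a μ)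
          (Fin.snoc (α := fun _ => Set (Fin d → EReal)) D C)))) := by
  have hD' : ∀ i, IsAdmissible (marginal μ)
      (Fin.snoc (α := fun _ => Set (Fin d → EReal)) D C i) :=
    Fin.lastCases (by simpa only [Fin.snoc_last] using hC)
      fun i => by simpa only [Fin.snoc_castSucc] using hD i
  have hfin : marginal μ C < ∞ :=
    hreg.isFiniteAwayFrom_marginal.lt_top_of_notMem_closure hC.bounded_away
  have hpos : 0 < (marginal μ).real C := ENNReal.toReal_pos hCpos.ne' hfin.ne
  refine ⟨fun i j => (summable_nat_add_iff 1).2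
      (summable_tau hX hstat hreg ha ha_tail hM (hD' i) (hD' j)),
    posSemidef_limitCov (posSemidef_SigmaMat hX hstat hreg ha ha_tail hM hD'), ?_,
    fun hbias => ?_⟩
  · simpa only [Fin.snoc_last, Fin.snoc_castSucc] using
      tendstoInDistribution_Rhat_sub_Rpre hX hstat hreg ha ha_tail hM hD' hgrowth
        (by simpa only [Fin.snoc_last] using hpos)
  · simpa only [Fin.snoc_last, Fin.snoc_castSucc] using
      tendstoInDistribution_Rhat_sub_ratio hX hstat hreg ha ha_tail hM hD' hgrowth
        (by simpa only [Fin.snoc_last] using hpos)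
        (by simpa only [Fin.snoc_last, Fin.snoc_castSucc] using hbias)
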